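/- Let $(M,\bar g,J)$ be a Kähler–Einstein manifold of real dimension $2n$ with (constant) scalar curvature $\bar R$, i.e. $\overline{\mathrm{Ric}}=\frac{\bar R}{2n}\bar g$, and let $\bar\omega(\cdot,\cdot)=\bar g(J\cdot,\cdot)$ be its Kähler form. Let $L$ be a compact connected $n$-dimensional manifold without boundary, and let $\phi_s:L\to M$, $s\in(-\eta,\eta)$, be a smooth family of immersions that is a hamiltonian deformation, i.e. for each $s$ the one-form $v\mapsto\bar\omega\big(\tfrac{\partial\phi_s}{\partial s},d\phi_s(v)\big)$ on $L$ is exact. Suppose that $L_0=\phi_0(L)$ is a minimal Lagrangian submanifold ($\phi_0^*\bar\omega=0$ and the mean curvature vector of $\phi_0$ vanishes), that the first (least positive) eigenvalue $\lambda_1$ of the Laplacian $-\Delta$ of the metric induced by $\phi_0$ on $L$ is $\lambda_1=\frac{\bar R}{2n}$, and that the initial velocity is $X=\frac{\partial\phi_s}{\partial s}\big|_{s=0}=J\nabla f$ for a smooth function $f$ on $L$, where $\nabla$ is the gradient of the induced metric and $\nabla f$ is regarded as a vector field along $\phi_0$. Call a vector field $X$ along $\phi_0$ an essential hamiltonian variation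 of $L_0$ if $X\neq 0$ and $X=J\nabla u$ for some smooth $u$ with $\int_L u\,d\mu_0=0$ and $u\notin E_{\lambda_1}$, where $\mu_0$ is the induced Riemannian measure and $E_{\lambda_1}=\{u:-\Delta u=\lambda_1u\}$ is the first eigenspace. Let $\mathrm{Vol}(L_s)$ be the volume of $L$ in the metric induced by $\phi_s$. Then $s\mapsto\mathrm{Vol}(L_s)$ is twice continuously differentiable near $s=0$, and $X$ is an essential hamiltonian variation of $L_0$ if and only if $$\frac{d^2}{ds^2}\mathrm{Vol}(L_s)\Big|_{s=0}>0 .$$ -/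

import Mathlib

open Set MeasureTheory Bundle
open scoped Manifold ContDiff Topology

noncomputable section

namespace LagVar

/-! ### Riemannian geometry in one coordinate system

A metric on (an open subset of) `ℝᵐ` is a map `g : ℝᵐ → (ℝᵐ →L ℝᵐ →L ℝ)`. Musical isomorphisms are
written with `ContinuousLinearMap.inverse (g y)`, which is the inverse of `v ↦ g y v ·` as soon as
`g y` is nondegenerate. -/

/-- Coordinate space `ℝᵐ`. -/
abbrev Euc (m : ℕ) : Type := EuclideanSpace ℝ (Fin m)

/-- The `i`-th standard basis vector. -/
def stdVec {m : ℕ} (i : Fin m) : Euc m := EuclideanSpace.single i (1 : ℝ)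

/-- The vector `g^{ij} ∂_j`, that is, the `i`-th coordinate covector with its index raised. -/
def dualVec {m : ℕ} (g : Euc m → Euc m →L[ℝ] Euc m →L[ℝ] ℝ) (y : Euc m) (i : Fin m) : Euc m :=
  (g y).inverse (EuclideanSpace.proj i)

/-- The density `√(det g_{ij})`. -/
def sqrtDet {m : ℕ} (g : Euc m → Euc m →L[ℝ] Euc m →L[ℝ] ℝ) (y : Euc m) : ℝ :=
  Real.sqrt (Matrix.of fun i j : Fin m => g y (stdVec i) (stdVec j)).det

/-- Christoffel symbols `Γ(v, w)`, given by
`g(Γ(v, w), z) = (D_v g(w, z) + D_w g(v, z) - D_z g(v, w)) / 2`. -/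
def christoffel {m : ℕ} (g : Euc m → Euc m →L[ℝ] Euc m →L[ℝ] ℝ) (y v w : Euc m) : Euc m :=
  (g y).inverse ((1 / 2 : ℝ) •
    (fderiv ℝ g y v w + fderiv ℝ g y w v - ((fderiv ℝ g y).flip v).flip w))

/-- Curvature `R(u, v) w = ∇_u ∇_v w - ∇_v ∇_u w` of the Levi-Civita connection, for the constant
fields `u, v, w`. -/
def riemann {m : ℕ} (g : Euc m → Euc m →L[ℝ] Euc m →L[ℝ] ℝ) (y u v w : Euc m) : Euc m :=
  fderiv ℝ (fun z => christoffel g z v w) y u - fderiv ℝ (fun z => christoffel g z u w) y v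
    + christoffel g y u (christoffel g y v w) - christoffel g y v (christoffel g y u w)

/-- Ricci curvature `Ric(v, w) = tr (u ↦ R(u, v) w)`, positive on round spheres. -/
def ricci {m : ℕ} (g : Euc m → Euc m →L[ℝ] Euc m →L[ℝ] ℝ) (y v w : Euc m) : ℝ :=
  ∑ i : Fin m, riemann g y (stdVec i) v w i

/-- Scalar curvature `g^{ij} Ric_{ij}`. -/
def scalarCurvature {m : ℕ} (g : Euc m → Euc m →L[ℝ] Euc m →L[ℝ] ℝ) (y : Euc m) : ℝ :=
  ∑ i : Fin m, ricci g y (stdVec i) (dualVec g y i)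

/-- Laplace-Beltrami operator `Δu = (√det g)⁻¹ ∂_i (√det g · g^{ij} ∂_j u)`. -/
def laplaceCoord {m : ℕ} (g : Euc m → Euc m →L[ℝ] Euc m →L[ℝ] ℝ) (u : Euc m → ℝ) (y : Euc m) : ℝ :=
  (sqrtDet g y)⁻¹ * ∑ i : Fin m,
    fderiv ℝ (fun z => sqrtDet g z * ((g z).inverse (fderiv ℝ u z)) i) y (stdVec i)

/-! ### Manifolds with a field of bilinear forms -/

section Manifold

variable {m : ℕ} {N : Type*} [TopologicalSpace N] [ChartedSpace (Euc m) N]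

/-- The pullback of a field `h` of bilinear forms on the tangent spaces under the inverse of a
chart `e`: the coordinate expression of `h`. -/
def inChart (h : ∀ x : N, TangentSpace (𝓡 m) x →L[ℝ] TangentSpace (𝓡 m) x →L[ℝ] ℝ)
    (e : OpenPartialHomeomorph N (Euc m)) (y : Euc m) : Euc m →L[ℝ] Euc m →L[ℝ] ℝ :=
  let D : Euc m →L[ℝ] TangentSpace (𝓡 m) (e.symm y) := mfderiv (𝓡 m) (𝓡 m) e.symm y
  (ContinuousLinearMap.precomp ℝ D).comp ((h (e.symm y)).comp D)

/-- Coordinate expression of a field of endomorphisms of the tangent spaces. -/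
def endInChart (J : ∀ x : N, TangentSpace (𝓡 m) x →L[ℝ] TangentSpace (𝓡 m) x)
    (e : OpenPartialHomeomorph N (Euc m)) (y : Euc m) : Euc m →L[ℝ] Euc m :=
  let D : Euc m →L[ℝ] TangentSpace (𝓡 m) (e.symm y) := mfderiv (𝓡 m) (𝓡 m) e.symm y
  let D' : TangentSpace (𝓡 m) (e.symm y) →L[ℝ] Euc m := mfderiv (𝓡 m) (𝓡 m) e (e.symm y)
  D'.comp ((J (e.symm y)).comp D)

/-- The Riemannian measure in a chart: the measure `√det g dy` on the target of the chart,
transported to the manifold. -/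
def chartMeasure [MeasurableSpace N]
    (h : ∀ x : N, TangentSpace (𝓡 m) x →L[ℝ] TangentSpace (𝓡 m) x →L[ℝ] ℝ)
    (e : OpenPartialHomeomorph N (Euc m)) : Measure N :=
  ((volume.restrict e.target).withDensity
    fun y => ENNReal.ofReal (sqrtDet (inChart h e) y)).map e.symm

/-- The Riemannian measure. By the change of variables formula the measures of the charts agree on
overlaps, so their least upper bound is the measure that restricts to `√det g dy` in each chart. -/
def riemannianMeasure [MeasurableSpace N]
    (h : ∀ x : N, TangentSpace (𝓡 m) x →L[ℝ] TangentSpace (𝓡 m) x →L[ℝ] ℝ) : Measure N :=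
  ⨆ e ∈ atlas (Euc m) N, chartMeasure h e

/-- The gradient: `h(∇u, v) = du(v)`. -/
def grad (h : ∀ x : N, TangentSpace (𝓡 m) x →L[ℝ] TangentSpace (𝓡 m) x →L[ℝ] ℝ)
    (u : N → ℝ) (x : N) : TangentSpace (𝓡 m) x :=
  let du : TangentSpace (𝓡 m) x →L[ℝ] ℝ := mfderiv (𝓡 m) 𝓘(ℝ, ℝ) u x
  (h x).inverse du

/-- The Laplace-Beltrami operator, computed at `x` in the preferred chart at `x`. -/
def laplacian (h : ∀ x : N, TangentSpace (𝓡 m) x →L[ℝ] TangentSpace (𝓡 m) x →L[ℝ] ℝ)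
    (u : N → ℝ) (x : N) : ℝ :=
  laplaceCoord (inChart h (chartAt (Euc m) x)) (u ∘ (chartAt (Euc m) x).symm)
    (chartAt (Euc m) x x)

/-- The eigenspace `E_lam` of the Laplace operator on `L²` of a closed manifold: `u ∈ L²` with
`-Δu = lam u`, where `Δu` is taken in the sense of distributions. For smooth `u` Green's formula
turns this into the pointwise equation `-Δu = lam u`. -/
def eigenspace [MeasurableSpace N]
    (h : ∀ x : N, TangentSpace (𝓡 m) x →L[ℝ] TangentSpace (𝓡 m) x →L[ℝ] ℝ)
    (lam : ℝ) : Set (N → ℝ) :=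
  {u | MemLp u 2 (riemannianMeasure h) ∧
    ∀ v : N → ℝ, ContMDiff (𝓡 m) 𝓘(ℝ, ℝ) ∞ v →
      -∫ x, u x * laplacian h v x ∂(riemannianMeasure h)
        = lam * ∫ x, u x * v x ∂(riemannianMeasure h)}

/-- `lam` is the first eigenvalue of the Laplace operator, that is, its least positive
eigenvalue. -/
def IsFirstEigenvalue [MeasurableSpace N]
    (h : ∀ x : N, TangentSpace (𝓡 m) x →L[ℝ] TangentSpace (𝓡 m) x →L[ℝ] ℝ) (lam : ℝ) : Prop :=
  IsLeast {r : ℝ | 0 < r ∧ ∃ u ∈ eigenspace h r, ¬ u =ᵐ[riemannianMeasure h] 0} lam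

end Manifold

/-! ### Kähler manifolds and their Lagrangian submanifolds -/

/-- A Kähler structure on a smooth manifold `M` of real dimension `2n`: a smooth Riemannian metric
and a smooth orthogonal almost complex structure that is parallel for the Levi-Civita connection. -/
structure KahlerStructure (n : ℕ) (M : Type*) [TopologicalSpace M]
    [ChartedSpace (Euc (2 * n)) M] [IsManifold (𝓡 (2 * n)) ∞ M] where
  /-- The Riemannian metric. -/
  metric : ContMDiffRiemannianMetric (𝓡 (2 * n)) ∞ (Euc (2 * n))
    (fun x : M => TangentSpace (𝓡 (2 * n)) x)
  /-- The complex structure. -/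
  J : ∀ x : M, TangentSpace (𝓡 (2 * n)) x →L[ℝ] TangentSpace (𝓡 (2 * n)) x
  smooth_J : ContMDiff (𝓡 (2 * n)) ((𝓡 (2 * n)).prod 𝓘(ℝ, Euc (2 * n) →L[ℝ] Euc (2 * n))) ∞
    (fun x : M => TotalSpace.mk' (Euc (2 * n) →L[ℝ] Euc (2 * n))
      (E := fun x : M => TangentSpace (𝓡 (2 * n)) x →L[ℝ] TangentSpace (𝓡 (2 * n)) x) x (J x))
  J_J : ∀ (x : M) (v : TangentSpace (𝓡 (2 * n)) x), J x (J x v) = -v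
  metric_J : ∀ (x : M) (v w : TangentSpace (𝓡 (2 * n)) x),
    metric.inner x (J x v) (J x w) = metric.inner x v w
  /-- `(∇_v J) w = 0` in every chart. -/
  parallel_J : ∀ e ∈ atlas (Euc (2 * n)) M, ∀ y ∈ e.target, ∀ v w : Euc (2 * n),
    fderiv ℝ (endInChart J e) y v w
      + christoffel (inChart metric.inner e) y v (endInChart J e y w)
      - endInChart J e y (christoffel (inChart metric.inner e) y v w) = 0

namespace KahlerStructure

variable {n : ℕ} {M : Type*} [TopologicalSpace M] [ChartedSpace (Euc (2 * n)) M]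
  [IsManifold (𝓡 (2 * n)) ∞ M] (K : KahlerStructure n M)
  {L : Type*} [TopologicalSpace L] [ChartedSpace (Euc n) L]

/-- The Kähler metric is Einstein with (constant) scalar curvature `R`. -/
def IsEinstein (R : ℝ) : Prop :=
  ∀ e ∈ atlas (Euc (2 * n)) M, ∀ y ∈ e.target,
    scalarCurvature (inChart K.metric.inner e) y = R ∧
    ∀ v w : Euc (2 * n), ricci (inChart K.metric.inner e) y v w
      = R / (2 * n) * inChart K.metric.inner e y v w

/-- The Kähler form `ω(v, w) = g(Jv, w)`. -/
def kahlerForm (x : M) (v w : TangentSpace (𝓡 (2 * n)) x) : ℝ :=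
  K.metric.inner x (K.J x v) w

/-- The metric induced on `L` by a map `φ : L → M`. -/
def inducedMetric (φ : L → M) (x : L) :
    TangentSpace (𝓡 n) x →L[ℝ] TangentSpace (𝓡 n) x →L[ℝ] ℝ :=
  let D : TangentSpace (𝓡 n) x →L[ℝ] TangentSpace (𝓡 (2 * n)) (φ x) :=
    mfderiv (𝓡 n) (𝓡 (2 * n)) φ x
  (ContinuousLinearMap.precomp ℝ D).comp ((K.metric.inner (φ x)).comp D)

/-- The volume of `L` in the metric induced by `φ`. -/
def vol [MeasurableSpace L] (φ : L → M) : ℝ :=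
  (riemannianMeasure (K.inducedMetric φ)).real univ

/-- Second fundamental form `A(v, w) = (∇̄_v ∂_w φ)^⊥` of an immersion `φ`, in a chart `e` of `L`
and a chart `e'` of `M`. The subtracted term is the tangential part, that is, the image under `dφ`
of the vector dual to `z ↦ g(∇̄_v ∂_w φ, dφ z)`. -/
def secondFundamentalForm (φ : L → M) (e : OpenPartialHomeomorph L (Euc n))
    (e' : OpenPartialHomeomorph M (Euc (2 * n))) (y v w : Euc n) : Euc (2 * n) :=
  let F : Euc n → Euc (2 * n) := fun z => e' (φ (e.symm z))
  let gM := inChart K.metric.inner e'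
  let W : Euc (2 * n) := fderiv ℝ (fun z => fderiv ℝ F z w) y v
    + christoffel gM (F y) (fderiv ℝ F y v) (fderiv ℝ F y w)
  W - fderiv ℝ F y
    ((inChart (K.inducedMetric φ) e y).inverse ((gM (F y) W).comp (fderiv ℝ F y)))

/-- Mean curvature vector `H = g^{ij} A(∂_i, ∂_j)` in charts. -/
def meanCurvature (φ : L → M) (e : OpenPartialHomeomorph L (Euc n))
    (e' : OpenPartialHomeomorph M (Euc (2 * n))) (y : Euc n) : Euc (2 * n) :=
  ∑ i : Fin n, K.secondFundamentalForm φ e e' y (stdVec i)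
    (dualVec (inChart (K.inducedMetric φ) e) y i)

/-- `φ^* ω = 0`. -/
def IsLagrangian (φ : L → M) : Prop :=
  ∀ (x : L) (v w : TangentSpace (𝓡 n) x),
    K.kahlerForm (φ x) (mfderiv (𝓡 n) (𝓡 (2 * n)) φ x v) (mfderiv (𝓡 n) (𝓡 (2 * n)) φ x w) = 0

/-- The mean curvature vector vanishes identically. -/
def IsMinimal (φ : L → M) : Prop :=
  ∀ e ∈ atlas (Euc n) L, ∀ e' ∈ atlas (Euc (2 * n)) M, ∀ y ∈ e.target,
    φ (e.symm y) ∈ e'.source → K.meanCurvature φ e e' y = 0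

/-- A vector field `X` along `φ` is a hamiltonian variation if the one-form `i_X ω` on `L` is
exact. -/
def IsHamiltonianVariation (φ : L → M) (X : ∀ x : L, TangentSpace (𝓡 (2 * n)) (φ x)) : Prop :=
  ∃ u : L → ℝ, ContMDiff (𝓡 n) 𝓘(ℝ, ℝ) ∞ u ∧ ∀ (x : L) (v : TangentSpace (𝓡 n) x),
    K.kahlerForm (φ x) (X x) (mfderiv (𝓡 n) (𝓡 (2 * n)) φ x v) = mfderiv (𝓡 n) 𝓘(ℝ, ℝ) u x v

/-- The vector field `J∇f` along `φ`, where `∇f` is the gradient for the induced metric. -/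
def JGrad (φ : L → M) (f : L → ℝ) (x : L) : TangentSpace (𝓡 (2 * n)) (φ x) :=
  K.J (φ x) (mfderiv (𝓡 n) (𝓡 (2 * n)) φ x (grad (K.inducedMetric φ) f x))

/-- A nonzero field `X` along `φ` is an essential hamiltonian variation if `X = J∇f` where the
potential `f`, normalized to have mean zero, is not in the first eigenspace of the Laplace
operator of the induced metric. -/
def IsEssentialVariation [MeasurableSpace L] (φ : L → M)
    (X : ∀ x : L, TangentSpace (𝓡 (2 * n)) (φ x)) : Prop :=
  (∃ x, X x ≠ 0) ∧ ∃ f : L → ℝ, ContMDiff (𝓡 n) 𝓘(ℝ, ℝ) ∞ f ∧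
    ∫ x, f x ∂(riemannianMeasure (K.inducedMetric φ)) = 0 ∧ (∀ x, X x = K.JGrad φ f x) ∧
    ∃ lam : ℝ, IsFirstEigenvalue (K.inducedMetric φ) lam ∧
      f ∉ eigenspace (K.inducedMetric φ) lam

/-- The velocity `∂φ_s / ∂s` at time `s`. -/
def velocity (φ : ℝ → L → M) (s : ℝ) (x : L) : TangentSpace (𝓡 (2 * n)) (φ s x) :=
  mfderiv 𝓘(ℝ, ℝ) (𝓡 (2 * n)) (fun t => φ t x) s (1 : ℝ)

/-- A smooth family `φ_s`, `s ∈ (-η, η)`, of immersions is a hamiltonian deformation if its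
velocity is a hamiltonian variation at each time. -/
structure IsHamiltonianDeformation (η : ℝ) (φ : ℝ → L → M) : Prop where
  smooth : ContMDiffOn (𝓘(ℝ, ℝ).prod (𝓡 n)) (𝓡 (2 * n)) ∞ (fun p : ℝ × L => φ p.1 p.2)
    (Ioo (-η) η ×ˢ univ)
  immersion : ∀ s ∈ Ioo (-η) η, ∀ x : L,
    Function.Injective (mfderiv (𝓡 n) (𝓡 (2 * n)) (φ s) x)
  hamiltonian : ∀ s ∈ Ioo (-η) η, K.IsHamiltonianVariation (φ s) (velocity φ s)

end KahlerStructure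

end LagVar

end

open LagVar

noncomputable section
set_option maxSynthPendingDepth 3
set_option linter.unusedSectionVars false

namespace LagVar

/-! The proof combines a second variation formula with a spectral gap. For a minimal Lagrangian in a
Kähler–Einstein manifold and initial velocity `J∇f`, the formula is `Vol'' = ∫ (Δf)² - (R/2n) ∫
|∇f|²` (`second_variation`). Since `R/2n` is the first eigenvalue `λ₁`, the right side is
nonnegative. It vanishes for mean zero `f` exactly when `f` lies in `E_{λ₁}`
(`SmoothMetric.spectral_gap`, `SmoothMetric.mem_eigenspace_iff`).

The formula is proved pointwise for the volume density. Put `W = ∇f`, let `A` be the acceleration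
`∇_s ∂_s φ` at time zero, and split `∇W` into the Hessian of `f` and its `J`-normal part `h`. The
first variation of the metric is `-2h`, with trace zero by minimality. The second variation of the
density therefore contains the trace of `∇A`, a curvature term in `JW`, and `|Hess f|² - |h|²`. A
Bochner formula (`fderiv_laplaceCoord`) expresses `⟨∇Δf, ∇f⟩` by the trace of `∇(∇_W W)`, a
curvature term in `W`, and `-|Hess f|² + |h|²`. On subtraction the quadratic terms cancel. The two
curvature terms combine, through the Kähler symmetries of the curvature and the frame `(∂_a, J∂_a)`,
into `-Ric(W, W)` (`sum_riemann`). The traces of `∇A` and `∇(∇_W W)` form the divergence of the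
one-form `d/ds g(∂_s φ, dφ ·)`, so the acceleration integrates to zero and Green's formula does the
rest.

The spectral gap needs no elliptic regularity. Smooth functions with the Sobolev inner product are
completed to a form domain `V`, and `ι : V → L²` is compact by a Rellich theorem proved with
averages over cubes. The operator `T = ι ι*` is the resolvent of `1 - Δ`. Its eigenvectors are weak
eigenfunctions, which is what `eigenspace` asks for, so with `c = 1/(1 + λ₁)` the operator `(1 -
T)(c - T)` is nonnegative. Evaluated at `(1 - Δ)f`, it gives the inequality. Equality makes `Δf` a
weak eigenfunction. Then `Δf + λ₁ f` has zero differential, hence is constant, and mean zero makes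
it vanish. -/

/-! ### Inner products as continuous bilinear forms -/

/-- A continuous bilinear form that is an inner product. -/
structure IsInner {m : ℕ} (B : Euc m →L[ℝ] Euc m →L[ℝ] ℝ) : Prop where
  symm : ∀ v w, B v w = B w v
  pos : ∀ v, v ≠ 0 → 0 < B v v

namespace IsInner

variable {m : ℕ} {B : Euc m →L[ℝ] Euc m →L[ℝ] ℝ}

lemma nonneg (hB : IsInner B) (v : Euc m) : 0 ≤ B v v := by
  rcases eq_or_ne v 0 with rfl | hv
  · simp
  · exact (hB.pos v hv).le

lemma eq_zero (hB : IsInner B) {v : Euc m} (h : B v v = 0) : v = 0 := by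
  by_contra hv
  exact (hB.pos v hv).ne' h

/-- Positivity makes `v ↦ B v ·` injective, and a space and its dual have the same finite dimension.
Every use of `inverse` rests on this, since `inverse` is zero on maps that are not invertible. -/
lemma isInvertible (hB : IsInner B) : B.IsInvertible := by
  have hinj : Function.Injective (B : Euc m →ₗ[ℝ] (Euc m →L[ℝ] ℝ)) := by
    rw [injective_iff_map_eq_zero]
    intro v hv
    apply hB.eq_zero
    have : B v = 0 := hv
    rw [this]; rfl
  have hfin : Module.finrank ℝ (Euc m) = Module.finrank ℝ (Euc m →L[ℝ] ℝ) := by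
    rw [← (LinearMap.toContinuousLinearMap (𝕜 := ℝ) (E := Euc m) (F' := ℝ)).finrank_eq]
    exact (Subspace.dual_finrank_eq (K := ℝ) (V := Euc m)).symm
  have : FiniteDimensional ℝ (Euc m →L[ℝ] ℝ) :=
    (LinearMap.toContinuousLinearMap (𝕜 := ℝ) (E := Euc m) (F' := ℝ)).finiteDimensional
  refine ⟨(LinearEquiv.ofInjectiveOfFinrankEq (B : Euc m →ₗ[ℝ] (Euc m →L[ℝ] ℝ)) hinj
    hfin).toContinuousLinearEquiv, ?_⟩
  ext v w
  rfl

lemma apply_inverse (hB : IsInner B) (α : Euc m →L[ℝ] ℝ) : B (B.inverse α) = α :=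
  hB.isInvertible.self_apply_inverse α

lemma inverse_apply (hB : IsInner B) (v : Euc m) : B.inverse (B v) = v :=
  hB.isInvertible.inverse_apply_self v

lemma ext (hB : IsInner B) {v w : Euc m} (h : ∀ z, B v z = B w z) : v = w := by
  rw [← hB.inverse_apply v, ← hB.inverse_apply w]
  congr 1
  ext z
  exact h z

end IsInner

lemma sum_stdVec {m : ℕ} (v : Euc m) : ∑ i, v i • stdVec i = v := by
  simpa [stdVec] using (EuclideanSpace.basisFun (Fin m) ℝ).sum_repr v

lemma sum_apply_stdVec {m : ℕ} {F : Type*} [AddCommGroup F] [Module ℝ F] [TopologicalSpace F]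
    (T : Euc m →L[ℝ] F) (v : Euc m) : ∑ i, v i • T (stdVec i) = T v := by
  conv_rhs => rw [← sum_stdVec v, map_sum]
  simp

/-! ### Metrics on open sets -/

/-- A smooth Riemannian metric on an open subset of coordinate space. -/
structure MetricOn {m : ℕ} (g : Euc m → Euc m →L[ℝ] Euc m →L[ℝ] ℝ) (U : Set (Euc m)) : Prop where
  isOpen : IsOpen U
  smooth : ContDiffOn ℝ ∞ g U
  inner : ∀ y ∈ U, IsInner (g y)

namespace MetricOn

variable {m : ℕ} {g : Euc m → Euc m →L[ℝ] Euc m →L[ℝ] ℝ} {U : Set (Euc m)}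

lemma contDiffAt (hg : MetricOn g U) {y : Euc m} (hy : y ∈ U) : ContDiffAt ℝ ∞ g y :=
  hg.smooth.contDiffAt (hg.isOpen.mem_nhds hy)

lemma differentiableAt (hg : MetricOn g U) {y : Euc m} (hy : y ∈ U) : DifferentiableAt ℝ g y :=
  (hg.contDiffAt hy).differentiableAt (by simp)

lemma contDiffAt_inverse (hg : MetricOn g U) {y : Euc m} (hy : y ∈ U) :
    ContDiffAt ℝ ∞ (fun z => (g z).inverse) y :=
  (hg.inner y hy).isInvertible.contDiffAt_map_inverse.comp y (hg.contDiffAt hy)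

lemma fderiv_symm (hg : MetricOn g U) {y : Euc m} (hy : y ∈ U) (u v w : Euc m) :
    fderiv ℝ g y u v w = fderiv ℝ g y u w v := by
  have h1 : ∀ a b, fderiv ℝ g y u a b = fderiv ℝ (fun z => g z a b) y u := by
    intro a b
    rw [fderiv_clm_apply ((hg.differentiableAt hy).clm_apply (differentiableAt_const _))
      (differentiableAt_const _), fderiv_clm_apply (hg.differentiableAt hy)
      (differentiableAt_const _)]
    simp
  rw [h1, h1]
  congr 1
  apply Filter.EventuallyEq.fderiv_eq
  filter_upwards [hg.isOpen.mem_nhds hy] with z hz using (hg.inner z hz).symm v w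

lemma christoffel_inner (hg : MetricOn g U) {y : Euc m} (hy : y ∈ U) (v w z : Euc m) :
    g y (christoffel g y v w) z
      = (1 / 2 : ℝ) * (fderiv ℝ g y v w z + fderiv ℝ g y w v z - fderiv ℝ g y z v w) := by
  rw [christoffel, (hg.inner y hy).apply_inverse]
  simp

lemma christoffel_symm (hg : MetricOn g U) {y : Euc m} (hy : y ∈ U) (v w : Euc m) :
    christoffel g y v w = christoffel g y w v := by
  apply (hg.inner y hy).ext
  intro z
  rw [hg.christoffel_inner hy, hg.christoffel_inner hy, hg.fderiv_symm hy z v w]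
  ring

/-- Adding the Koszul identities for `Γ(u, v)` and `Γ(u, w)` leaves only the derivative in the
direction `u`; this is metric compatibility. -/
lemma fderiv_eq (hg : MetricOn g U) {y : Euc m} (hy : y ∈ U) (u v w : Euc m) :
    fderiv ℝ g y u v w = g y (christoffel g y u v) w + g y v (christoffel g y u w) := by
  rw [(hg.inner y hy).symm v, hg.christoffel_inner hy, hg.christoffel_inner hy,
    hg.fderiv_symm hy u w v, hg.fderiv_symm hy v u w]
  ring

end MetricOn

/-- The Christoffel symbols as a bilinear map. -/
def christoffelL {m : ℕ} (g : Euc m → Euc m →L[ℝ] Euc m →L[ℝ] ℝ) (y : Euc m) :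
    Euc m →L[ℝ] Euc m →L[ℝ] Euc m :=
  (ContinuousLinearMap.compL ℝ (Euc m) (Euc m →L[ℝ] ℝ) (Euc m) (g y).inverse).comp
    ((1 / 2 : ℝ) • (fderiv ℝ g y + (fderiv ℝ g y).flip
      - ((ContinuousLinearMap.flipₗᵢ ℝ (Euc m) (Euc m) ℝ).toContinuousLinearEquiv :
          (Euc m →L[ℝ] Euc m →L[ℝ] ℝ) →L[ℝ] (Euc m →L[ℝ] Euc m →L[ℝ] ℝ)).comp
          (fderiv ℝ g y).flip))

lemma christoffelL_apply {m : ℕ} (g : Euc m → Euc m →L[ℝ] Euc m →L[ℝ] ℝ) (y v w : Euc m) :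
    christoffelL g y v w = christoffel g y v w := by
  simp only [christoffelL, christoffel]
  rfl

lemma MetricOn.contDiffAt_christoffelL {m : ℕ} {g : Euc m → Euc m →L[ℝ] Euc m →L[ℝ] ℝ}
    {U : Set (Euc m)} (hg : MetricOn g U) {y : Euc m} (hy : y ∈ U) :
    ContDiffAt ℝ ∞ (christoffelL g) y := by
  have hd : ContDiffAt ℝ ∞ (fderiv ℝ g) y := (hg.contDiffAt hy).fderiv_right (by simp)
  have hf : ContDiffAt ℝ ∞ (fun z => (fderiv ℝ g z).flip) y :=
    ((ContinuousLinearMap.flipₗᵢ ℝ (Euc m) (Euc m) (Euc m →L[ℝ] ℝ)).contDiff.contDiffAt).comp y hd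
  unfold christoffelL
  refine ContDiffAt.clm_comp ?_ ?_
  · exact ((ContinuousLinearMap.compL ℝ (Euc m) (Euc m →L[ℝ] ℝ) (Euc m)).contDiff.contDiffAt).comp y
      (hg.contDiffAt_inverse hy)
  · exact ((hd.add hf).sub (contDiffAt_const.clm_comp hf)).const_smul (1 / 2 : ℝ)

/-! ### Covariant derivatives along maps -/

section Along

variable {m : ℕ} {P : Type*} [NormedAddCommGroup P] [NormedSpace ℝ P]

/-- The covariant derivative `∇_u Y` of a vector field `Y` along a map `F`. -/
def covD (g : Euc m → Euc m →L[ℝ] Euc m →L[ℝ] ℝ) (F Y : P → Euc m) (p u : P) : Euc m :=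
  fderiv ℝ Y p u + christoffel g (F p) (fderiv ℝ F p u) (Y p)

variable {g : Euc m → Euc m →L[ℝ] Euc m →L[ℝ] ℝ} {U : Set (Euc m)} {F Y Z : P → Euc m} {p : P}

lemma covD_eq (p u : P) : covD g F Y p u
    = fderiv ℝ Y p u + christoffelL g (F p) (fderiv ℝ F p u) (Y p) := by
  rw [christoffelL_apply, covD]

/-- `covD` as a linear map in the direction. -/
def covDL (g : Euc m → Euc m →L[ℝ] Euc m →L[ℝ] ℝ) (F Y : P → Euc m) (p : P) : P →L[ℝ] Euc m :=
  fderiv ℝ Y p + ((christoffelL g (F p)).flip (Y p)).comp (fderiv ℝ F p)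

lemma covDL_apply (p u : P) : covDL g F Y p u = covD g F Y p u := by
  simp [covDL, covD_eq]

lemma covD_congr {Y' : P → Euc m} (h : Y =ᶠ[𝓝 p] Y') (u : P) :
    covD g F Y p u = covD g F Y' p u := by
  rw [covD, covD, h.fderiv_eq, h.eq_of_nhds]

lemma covD_add (hY : DifferentiableAt ℝ Y p) (hZ : DifferentiableAt ℝ Z p) (u : P) :
    covD g F (fun q => Y q + Z q) p u = covD g F Y p u + covD g F Z p u := by
  simp only [covD_eq, fderiv_fun_add hY hZ, map_add, add_apply]
  abel

lemma covD_sub (hY : DifferentiableAt ℝ Y p) (hZ : DifferentiableAt ℝ Z p) (u : P) :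
    covD g F (fun q => Y q - Z q) p u = covD g F Y p u - covD g F Z p u := by
  simp only [covD_eq, fderiv_fun_sub hY hZ, map_sub, sub_apply]
  abel

/-- Leibniz rule for a field of linear maps applied to a field of parameters. -/
lemma covD_clm_apply {Q : Type*} [NormedAddCommGroup Q] [NormedSpace ℝ Q] {A : P → Q →L[ℝ] Euc m}
    {w : P → Q} (hA : DifferentiableAt ℝ A p) (hw : DifferentiableAt ℝ w p) (u : P) :
    covD g F (fun q => A q (w q)) p u
      = covD g F (fun q => A q (w p)) p u + A p (fderiv ℝ w p u) := by
  simp only [covD_eq]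
  rw [fderiv_clm_apply hA hw, fderiv_clm_apply hA (differentiableAt_const _)]
  simp
  abel

lemma contDiffAt_covDL (hg : MetricOn g U) (hp : F p ∈ U) (hF : ContDiffAt ℝ ∞ F p)
    (hY : ContDiffAt ℝ ∞ Y p) : ContDiffAt ℝ ∞ (covDL g F Y) p := by
  have hΓ : ContDiffAt ℝ ∞ (fun q => christoffelL g (F q)) p :=
    (hg.contDiffAt_christoffelL hp).comp p hF
  have hfl : ContDiffAt ℝ ∞ (fun q => (christoffelL g (F q)).flip) p :=
    ((ContinuousLinearMap.flipₗᵢ ℝ (Euc m) (Euc m) (Euc m)).contDiff.contDiffAt).comp p hΓ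
  exact (hY.fderiv_right (by simp)).add
    ((hfl.clm_apply hY).clm_comp (hF.fderiv_right (by simp)))

lemma contDiffAt_covD (hg : MetricOn g U) (hp : F p ∈ U) (hF : ContDiffAt ℝ ∞ F p)
    (hY : ContDiffAt ℝ ∞ Y p) {w : P → P} (hw : ContDiffAt ℝ ∞ w p) :
    ContDiffAt ℝ ∞ (fun q => covD g F Y q (w q)) p := by
  simp only [← covDL_apply]
  exact (contDiffAt_covDL hg hp hF hY).clm_apply hw

/-- The connection is metric. -/
lemma fderiv_inner_along (hg : MetricOn g U) (hp : F p ∈ U) (hF : DifferentiableAt ℝ F p)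
    (hY : DifferentiableAt ℝ Y p) (hZ : DifferentiableAt ℝ Z p) (u : P) :
    fderiv ℝ (fun q => g (F q) (Y q) (Z q)) p u
      = g (F p) (covD g F Y p u) (Z p) + g (F p) (Y p) (covD g F Z p u) := by
  have hgF : DifferentiableAt ℝ (fun q => g (F q)) p := (hg.differentiableAt hp).comp p hF
  have h1 : fderiv ℝ (fun q => g (F q)) p u = fderiv ℝ g (F p) (fderiv ℝ F p u) := by
    have := fderiv_fun_comp (𝕜 := ℝ) p (hg.differentiableAt hp) hF
    rw [this]; rfl
  rw [fderiv_clm_apply (hgF.clm_apply hY) hZ, fderiv_clm_apply hgF hY]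
  simp only [add_apply, ContinuousLinearMap.comp_apply,
    ContinuousLinearMap.flip_apply, h1, hg.fderiv_eq hp, covD, map_add]
  ring

/-- The connection is torsion free. -/
lemma covD_fderiv_symm (hg : MetricOn g U) (hp : F p ∈ U) (hF : ContDiffAt ℝ ∞ F p) (u v : P) :
    covD g F (fun q => fderiv ℝ F q v) p u = covD g F (fun q => fderiv ℝ F q u) p v := by
  have hd : DifferentiableAt ℝ (fderiv ℝ F) p :=
    (hF.fderiv_right (m := 1) (by norm_cast)).differentiableAt (by simp)
  have hs : IsSymmSndFDerivAt ℝ F p := hF.isSymmSndFDerivAt (by simp [ENat.LEInfty.out])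
  have h1 : ∀ a b, fderiv ℝ (fun q => fderiv ℝ F q a) p b = fderiv ℝ (fderiv ℝ F) p b a := by
    intro a b
    rw [fderiv_clm_apply hd (differentiableAt_const _)]
    simp
  rw [covD, covD, hg.christoffel_symm hp, h1, h1, hs.eq u v]

/-- The commutator of covariant derivatives is the curvature. -/
lemma covD_covD_sub (hg : MetricOn g U) (hp : F p ∈ U) (hF : ContDiffAt ℝ ∞ F p)
    (hY : ContDiffAt ℝ ∞ Y p) (u v : P) :
    covD g F (fun q => covD g F Y q v) p u - covD g F (fun q => covD g F Y q u) p v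
      = riemann g (F p) (fderiv ℝ F p u) (fderiv ℝ F p v) (Y p) := by
  have hdF : DifferentiableAt ℝ (fderiv ℝ F) p :=
    (hF.fderiv_right (m := 1) (by norm_cast)).differentiableAt (by simp)
  have hdY : DifferentiableAt ℝ (fderiv ℝ Y) p :=
    (hY.fderiv_right (m := 1) (by norm_cast)).differentiableAt (by simp)
  have hF1 : DifferentiableAt ℝ F p := hF.differentiableAt (by simp)
  have hY1 : DifferentiableAt ℝ Y p := hY.differentiableAt (by simp)
  have hΓ : DifferentiableAt ℝ (christoffelL g) (F p) :=
    (hg.contDiffAt_christoffelL hp).differentiableAt (by simp)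
  have hΓF : DifferentiableAt ℝ (fun q => christoffelL g (F q)) p := hΓ.comp p hF1
  have hΓd : ∀ u, fderiv ℝ (fun q => christoffelL g (F q)) p u
      = fderiv ℝ (christoffelL g) (F p) (fderiv ℝ F p u) := by
    intro u
    rw [fderiv_fun_comp (𝕜 := ℝ) p hΓ hF1]; rfl
  have hsF : IsSymmSndFDerivAt ℝ F p := hF.isSymmSndFDerivAt (by simp [ENat.LEInfty.out])
  have hsY : IsSymmSndFDerivAt ℝ Y p := hY.isSymmSndFDerivAt (by simp [ENat.LEInfty.out])
  have hR : ∀ a b w, fderiv ℝ (fun z => christoffel g z a w) (F p) b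
      = fderiv ℝ (christoffelL g) (F p) b a w := by
    intro a b w
    simp only [← christoffelL_apply]
    rw [fderiv_clm_apply (hΓ.clm_apply (differentiableAt_const _)) (differentiableAt_const _),
      fderiv_clm_apply hΓ (differentiableAt_const _)]
    simp
  -- The terms with second derivatives of `Y` and `F` are symmetric in `a` and `b`, so they drop out
  -- of the commutator.
  have key : ∀ a b, fderiv ℝ (fun q => covD g F Y q a) p b
      = fderiv ℝ (fderiv ℝ Y) p b a
        + fderiv ℝ (christoffelL g) (F p) (fderiv ℝ F p b) (fderiv ℝ F p a) (Y p)
        + christoffelL g (F p) (fderiv ℝ (fderiv ℝ F) p b a) (Y p)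
        + christoffelL g (F p) (fderiv ℝ F p a) (fderiv ℝ Y p b) := by
    intro a b
    simp only [covD_eq]
    have hFa : DifferentiableAt ℝ (fun q => fderiv ℝ F q a) p :=
      hdF.clm_apply (differentiableAt_const _)
    have hYa : DifferentiableAt ℝ (fun q => fderiv ℝ Y q a) p :=
      hdY.clm_apply (differentiableAt_const _)
    rw [fderiv_fun_add hYa ((hΓF.clm_apply hFa).clm_apply hY1),
      fderiv_clm_apply (hΓF.clm_apply hFa) hY1, fderiv_clm_apply hΓF hFa,
      fderiv_clm_apply hdF (differentiableAt_const _),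
      fderiv_clm_apply hdY (differentiableAt_const _)]
    simp [hΓd]
    abel
  have key' : ∀ a b, covD g F (fun q => covD g F Y q a) p b
      = fderiv ℝ (fun q => covD g F Y q a) p b + christoffelL g (F p) (fderiv ℝ F p b)
        (fderiv ℝ Y p a + christoffelL g (F p) (fderiv ℝ F p a) (Y p)) := by
    intro a b
    rw [covD_eq, covD_eq]
  rw [key', key', key, key, hsY.eq u v, hsF.eq u v, riemann, hR, hR]
  simp only [← christoffelL_apply, map_add]
  abel

end Along

/-! ### Symmetries of the curvature tensor -/

section Curvature

variable {m : ℕ} {g : Euc m → Euc m →L[ℝ] Euc m →L[ℝ] ℝ} {U : Set (Euc m)} {y : Euc m}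

lemma riemann_swap (u v w : Euc m) : riemann g y u v w = -riemann g y v u w := by
  simp only [riemann]; abel

/-- With `F` the identity, curvature is a commutator of covariant derivatives of vector fields. The
symmetries below come from applying this to constant fields and to the field `J w`. -/
lemma riemann_eq_covD (hg : MetricOn g U) (hy : y ∈ U) {Y : Euc m → Euc m}
    (hY : ContDiffAt ℝ ∞ Y y) (u v : Euc m) :
    riemann g y u v (Y y) = covD g (fun q => q) (fun q => covD g (fun q => q) Y q v) y u
      - covD g (fun q => q) (fun q => covD g (fun q => q) Y q u) y v := by
  have := covD_covD_sub (F := fun q : Euc m => q) hg hy contDiffAt_id hY u v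
  simpa using this.symm

namespace MetricOn

lemma riemann_eq (hg : MetricOn g U) (hy : y ∈ U) (u v w : Euc m) :
    riemann g y u v w = fderiv ℝ (christoffelL g) y u v w - fderiv ℝ (christoffelL g) y v u w
      + christoffelL g y u (christoffelL g y v w) - christoffelL g y v (christoffelL g y u w) := by
  have hΓ : DifferentiableAt ℝ (christoffelL g) y :=
    (hg.contDiffAt_christoffelL hy).differentiableAt (by simp)
  have hR : ∀ a b w, fderiv ℝ (fun z => christoffel g z a w) y b
      = fderiv ℝ (christoffelL g) y b a w := by
    intro a b w
    simp only [← christoffelL_apply]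
    rw [fderiv_clm_apply (hΓ.clm_apply (differentiableAt_const _)) (differentiableAt_const _),
      fderiv_clm_apply hΓ (differentiableAt_const _)]
    simp
  rw [riemann, hR, hR]
  simp only [← christoffelL_apply]

/-- The second derivative of the function `g(w, z)`, with constant `w` and `z`, is symmetric.
Expanded by metric compatibility, its products of first covariant derivatives are symmetric in `u`
and `v`, and the commutator leaves the two curvature terms. -/
lemma riemann_inner_skew (hg : MetricOn g U) (hy : y ∈ U) (u v w z : Euc m) :
    g y (riemann g y u v w) z = -g y (riemann g y u v z) w := by
  have hid : ∀ q : Euc m, DifferentiableAt ℝ (fun q : Euc m => q) q := fun q => differentiableAt_id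
  have hc : ∀ a q : Euc m, DifferentiableAt ℝ (fun _ : Euc m => a) q :=
    fun a q => differentiableAt_const _
  have hfirst : ∀ b, ∀ q ∈ U, fderiv ℝ (fun q => g q w z) q b
      = g q (covD g (fun q => q) (fun _ => w) q b) z
        + g q w (covD g (fun q => q) (fun _ => z) q b) := fun b q hq =>
    fderiv_inner_along (F := fun q : Euc m => q) hg hq (hid q) (hc w q) (hc z q) b
  have hsm : ∀ a b : Euc m, DifferentiableAt ℝ (fun q => covD g (fun q => q) (fun _ => a) q b) y :=
    fun a b => (contDiffAt_covD (F := fun q : Euc m => q) hg hy contDiffAt_id contDiffAt_const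
      contDiffAt_const).differentiableAt (by simp)
  have hgI : DifferentiableAt ℝ g y := hg.differentiableAt hy
  have hsnd : ∀ a b, fderiv ℝ (fun q => fderiv ℝ (fun q => g q w z) q b) y a
      = (g y (covD g (fun q => q) (fun q => covD g (fun q => q) (fun _ => w) q b) y a) z
        + g y (covD g (fun q => q) (fun _ => w) y b) (covD g (fun q => q) (fun _ => z) y a))
        + (g y (covD g (fun q => q) (fun _ => w) y a) (covD g (fun q => q) (fun _ => z) y b)
        + g y w (covD g (fun q => q) (fun q => covD g (fun q => q) (fun _ => z) q b) y a)) := by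
    intro a b
    have hev : (fun q => fderiv ℝ (fun q => g q w z) q b) =ᶠ[𝓝 y]
        fun q => g q (covD g (fun q => q) (fun _ => w) q b) z
          + g q w (covD g (fun q => q) (fun _ => z) q b) := by
      filter_upwards [hg.isOpen.mem_nhds hy] with q hq using hfirst b q hq
    rw [hev.fderiv_eq, fderiv_fun_add ((hgI.clm_apply (hsm w b)).clm_apply (hc z y))
      ((hgI.clm_apply (hc w y)).clm_apply (hsm z b)), add_apply]
    congr 1
    · exact fderiv_inner_along (F := fun q : Euc m => q) hg hy (hid y) (hsm w b) (hc z y) a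
    · exact fderiv_inner_along (F := fun q : Euc m => q) hg hy (hid y) (hc w y) (hsm z b) a
  have hgs : ContDiffAt ℝ ∞ (fun q => g q w z) y :=
    ((hg.contDiffAt hy).clm_apply contDiffAt_const).clm_apply contDiffAt_const
  have hsymm : IsSymmSndFDerivAt ℝ (fun q => g q w z) y :=
    hgs.isSymmSndFDerivAt (by simp [ENat.LEInfty.out])
  have hd : DifferentiableAt ℝ (fderiv ℝ (fun q => g q w z)) y :=
    (hgs.fderiv_right (m := 1) (by norm_cast)).differentiableAt (by simp)
  have hcomm : fderiv ℝ (fun q => fderiv ℝ (fun q => g q w z) q v) y u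
      = fderiv ℝ (fun q => fderiv ℝ (fun q => g q w z) q u) y v := by
    rw [fderiv_clm_apply hd (hc v y), fderiv_clm_apply hd (hc u y)]
    simpa using hsymm.eq u v
  rw [hsnd, hsnd] at hcomm
  have hw := riemann_eq_covD hg hy (Y := fun _ => w) contDiffAt_const u v
  have hz := riemann_eq_covD hg hy (Y := fun _ => z) contDiffAt_const u v
  have hs : ∀ a, g y w a = g y a w := fun a => (hg.inner y hy).symm w a
  rw [hw, hz]
  simp only [map_sub, sub_apply]
  rw [hs, hs] at hcomm
  linarith

/-- For constant fields the absence of torsion reads `∇_b a = ∇_a b`; after this exchange the six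
second covariant derivatives cancel in pairs. -/
lemma riemann_bianchi (hg : MetricOn g U) (hy : y ∈ U) (u v w : Euc m) :
    riemann g y u v w + riemann g y v w u + riemann g y w u v = 0 := by
  have hsw : ∀ a b c : Euc m, covD g (fun q => q) (fun q => covD g (fun q => q) (fun _ => a) q b) y c
      = covD g (fun q => q) (fun q => covD g (fun q => q) (fun _ => b) q a) y c := by
    intro a b c
    apply covD_congr
    filter_upwards [hg.isOpen.mem_nhds hy] with q hq
    simp [covD, hg.christoffel_symm hq a b]
  have h1 := riemann_eq_covD hg hy (Y := fun _ => w) contDiffAt_const u v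
  have h2 := riemann_eq_covD hg hy (Y := fun _ => u) contDiffAt_const v w
  have h3 := riemann_eq_covD hg hy (Y := fun _ => v) contDiffAt_const w u
  rw [h1, h2, h3, hsw w v, hsw w u, hsw u v]
  abel

/-- The octahedron argument: four cyclic Bianchi sums together with the two skew symmetries form a
linear system that forces the exchange of pairs. -/
lemma riemann_pair_symm (hg : MetricOn g U) (hy : y ∈ U) (a b c d : Euc m) :
    g y (riemann g y a b c) d = g y (riemann g y c d a) b := by
  have hb : ∀ u v w z, g y (riemann g y u v w) z + g y (riemann g y v w u) z
      + g y (riemann g y w u v) z = 0 := by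
    intro u v w z
    rw [← add_apply, ← add_apply, ← map_add, ← map_add, hg.riemann_bianchi hy]
    simp
  have hs := fun u v w z => hg.riemann_inner_skew hy u v w z
  have ha : ∀ u v w z, g y (riemann g y u v w) z = -g y (riemann g y v u w) z := by
    intro u v w z
    rw [riemann_swap u v w]; simp
  linarith [hb a b c d, hb b c d a, hb c d a b, hb d a b c, hs a b c d, hs b c d a, hs c d a b,
    hs d a b c, hs a c b d, hs b d a c, ha a b c d, ha b c d a, ha c d a b, ha d a b c,
    ha a c b d, ha b d a c, ha a c d b, ha b d c a, hs c a b d, hs d b c a, hs a b d c,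
    ha a b d c, hs c d b a, ha c d b a, hs b c a d, hs d a c b, ha b c a d, ha d a c b]

end MetricOn

/-! ### Kähler structures on open sets -/

/-- A Kähler structure on an open subset of coordinate space. -/
structure KahlerOn (g : Euc m → Euc m →L[ℝ] Euc m →L[ℝ] ℝ) (J : Euc m → Euc m →L[ℝ] Euc m)
    (U : Set (Euc m)) : Prop where
  metric : MetricOn g U
  smooth : ContDiffOn ℝ ∞ J U
  J_J : ∀ y ∈ U, ∀ v, J y (J y v) = -v
  metric_J : ∀ y ∈ U, ∀ v w, g y (J y v) (J y w) = g y v w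
  parallel : ∀ y ∈ U, ∀ v w,
    fderiv ℝ J y v w + christoffel g y v (J y w) - J y (christoffel g y v w) = 0

namespace KahlerOn

variable {J : Euc m → Euc m →L[ℝ] Euc m}

lemma contDiffAt (hK : KahlerOn g J U) (hy : y ∈ U) : ContDiffAt ℝ ∞ J y :=
  hK.smooth.contDiffAt (hK.metric.isOpen.mem_nhds hy)

lemma metric_J_left (hK : KahlerOn g J U) (hy : y ∈ U) (v w : Euc m) :
    g y (J y v) w = -g y v (J y w) := by
  rw [← hK.metric_J y hy v (J y w), hK.J_J y hy]
  simp

/-- Parallelism says that the derivative of `J` is exactly the commutator of `J` with the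
Christoffel term, so covariant differentiation passes through `J`. -/
lemma covD_J {P : Type*} [NormedAddCommGroup P] [NormedSpace ℝ P] {F Y : P → Euc m} {p : P}
    (hK : KahlerOn g J U) (hp : F p ∈ U) (hF : DifferentiableAt ℝ F p)
    (hY : DifferentiableAt ℝ Y p) (u : P) :
    covD g F (fun q => J (F q) (Y q)) p u = J (F p) (covD g F Y p u) := by
  have hJ : DifferentiableAt ℝ J (F p) := (hK.contDiffAt hp).differentiableAt (by simp)
  have hJF : DifferentiableAt ℝ (fun q => J (F q)) p := hJ.comp p hF
  have h1 : fderiv ℝ (fun q => J (F q)) p u = fderiv ℝ J (F p) (fderiv ℝ F p u) := by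
    rw [fderiv_fun_comp (𝕜 := ℝ) p hJ hF]; rfl
  have h2 := hK.parallel (F p) hp (fderiv ℝ F p u) (Y p)
  rw [covD, covD, fderiv_clm_apply hJF hY, map_add]
  simp only [add_apply, ContinuousLinearMap.comp_apply, ContinuousLinearMap.flip_apply, h1]
  rw [sub_eq_zero] at h2
  rw [← h2]
  abel

lemma riemann_J (hK : KahlerOn g J U) (hy : y ∈ U) (u v w : Euc m) :
    riemann g y u v (J y w) = J y (riemann g y u v w) := by
  have hg := hK.metric
  have hJw : ContDiffAt ℝ ∞ (fun q => J q w) y := (hK.contDiffAt hy).clm_apply contDiffAt_const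
  have hsm : ∀ b : Euc m, DifferentiableAt ℝ (fun q => covD g (fun q => q) (fun _ => w) q b) y :=
    fun b => (contDiffAt_covD (F := fun q : Euc m => q) hg hy contDiffAt_id contDiffAt_const
      contDiffAt_const).differentiableAt (by simp)
  have h : ∀ a b, covD g (fun q => q) (fun q => covD g (fun q => q) (fun q => J q w) q b) y a
      = J y (covD g (fun q => q) (fun q => covD g (fun q => q) (fun _ => w) q b) y a) := by
    intro a b
    rw [← hK.covD_J (F := fun q : Euc m => q) hy differentiableAt_id (hsm b)]
    apply covD_congr
    filter_upwards [hg.isOpen.mem_nhds hy] with q hq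
    exact hK.covD_J (F := fun q : Euc m => q) (Y := fun _ => w) hq differentiableAt_id
      (differentiableAt_const _) b
  rw [riemann_eq_covD hg hy (Y := fun q => J q w) hJw u v,
    riemann_eq_covD hg hy (Y := fun _ => w) contDiffAt_const u v, h, h, map_sub]

/-- Exchanging the pairs moves `J` to the last two slots, where it commutes with the curvature and
is an isometry. -/
lemma riemann_J_J (hK : KahlerOn g J U) (hy : y ∈ U) (u v w : Euc m) :
    riemann g y (J y u) (J y v) w = riemann g y u v w := by
  apply (hK.metric.inner y hy).ext
  intro z
  rw [hK.metric.riemann_pair_symm hy, hK.riemann_J hy, hK.metric_J y hy,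
    hK.metric.riemann_pair_symm hy]

end KahlerOn

end Curvature

/-! ### Derivatives of the Riemannian density -/

section Density

variable {m : ℕ}

/-- The density `√det` of a bilinear form. -/
def density (B : Euc m →L[ℝ] Euc m →L[ℝ] ℝ) : ℝ :=
  Real.sqrt (Matrix.of fun i j : Fin m => B (stdVec i) (stdVec j)).det

lemma sqrtDet_eq_density (g : Euc m → Euc m →L[ℝ] Euc m →L[ℝ] ℝ) (y : Euc m) :
    sqrtDet g y = density (g y) := rfl

variable {B : Euc m →L[ℝ] Euc m →L[ℝ] ℝ}

lemma apply_eq_sum (A : Euc m →L[ℝ] Euc m →L[ℝ] ℝ) (v w : Euc m) :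
    A v w = ∑ i, ∑ j, v i * w j * A (stdVec i) (stdVec j) := by
  rw [← sum_apply_stdVec A v, sum_apply]
  refine Finset.sum_congr rfl fun i _ => ?_
  rw [smul_apply, ← sum_apply_stdVec (A (stdVec i)) w, Finset.smul_sum]
  refine Finset.sum_congr rfl fun j _ => ?_
  simp only [smul_eq_mul]; ring

lemma IsInner.posDef (hB : IsInner B) :
    (Matrix.of fun i j : Fin m => B (stdVec i) (stdVec j)).PosDef := by
  rw [Matrix.posDef_iff_dotProduct_mulVec]
  refine ⟨by ext i j; simp [hB.symm (stdVec j)], fun x hx => ?_⟩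
  have h := hB.pos (WithLp.toLp 2 x) (by
    intro h
    apply hx
    simpa using congrArg (WithLp.ofLp) h)
  rw [apply_eq_sum] at h
  simp only [dotProduct, Matrix.mulVec, Finset.mul_sum]
  refine h.trans_le (le_of_eq ?_)
  refine Finset.sum_congr rfl fun i _ => Finset.sum_congr rfl fun j _ => ?_
  simp
  ring

lemma IsInner.det_pos (hB : IsInner B) :
    0 < (Matrix.of fun i j : Fin m => B (stdVec i) (stdVec j)).det := hB.posDef.det_pos

lemma IsInner.density_pos (hB : IsInner B) : 0 < density B := Real.sqrt_pos.2 hB.det_pos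

lemma contDiff_det : ContDiff ℝ ∞ (fun B : Euc m →L[ℝ] Euc m →L[ℝ] ℝ =>
    (Matrix.of fun i j : Fin m => B (stdVec i) (stdVec j)).det) := by
  simp only [Matrix.det_apply, Matrix.of_apply]
  refine ContDiff.sum fun σ _ => ContDiff.const_smul _ (contDiff_prod fun i _ => ?_)
  exact (contDiff_id.clm_apply contDiff_const).clm_apply contDiff_const

lemma IsInner.contDiffAt_density (hB : IsInner B) : ContDiffAt ℝ ∞ density B :=
  contDiff_det.contDiffAt.sqrt hB.det_pos.ne'

/-- The inverse Gram matrix is symmetric, so the trace does not see which slot carries the raised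
index, even when `A` is not symmetric. -/
lemma IsInner.sum_swap (hB : IsInner B) (A : Euc m →L[ℝ] Euc m →L[ℝ] ℝ) :
    ∑ i, A (stdVec i) (B.inverse (EuclideanSpace.proj i))
      = ∑ i, A (B.inverse (EuclideanSpace.proj i)) (stdVec i) := by
  have hc : ∀ i j : Fin m, (B.inverse (EuclideanSpace.proj i)) j
      = (B.inverse (EuclideanSpace.proj j)) i := by
    intro i j
    have h : ∀ a b : Fin m, B (B.inverse (EuclideanSpace.proj a)) (B.inverse (EuclideanSpace.proj b))
        = (B.inverse (EuclideanSpace.proj b)) a := fun a b =>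
      congrArg (fun α : Euc m →L[ℝ] ℝ => α (B.inverse (EuclideanSpace.proj b)))
        (hB.apply_inverse (EuclideanSpace.proj a))
    have h1 := h i j
    have h2 := h j i
    rw [← h1, ← h2, hB.symm]
  have h1 : ∀ i, A (stdVec i) (B.inverse (EuclideanSpace.proj i))
      = ∑ j, (B.inverse (EuclideanSpace.proj i)) j * A (stdVec i) (stdVec j) := fun i => by
    rw [← sum_apply_stdVec (A (stdVec i))]; simp
  have h2 : ∀ i, A (B.inverse (EuclideanSpace.proj i)) (stdVec i)
      = ∑ j, (B.inverse (EuclideanSpace.proj i)) j * A (stdVec j) (stdVec i) := fun i => by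
    rw [← sum_apply_stdVec A]; simp
  simp only [h1, h2]
  rw [Finset.sum_comm]
  refine Finset.sum_congr rfl fun i _ => Finset.sum_congr rfl fun j _ => ?_
  rw [hc]

/-- Jacobi's formula. -/
lemma IsInner.fderiv_density (hB : IsInner B) (A : Euc m →L[ℝ] Euc m →L[ℝ] ℝ) :
    fderiv ℝ density B A
      = density B * ((1 / 2) * ∑ i, A (stdVec i) (B.inverse (EuclideanSpace.proj i))) := by
  set M : (Euc m →L[ℝ] Euc m →L[ℝ] ℝ) → Matrix (Fin m) (Fin m) ℝ :=
    fun B => Matrix.of fun i j : Fin m => B (stdVec i) (stdVec j) with hM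
  set C : Matrix (Fin m) (Fin m) ℝ := Matrix.of fun i j => (B.inverse (EuclideanSpace.proj i)) j
    with hC
  have hCM : C * M B = 1 := by
    ext i k
    have h1 : ∑ j, (B.inverse (EuclideanSpace.proj i)) j * B (stdVec j) (stdVec k)
        = B (B.inverse (EuclideanSpace.proj i)) (stdVec k) := by
      rw [← sum_apply_stdVec B]; simp
    simp only [Matrix.mul_apply, hC, hM, Matrix.of_apply, h1, hB.apply_inverse]
    simp [stdVec, Matrix.one_apply]
  have hMC : M B * C = 1 := mul_eq_one_comm.1 hCM
  have htr : (C * M A).trace = ∑ i, A (stdVec i) (B.inverse (EuclideanSpace.proj i)) := by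
    rw [hB.sum_swap, Matrix.trace]
    refine Finset.sum_congr rfl fun i _ => ?_
    rw [← sum_apply_stdVec A]
    simp [Matrix.mul_apply, hC, hM]
  -- Along a line through `B` the determinant is `det B · det (1 + t C A)` with `C` the inverse Gram
  -- matrix, and the second factor is `1 + t tr(C A)` up to order `t²`.
  have hline : HasDerivAt (fun t : ℝ => (M (B + t • A)).det) ((M B).det * (C * M A).trace) 0 := by
    have heq : ∀ t : ℝ, (M (B + t • A)).det = (M B).det * (1 + t • (C * M A)).det := by
      intro t
      rw [← Matrix.det_mul]
      congr 1
      rw [mul_add, mul_one, Matrix.mul_smul, ← mul_assoc, hMC, one_mul]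
      ext i j
      simp [hM]
    have heq' : (fun t : ℝ => (M (B + t • A)).det) = fun t => (M B).det *
        (1 + (C * M A).trace * t + Polynomial.eval t
        (1 + (Polynomial.X : Polynomial ℝ) • (C * M A).map Polynomial.C).det.divX.divX * t ^ 2) :=
      funext fun t => by rw [heq, Matrix.det_one_add_smul]
    rw [heq']
    apply HasDerivAt.const_mul
    have h1 : HasDerivAt (fun t : ℝ => 1 + (C * M A).trace * t) (C * M A).trace 0 := by
      simpa using ((hasDerivAt_id (0 : ℝ)).const_mul (C * M A).trace).const_add 1
    have h2 : HasDerivAt (fun t : ℝ => Polynomial.eval t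
        (1 + (Polynomial.X : Polynomial ℝ) • (C * M A).map Polynomial.C).det.divX.divX * t ^ 2)
        0 0 := by
      have := (Polynomial.hasDerivAt
        (1 + (Polynomial.X : Polynomial ℝ) • (C * M A).map Polynomial.C).det.divX.divX
          (0 : ℝ)).fun_mul (hasDerivAt_pow 2 (0 : ℝ))
      simpa using this
    simpa using h1.fun_add h2
  have hdet : fderiv ℝ (fun B => (M B).det) B A = (M B).det * (C * M A).trace := by
    have hcd : DifferentiableAt ℝ (fun B => (M B).det) B :=
      (contDiff_det.contDiffAt).differentiableAt (by simp)
    have h3 : HasDerivAt (fun t : ℝ => B + t • A) A 0 := by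
      simpa using ((hasDerivAt_id (0 : ℝ)).smul_const A).const_add B
    have h4 : HasFDerivAt (fun B => (M B).det) (fderiv ℝ (fun B => (M B).det) B)
        (B + (0 : ℝ) • A) := by simpa using hcd.hasFDerivAt
    have h5 : HasDerivAt (fun t : ℝ => (M (B + t • A)).det)
        (fderiv ℝ (fun B => (M B).det) B A) 0 :=
      HasFDerivAt.comp_hasDerivAt (l := fun B => (M B).det) (0 : ℝ) h4 h3
    exact h5.unique hline
  have hpos : 0 < (M B).det := hB.det_pos
  have hcd : DifferentiableAt ℝ (fun B => (M B).det) B :=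
    (contDiff_det.contDiffAt).differentiableAt (by simp)
  have h5 : fderiv ℝ density B = (1 / (2 * √((M B).det))) • fderiv ℝ (fun B => (M B).det) B :=
    (hcd.hasFDerivAt.sqrt hpos.ne').fderiv
  rw [h5, smul_apply, hdet, htr, smul_eq_mul]
  have h6 : density B = √((M B).det) := rfl
  have h7 : √((M B).det) * √((M B).det) = (M B).det := Real.mul_self_sqrt hpos.le
  have h8 : √((M B).det) ≠ 0 := (Real.sqrt_pos.2 hpos).ne'
  rw [h6]
  field_simp
  rw [sq, h7]

/-- The derivative of an index raised by a family of metrics. -/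
lemma IsInner.hasDerivAt_inverse {γ : ℝ → Euc m →L[ℝ] Euc m →L[ℝ] ℝ}
    {γ' : Euc m →L[ℝ] Euc m →L[ℝ] ℝ} {s : ℝ} (hB : IsInner (γ s)) (hγ : HasDerivAt γ γ' s)
    (α : Euc m →L[ℝ] ℝ) :
    HasDerivAt (fun t => (γ t).inverse α) (-(γ s).inverse (γ' ((γ s).inverse α))) s := by
  have hi : DifferentiableAt ℝ (fun t => (γ t).inverse) s :=
    ((hB.isInvertible.contDiffAt_map_inverse (n := 1)).differentiableAt (by simp)).comp s
      hγ.differentiableAt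
  have hd : HasDerivAt (fun t => (γ t).inverse α) (deriv (fun t => (γ t).inverse α) s) s :=
    (hi.clm_apply (differentiableAt_const _)).hasDerivAt
  convert hd using 1
  have hev : ∀ᶠ t in 𝓝 s, (γ t).IsInvertible := by
    have hcont : ContinuousAt γ s := hγ.continuousAt
    obtain ⟨E, hE⟩ := hB.isInvertible
    have := ContinuousLinearEquiv.nhds E
    rw [hE] at this
    filter_upwards [hcont this] with t ht
    obtain ⟨E', hE'⟩ := ht
    exact ⟨E', hE'⟩
  -- Differentiating the identity `γ (γ⁻¹ α) = α` determines the derivative of the raised covector.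
  have hconst : (fun t => γ t ((γ t).inverse α)) =ᶠ[𝓝 s] fun _ => α := by
    filter_upwards [hev] with t ht using ht.self_apply_inverse α
  have h1 : HasDerivAt (fun t => γ t ((γ t).inverse α))
      (γ' ((γ s).inverse α) + γ s (deriv (fun t => (γ t).inverse α) s)) s := hγ.clm_apply hd
  have h2 := h1.unique ((hasDerivAt_const s α).congr_of_eventuallyEq hconst)
  have h3 : γ s (deriv (fun t => (γ t).inverse α) s) = -γ' ((γ s).inverse α) := by
    rw [eq_neg_iff_add_eq_zero, add_comm]; exact h2
  rw [← map_neg, ← h3, hB.inverse_apply]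

lemma IsInner.inverse_eq_sum (B : Euc m →L[ℝ] Euc m →L[ℝ] ℝ) (α : Euc m →L[ℝ] ℝ) :
    B.inverse α = ∑ j, α (stdVec j) • B.inverse (EuclideanSpace.proj j) := by
  have : α = ∑ j, α (stdVec j) • (EuclideanSpace.proj j : Euc m →L[ℝ] ℝ) := by
    ext v
    rw [← sum_apply_stdVec α v, sum_apply]
    exact Finset.sum_congr rfl fun i _ => by simp [mul_comm]
  conv_lhs => rw [this, map_sum]
  simp

lemma hasDerivAt_density {γ : ℝ → Euc m →L[ℝ] Euc m →L[ℝ] ℝ}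
    {γ' : Euc m →L[ℝ] Euc m →L[ℝ] ℝ} {s : ℝ} (hB : IsInner (γ s)) (hγ : HasDerivAt γ γ' s) :
    HasDerivAt (fun t => density (γ t)) (density (γ s) *
      ((1 / 2) * ∑ i, γ' (stdVec i) ((γ s).inverse (EuclideanSpace.proj i)))) s := by
  rw [← hB.fderiv_density]
  exact (hB.contDiffAt_density.differentiableAt (by simp)).hasFDerivAt.comp_hasDerivAt s hγ

/-- The second derivative of the density of a curve of metrics. -/
lemma hasDerivAt_deriv_density {γ γ₁ : ℝ → Euc m →L[ℝ] Euc m →L[ℝ] ℝ}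
    {γ₂ : Euc m →L[ℝ] Euc m →L[ℝ] ℝ} {s : ℝ} (hB : ∀ᶠ t in 𝓝 s, IsInner (γ t))
    (hγ : ∀ᶠ t in 𝓝 s, HasDerivAt γ (γ₁ t) t) (hγ₁ : HasDerivAt γ₁ γ₂ s) :
    HasDerivAt (fun t => deriv (fun t => density (γ t)) t)
      (density (γ s) *
        (((1 / 2) * ∑ i, γ₁ s (stdVec i) ((γ s).inverse (EuclideanSpace.proj i))) ^ 2
        + (1 / 2) * ∑ i, γ₂ (stdVec i) ((γ s).inverse (EuclideanSpace.proj i))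
        - (1 / 2) * ∑ i, ∑ j, γ₁ s (stdVec i) ((γ s).inverse (EuclideanSpace.proj j))
            * γ₁ s ((γ s).inverse (EuclideanSpace.proj i)) (stdVec j))) s := by
  have hBs := hB.self_of_nhds
  have hγs := hγ.self_of_nhds
  have hev : (fun t => deriv (fun t => density (γ t)) t) =ᶠ[𝓝 s] fun t => density (γ t) *
      ((1 / 2) * ∑ i, γ₁ t (stdVec i) ((γ t).inverse (EuclideanSpace.proj i))) := by
    filter_upwards [hB, hγ] with t h1 h2 using (hasDerivAt_density h1 h2).deriv
  refine HasDerivAt.congr_of_eventuallyEq ?_ hev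
  have hsum : HasDerivAt (fun t => ∑ i, γ₁ t (stdVec i) ((γ t).inverse (EuclideanSpace.proj i)))
      (∑ i, (γ₂ (stdVec i) ((γ s).inverse (EuclideanSpace.proj i))
        + γ₁ s (stdVec i) (-(γ s).inverse (γ₁ s ((γ s).inverse (EuclideanSpace.proj i)))))) s := by
    apply HasDerivAt.fun_sum
    intro i _
    have h1 : HasDerivAt (fun t => γ₁ t (stdVec i)) (γ₂ (stdVec i)) s := by
      simpa using hγ₁.clm_apply (hasDerivAt_const s (stdVec i))
    exact h1.clm_apply (hBs.hasDerivAt_inverse hγs _)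
  refine ((hasDerivAt_density hBs hγs).fun_mul (hsum.const_mul (1 / 2 : ℝ))).congr_deriv ?_
  have h3 : ∀ i, γ₁ s (stdVec i) (-(γ s).inverse (γ₁ s ((γ s).inverse (EuclideanSpace.proj i))))
      = -∑ j, γ₁ s (stdVec i) ((γ s).inverse (EuclideanSpace.proj j))
            * γ₁ s ((γ s).inverse (EuclideanSpace.proj i)) (stdVec j) := by
    intro i
    rw [map_neg, IsInner.inverse_eq_sum (γ s) (γ₁ s _), map_sum]
    simp [mul_comm]
  simp only [h3, Finset.sum_add_distrib, Finset.sum_neg_distrib]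
  ring

end Density

/-! ### Divergence in coordinates -/

/-- The divergence `(√det g)⁻¹ ∂_i (√det g · g^{ij} β_j)` of a one-form. -/
def divCoord {m : ℕ} (g : Euc m → Euc m →L[ℝ] Euc m →L[ℝ] ℝ) (β : Euc m → Euc m →L[ℝ] ℝ)
    (y : Euc m) : ℝ :=
  (sqrtDet g y)⁻¹ * ∑ i : Fin m,
    fderiv ℝ (fun z => sqrtDet g z * ((g z).inverse (β z)) i) y (stdVec i)

lemma laplaceCoord_eq_divCoord {m : ℕ} (g : Euc m → Euc m →L[ℝ] Euc m →L[ℝ] ℝ) (u : Euc m → ℝ)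
    (y : Euc m) : laplaceCoord g u y = divCoord g (fderiv ℝ u) y := rfl

section Div

variable {m : ℕ} {g : Euc m → Euc m →L[ℝ] Euc m →L[ℝ] ℝ} {O : Set (Euc m)} {y : Euc m}

lemma divCoord_congr {β β' : Euc m → Euc m →L[ℝ] ℝ} (h : β =ᶠ[𝓝 y] β') :
    divCoord g β y = divCoord g β' y := by
  unfold divCoord
  congr 1
  refine Finset.sum_congr rfl fun i _ => ?_
  congr 1
  apply Filter.EventuallyEq.fderiv_eq
  filter_upwards [h] with z hz
  rw [hz]

lemma MetricOn.contDiffAt_sqrtDet (hg : MetricOn g O) (hy : y ∈ O) :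
    ContDiffAt ℝ ∞ (sqrtDet g) y :=
  (hg.inner y hy).contDiffAt_density.comp y (hg.contDiffAt hy)

lemma MetricOn.sqrtDet_pos (hg : MetricOn g O) (hy : y ∈ O) : 0 < sqrtDet g y :=
  (hg.inner y hy).density_pos

lemma MetricOn.fderiv_sqrtDet (hg : MetricOn g O) (hy : y ∈ O) (u : Euc m) :
    fderiv ℝ (sqrtDet g) y u
      = sqrtDet g y * ((1 / 2) * ∑ i, fderiv ℝ g y u (stdVec i) (dualVec g y i)) := by
  have h := fderiv_fun_comp (𝕜 := ℝ) y
    ((hg.inner y hy).contDiffAt_density.differentiableAt (by simp)) (hg.differentiableAt hy)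
  have h2 : fderiv ℝ (sqrtDet g) y = fderiv ℝ (fun z => density (g z)) y := rfl
  rw [h2, h, ContinuousLinearMap.comp_apply, (hg.inner y hy).fderiv_density]
  rfl

/-- By the product rule and Jacobi's formula, the derivative of `√det g` along the field contributes
half a trace of `Dg`. In this form the divergence can be compared with traces of covariant
derivatives along an immersion. -/
lemma MetricOn.divCoord_eq (hg : MetricOn g O) (hy : y ∈ O) {β : Euc m → Euc m →L[ℝ] ℝ}
    (hβ : ContDiffAt ℝ ∞ β y) :
    divCoord g β y = ∑ i, (fderiv ℝ (fun z => (g z).inverse (β z)) y (stdVec i)) i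
      + (1 / 2) * ∑ i, fderiv ℝ g y ((g y).inverse (β y)) (stdVec i) (dualVec g y i) := by
  have hZ : DifferentiableAt ℝ (fun z => (g z).inverse (β z)) y :=
    ((hg.contDiffAt_inverse hy).clm_apply hβ).differentiableAt (by simp)
  have hs : DifferentiableAt ℝ (sqrtDet g) y := (hg.contDiffAt_sqrtDet hy).differentiableAt (by simp)
  have hpos := hg.sqrtDet_pos hy
  have hZi : ∀ i, HasFDerivAt (fun z => ((g z).inverse (β z)) i)
      ((EuclideanSpace.proj i : Euc m →L[ℝ] ℝ).comp (fderiv ℝ (fun z => (g z).inverse (β z)) y)) y :=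
    fun i => (EuclideanSpace.proj i : Euc m →L[ℝ] ℝ).hasFDerivAt.comp y hZ.hasFDerivAt
  have h1 : ∀ i, fderiv ℝ (fun z => sqrtDet g z * ((g z).inverse (β z)) i) y (stdVec i)
      = sqrtDet g y * (fderiv ℝ (fun z => (g z).inverse (β z)) y (stdVec i)) i
        + ((g y).inverse (β y)) i * fderiv ℝ (sqrtDet g) y (stdVec i) := by
    intro i
    rw [(hs.hasFDerivAt.fun_mul (hZi i)).fderiv]
    simp
  have h2 : ∑ i, ((g y).inverse (β y)) i * fderiv ℝ (sqrtDet g) y (stdVec i)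
      = fderiv ℝ (sqrtDet g) y ((g y).inverse (β y)) := by
    rw [← sum_apply_stdVec (fderiv ℝ (sqrtDet g) y)]; simp
  unfold divCoord
  simp only [h1, Finset.sum_add_distrib, ← Finset.mul_sum]
  rw [h2, hg.fderiv_sqrtDet hy]
  field_simp

lemma MetricOn.contDiffAt_dualVec (hg : MetricOn g O) (hy : y ∈ O) (i : Fin m) :
    ContDiffAt ℝ ∞ (fun z => dualVec g z i) y :=
  (hg.contDiffAt_inverse hy).clm_apply contDiffAt_const

lemma MetricOn.inner_dualVec (hg : MetricOn g O) (hy : y ∈ O) (i : Fin m) (v : Euc m) :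
    g y v (dualVec g y i) = v i := by
  rw [(hg.inner y hy).symm, dualVec, (hg.inner y hy).apply_inverse]
  rfl

end Div

/-! ### Minimal Lagrangian immersions in coordinates -/

/-- A minimal Lagrangian immersion `F` of an open subset `O` of `ℝⁿ` into a Kähler domain, with
induced metric `g`. -/
structure MinimalLagrangian {n : ℕ} (G : Euc (2 * n) → Euc (2 * n) →L[ℝ] Euc (2 * n) →L[ℝ] ℝ)
    (J : Euc (2 * n) → Euc (2 * n) →L[ℝ] Euc (2 * n)) (U : Set (Euc (2 * n)))
    (F : Euc n → Euc (2 * n)) (g : Euc n → Euc n →L[ℝ] Euc n →L[ℝ] ℝ) (O : Set (Euc n)) :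
    Prop where
  kahler : KahlerOn G J U
  metric : MetricOn g O
  smooth : ContDiffOn ℝ ∞ F O
  maps : ∀ y ∈ O, F y ∈ U
  induced : ∀ y ∈ O, ∀ u v, g y u v = G (F y) (fderiv ℝ F y u) (fderiv ℝ F y v)
  lagrangian : ∀ y ∈ O, ∀ u v, G (F y) (J (F y) (fderiv ℝ F y u)) (fderiv ℝ F y v) = 0
  minimal : ∀ y ∈ O, ∀ ν, (∀ v, G (F y) ν (fderiv ℝ F y v) = 0) →
    ∑ i, G (F y) (covD G F (fun z => fderiv ℝ F z (dualVec g y i)) y (stdVec i)) ν = 0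

namespace MinimalLagrangian

variable {n : ℕ} {G : Euc (2 * n) → Euc (2 * n) →L[ℝ] Euc (2 * n) →L[ℝ] ℝ}
    {J : Euc (2 * n) → Euc (2 * n) →L[ℝ] Euc (2 * n)} {U : Set (Euc (2 * n))}
    {F : Euc n → Euc (2 * n)} {g : Euc n → Euc n →L[ℝ] Euc n →L[ℝ] ℝ} {O : Set (Euc n)}
    {y : Euc n}

lemma contDiffAt (h : MinimalLagrangian G J U F g O) (hy : y ∈ O) : ContDiffAt ℝ ∞ F y :=
  h.smooth.contDiffAt (h.metric.isOpen.mem_nhds hy)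

lemma differentiableAt (h : MinimalLagrangian G J U F g O) (hy : y ∈ O) :
    DifferentiableAt ℝ F y := (h.contDiffAt hy).differentiableAt (by simp)

lemma contDiffAt_fderiv (h : MinimalLagrangian G J U F g O) (hy : y ∈ O) :
    ContDiffAt ℝ ∞ (fderiv ℝ F) y := (h.contDiffAt hy).fderiv_right (by simp)

lemma differentiableAt_fderiv (h : MinimalLagrangian G J U F g O) (hy : y ∈ O) :
    DifferentiableAt ℝ (fderiv ℝ F) y := (h.contDiffAt_fderiv hy).differentiableAt (by simp)

lemma differentiableAt_fderiv_apply (h : MinimalLagrangian G J U F g O) (hy : y ∈ O) (v : Euc n) :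
    DifferentiableAt ℝ (fun z => fderiv ℝ F z v) y :=
  (h.differentiableAt_fderiv hy).clm_apply (differentiableAt_const _)

lemma symm (h : MinimalLagrangian G J U F g O) (hy : y ∈ O) (v w : Euc (2 * n)) :
    G (F y) v w = G (F y) w v := (h.kahler.metric.inner _ (h.maps y hy)).symm v w

/-- Derivatives of inner products along `F`. -/
lemma fderiv_inner (h : MinimalLagrangian G J U F g O) (hy : y ∈ O) {Y Z : Euc n → Euc (2 * n)}
    (hY : DifferentiableAt ℝ Y y) (hZ : DifferentiableAt ℝ Z y) (u : Euc n) :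
    fderiv ℝ (fun q => G (F q) (Y q) (Z q)) y u
      = G (F y) (covD G F Y y u) (Z y) + G (F y) (Y y) (covD G F Z y u) :=
  fderiv_inner_along h.kahler.metric (h.maps y hy) (h.differentiableAt hy) hY hZ u

/-- Differentiating a constant inner product. -/
lemma inner_covD_of_eventually (h : MinimalLagrangian G J U F g O) (hy : y ∈ O)
    {Y Z : Euc n → Euc (2 * n)} (hY : DifferentiableAt ℝ Y y) (hZ : DifferentiableAt ℝ Z y) {c : ℝ}
    (hc : ∀ z ∈ O, G (F z) (Y z) (Z z) = c) (u : Euc n) :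
    G (F y) (covD G F Y y u) (Z y) = -G (F y) (Y y) (covD G F Z y u) := by
  have h1 := h.fderiv_inner hy hY hZ u
  have h2 : (fun q => G (F q) (Y q) (Z q)) =ᶠ[𝓝 y] fun _ => c := by
    filter_upwards [h.metric.isOpen.mem_nhds hy] with z hz using hc z hz
  rw [h2.fderiv_eq] at h1
  simp at h1
  linarith

lemma covD_fderiv_symm (h : MinimalLagrangian G J U F g O) (hy : y ∈ O) (u v : Euc n) :
    covD G F (fun q => fderiv ℝ F q v) y u = covD G F (fun q => fderiv ℝ F q u) y v :=
  LagVar.covD_fderiv_symm h.kahler.metric (h.maps y hy) (h.contDiffAt hy) u v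

/-- The full second derivative `∇_a ∂_u F` as a linear map of `u`. -/
lemma exists_hessL (h : MinimalLagrangian G J U F g O) (hy : y ∈ O) (a : Euc n) :
    ∃ T : Euc n →L[ℝ] Euc (2 * n), ∀ u, T u = covD G F (fun z => fderiv ℝ F z u) y a := by
  refine ⟨fderiv ℝ (fderiv ℝ F) y a
    + (christoffelL G (F y) (fderiv ℝ F y a)).comp (fderiv ℝ F y), fun u => ?_⟩
  rw [covD_eq, fderiv_clm_apply (h.differentiableAt_fderiv hy) (differentiableAt_const _)]
  simp

/-- Symmetry of traces. -/
lemma sum_swap (h : MinimalLagrangian G J U F g O) (hy : y ∈ O) (S T : Euc n →L[ℝ] Euc (2 * n)) :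
    ∑ i, G (F y) (S (stdVec i)) (T (dualVec g y i))
      = ∑ i, G (F y) (S (dualVec g y i)) (T (stdVec i)) :=
  (h.metric.inner y hy).sum_swap ((G (F y)).bilinearComp S T)

/-- For a minimal immersion the trace of `∇Y` is the divergence of the tangential part of `Y`. -/
lemma sum_inner_covD (h : MinimalLagrangian G J U F g O) (hy : y ∈ O) {Y : Euc n → Euc (2 * n)}
    (hY : ContDiffAt ℝ ∞ Y y) :
    ∑ i, G (F y) (covD G F Y y (stdVec i)) (fderiv ℝ F y (dualVec g y i))
      = divCoord g (fun z => (G (F z) (Y z)).comp (fderiv ℝ F z)) y := by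
  have hGF : ContDiffAt ℝ ∞ (fun z => G (F z)) y :=
    (h.kahler.metric.contDiffAt (h.maps y hy)).comp y (h.contDiffAt hy)
  have hY1 : DifferentiableAt ℝ Y y := hY.differentiableAt (by simp)
  set β : Euc n → Euc n →L[ℝ] ℝ := fun z => (G (F z) (Y z)).comp (fderiv ℝ F z) with hβdef
  have hβ : ContDiffAt ℝ ∞ β y := (hGF.clm_apply hY).clm_comp (h.contDiffAt_fderiv hy)
  set Z : Euc n → Euc n := fun z => (g z).inverse (β z) with hZdef
  have hZ : ContDiffAt ℝ ∞ Z y := (h.metric.contDiffAt_inverse hy).clm_apply hβ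
  have hZ1 : DifferentiableAt ℝ Z y := hZ.differentiableAt (by simp)
  have hT : DifferentiableAt ℝ (fun z => fderiv ℝ F z (Z z)) y :=
    (h.differentiableAt_fderiv hy).clm_apply hZ1
  have hdF := h.differentiableAt_fderiv_apply hy
  have hperp : ∀ z ∈ O, ∀ v, G (F z) (Y z - fderiv ℝ F z (Z z)) (fderiv ℝ F z v) = 0 := by
    intro z hz v
    rw [map_sub, sub_apply, ← h.induced z hz, hZdef]
    simp only
    rw [(h.metric.inner z hz).apply_inverse]
    simp [hβdef]
  -- The normal part of `Y` is orthogonal to all tangent vectors, so the trace of its derivative is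
  -- minus its pairing with the mean curvature, which is zero.
  have hnormal : ∑ i, G (F y) (covD G F (fun z => Y z - fderiv ℝ F z (Z z)) y (stdVec i))
      (fderiv ℝ F y (dualVec g y i)) = 0 := by
    have h1 : ∀ i, G (F y) (covD G F (fun z => Y z - fderiv ℝ F z (Z z)) y (stdVec i))
        (fderiv ℝ F y (dualVec g y i))
        = -G (F y) (covD G F (fun z => fderiv ℝ F z (dualVec g y i)) y (stdVec i))
          (Y y - fderiv ℝ F y (Z y)) := by
      intro i
      rw [h.symm hy (covD G F (fun z => fderiv ℝ F z (dualVec g y i)) y (stdVec i))]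
      exact h.inner_covD_of_eventually hy (hY1.sub hT) (hdF _)
        (fun z hz => hperp z hz (dualVec g y i)) (stdVec i)
    simp only [h1, Finset.sum_neg_distrib]
    rw [h.minimal y hy _ (hperp y hy), neg_zero]
  -- For the tangential part `dF Z`, the absence of torsion trades the derivative of `dF` for a
  -- derivative of the frame along `Z`; its trace is half the trace of the derivative of `g`, as in
  -- `divCoord_eq`.
  have hsplit : ∀ i, covD G F Y y (stdVec i)
      = covD G F (fun z => Y z - fderiv ℝ F z (Z z)) y (stdVec i)
        + (covD G F (fun z => fderiv ℝ F z (stdVec i)) y (Z y)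
          + fderiv ℝ F y (fderiv ℝ Z y (stdVec i))) := by
    intro i
    rw [covD_sub hY1 hT, ← h.covD_fderiv_symm hy (stdVec i) (Z y),
      ← covD_clm_apply (h.differentiableAt_fderiv hy) hZ1]
    abel
  have hdg : ∀ u v, fderiv ℝ g y (Z y) u v
      = G (F y) (covD G F (fun z => fderiv ℝ F z u) y (Z y)) (fderiv ℝ F y v)
        + G (F y) (fderiv ℝ F y u) (covD G F (fun z => fderiv ℝ F z v) y (Z y)) := by
    intro u v
    rw [← h.fderiv_inner hy (hdF u) (hdF v)]
    have h1 : (fun q => G (F q) (fderiv ℝ F q u) (fderiv ℝ F q v)) =ᶠ[𝓝 y] fun q => g q u v := by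
      filter_upwards [h.metric.isOpen.mem_nhds hy] with z hz using (h.induced z hz u v).symm
    have hg1 := h.metric.differentiableAt hy
    rw [h1.fderiv_eq, fderiv_clm_apply (hg1.clm_apply (differentiableAt_const _))
      (differentiableAt_const _), fderiv_clm_apply hg1 (differentiableAt_const _)]
    simp
  obtain ⟨T, hTe⟩ := h.exists_hessL hy (Z y)
  have hsw := h.sum_swap hy T (fderiv ℝ F y)
  rw [h.metric.divCoord_eq hy hβ]
  simp only [hsplit, map_add, add_apply, Finset.sum_add_distrib, hnormal, zero_add]
  rw [add_comm]
  congr 1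
  · refine Finset.sum_congr rfl fun i _ => ?_
    rw [← h.induced y hy, h.metric.inner_dualVec hy]
  · have h2 : ∀ i, fderiv ℝ g y (Z y) (stdVec i) (dualVec g y i)
        = G (F y) (T (stdVec i)) (fderiv ℝ F y (dualVec g y i))
          + G (F y) (T (dualVec g y i)) (fderiv ℝ F y (stdVec i)) := by
      intro i
      rw [hdg, hTe, hTe, h.symm hy (fderiv ℝ F y (stdVec i))]
    have h3 : (g y).inverse (β y) = Z y := rfl
    simp only [h3, h2, Finset.sum_add_distrib, ← hTe]
    rw [hsw]
    ring

/-! #### The Lagrangian frame -/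

lemma inner_J_J (h : MinimalLagrangian G J U F g O) (hy : y ∈ O) (v w : Euc (2 * n)) :
    G (F y) (J (F y) v) (J (F y) w) = G (F y) v w := h.kahler.metric_J _ (h.maps y hy) v w

lemma inner_J_left (h : MinimalLagrangian G J U F g O) (hy : y ∈ O) (v w : Euc (2 * n)) :
    G (F y) (J (F y) v) w = -G (F y) v (J (F y) w) := h.kahler.metric_J_left (h.maps y hy) v w

lemma inner_J_right (h : MinimalLagrangian G J U F g O) (hy : y ∈ O) (u v : Euc n) :
    G (F y) (fderiv ℝ F y u) (J (F y) (fderiv ℝ F y v)) = 0 := by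
  rw [h.symm hy, h.lagrangian y hy]

/-- The images of `dF` and `J dF` are orthogonal by the Lagrangian condition, and both maps are
isometric for `g`. Hence `(u, v) ↦ dF u + J dF v` is injective, and the dimensions agree. -/
lemma exists_decomp (h : MinimalLagrangian G J U F g O) (hy : y ∈ O) (X : Euc (2 * n)) :
    ∃ u v, X = fderiv ℝ F y u + J (F y) (fderiv ℝ F y v) := by
  let T : (Euc n × Euc n) →ₗ[ℝ] Euc (2 * n) :=
    ((fderiv ℝ F y).coprod ((J (F y)).comp (fderiv ℝ F y)) : (Euc n × Euc n) →L[ℝ] Euc (2 * n))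
  have hTe : ∀ u v, T (u, v) = fderiv ℝ F y u + J (F y) (fderiv ℝ F y v) := fun u v => by
    simp [T]
  have hinj : Function.Injective T := by
    rw [injective_iff_map_eq_zero]
    rintro ⟨u, v⟩ h0
    rw [hTe] at h0
    have h1 : G (F y) (fderiv ℝ F y u + J (F y) (fderiv ℝ F y v))
        (fderiv ℝ F y u + J (F y) (fderiv ℝ F y v)) = 0 := by rw [h0]; simp
    simp only [map_add, add_apply, h.inner_J_right hy, h.lagrangian y hy, h.inner_J_J hy,
      ← h.induced y hy] at h1
    have hu := (h.metric.inner y hy).nonneg u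
    have hv := (h.metric.inner y hy).nonneg v
    have hu0 := (h.metric.inner y hy).eq_zero (v := u) (by linarith)
    have hv0 := (h.metric.inner y hy).eq_zero (v := v) (by linarith)
    rw [hu0, hv0]; rfl
  have hdim : Module.finrank ℝ (Euc n × Euc n) = Module.finrank ℝ (Euc (2 * n)) := by
    simp [two_mul]
  have hsurj := (LinearMap.injective_iff_surjective_of_finrank_eq_finrank hdim).1 hinj
  obtain ⟨⟨u, v⟩, huv⟩ := hsurj X
  exact ⟨u, v, by rw [← huv, hTe]⟩

/-- The vectors `dF ∂_a` and `J dF ∂_a` form a frame of the ambient space whose dual frame is given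
by the raised vectors `dualVec`. -/
lemma expand (h : MinimalLagrangian G J U F g O) (hy : y ∈ O) (X : Euc (2 * n)) :
    X = ∑ a, G (F y) X (fderiv ℝ F y (dualVec g y a)) • fderiv ℝ F y (stdVec a)
      + ∑ a, G (F y) X (J (F y) (fderiv ℝ F y (dualVec g y a)))
          • J (F y) (fderiv ℝ F y (stdVec a)) := by
  obtain ⟨u, v, rfl⟩ := h.exists_decomp hy X
  have h1 : ∀ a, G (F y) (fderiv ℝ F y u + J (F y) (fderiv ℝ F y v))
      (fderiv ℝ F y (dualVec g y a)) = u a := by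
    intro a
    rw [map_add, add_apply, h.lagrangian y hy, ← h.induced y hy, h.metric.inner_dualVec hy, add_zero]
  have h2 : ∀ a, G (F y) (fderiv ℝ F y u + J (F y) (fderiv ℝ F y v))
      (J (F y) (fderiv ℝ F y (dualVec g y a))) = v a := by
    intro a
    rw [map_add, add_apply, h.inner_J_right hy, h.inner_J_J hy, ← h.induced y hy,
      h.metric.inner_dualVec hy, zero_add]
  simp only [h1, h2]
  rw [sum_apply_stdVec (fderiv ℝ F y) u]
  congr 1
  exact (sum_apply_stdVec ((J (F y)).comp (fderiv ℝ F y)) v).symm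

lemma inner_eq_sum (h : MinimalLagrangian G J U F g O) (hy : y ∈ O) (X X' : Euc (2 * n)) :
    G (F y) X X' = ∑ a, (G (F y) X (fderiv ℝ F y (dualVec g y a)) * G (F y) (fderiv ℝ F y (stdVec a)) X'
      + G (F y) X (J (F y) (fderiv ℝ F y (dualVec g y a)))
          * G (F y) (J (F y) (fderiv ℝ F y (stdVec a))) X') := by
  conv_lhs => rw [h.expand hy X, map_add, add_apply, map_sum, map_sum, sum_apply, sum_apply]
  rw [← Finset.sum_add_distrib]
  refine Finset.sum_congr rfl fun a _ => ?_
  simp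

/-- Traces of endomorphisms of the ambient space in the Lagrangian frame. -/
lemma trace_eq (h : MinimalLagrangian G J U F g O) (hy : y ∈ O)
    (T : Euc (2 * n) →L[ℝ] Euc (2 * n)) :
    ∑ i, T (stdVec i) i = ∑ a, (G (F y) (T (fderiv ℝ F y (stdVec a))) (fderiv ℝ F y (dualVec g y a))
      + G (F y) (T (J (F y) (fderiv ℝ F y (stdVec a))))
        (J (F y) (fderiv ℝ F y (dualVec g y a)))) := by
  have h1 : ∀ i, T (stdVec i) i
      = ∑ a, (G (F y) (stdVec i) (fderiv ℝ F y (dualVec g y a)) * T (fderiv ℝ F y (stdVec a)) i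
        + G (F y) (stdVec i) (J (F y) (fderiv ℝ F y (dualVec g y a)))
          * T (J (F y) (fderiv ℝ F y (stdVec a))) i) := by
    intro i
    conv_lhs => rw [h.expand hy (stdVec i), map_add, map_sum, map_sum]
    simp [Finset.sum_add_distrib]
  simp only [h1]
  rw [Finset.sum_comm]
  refine Finset.sum_congr rfl fun a _ => ?_
  rw [Finset.sum_add_distrib, ← sum_apply_stdVec (G (F y)) (T (fderiv ℝ F y (stdVec a))),
    ← sum_apply_stdVec (G (F y)) (T (J (F y) (fderiv ℝ F y (stdVec a)))), sum_apply, sum_apply]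
  congr 1
  · exact Finset.sum_congr rfl fun i _ => by simp [mul_comm]
  · exact Finset.sum_congr rfl fun i _ => by simp [mul_comm]

/-- The Ricci curvature of a Kähler metric from a Lagrangian frame. -/
lemma sum_riemann (h : MinimalLagrangian G J U F g O) (hy : y ∈ O) (W : Euc (2 * n)) :
    ∑ a, G (F y) (riemann G (F y) W (fderiv ℝ F y (stdVec a)) W) (fderiv ℝ F y (dualVec g y a))
      + ∑ a, G (F y) (riemann G (F y) (J (F y) W) (fderiv ℝ F y (stdVec a)) (J (F y) W))
        (fderiv ℝ F y (dualVec g y a)) = -ricci G (F y) W W := by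
  have hU := h.maps y hy
  have hg := h.kahler.metric
  obtain ⟨T, hT⟩ : ∃ T : Euc (2 * n) →L[ℝ] Euc (2 * n), ∀ u, T u = riemann G (F y) u W W := by
    refine ⟨((fderiv ℝ (christoffelL G) (F y)).flip W).flip W
      - (fderiv ℝ (christoffelL G) (F y) W).flip W
      + (christoffelL G (F y)).flip (christoffelL G (F y) W W)
      - (christoffelL G (F y) W).comp ((christoffelL G (F y)).flip W), fun u => ?_⟩
    rw [hg.riemann_eq hU]
    simp
  have htr := h.trace_eq hy T
  simp only [hT] at htr
  rw [ricci, htr, Finset.sum_add_distrib, neg_add, ← Finset.sum_neg_distrib,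
    ← Finset.sum_neg_distrib]
  congr 1
  · refine Finset.sum_congr rfl fun a _ => ?_
    rw [riemann_swap]; simp
  · refine Finset.sum_congr rfl fun a _ => ?_
    -- In the normal half of the frame `J` is moved off the frame vector: `R(J e, W) = R(J J e, J W)
    -- = -R(e, J W)`, while `J` passes through the last argument. This produces the sum for `J W`.
    rw [← neg_eq_iff_eq_neg.2 (h.inner_J_left hy _ _), ← h.kahler.riemann_J hU,
      ← h.kahler.riemann_J_J hU (J (F y) (fderiv ℝ F y (stdVec a))) W, h.kahler.J_J _ hU, neg_neg,
      riemann_swap]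
    have : ∀ v, riemann G (F y) (-v) (J (F y) W) (J (F y) W)
        = -riemann G (F y) v (J (F y) W) (J (F y) W) := by
      intro v
      rw [hg.riemann_eq hU, hg.riemann_eq hU]
      simp
      abel
    rw [this]

end MinimalLagrangian

/-- The pullback of a bilinear form under a linear map. -/
def pull {E F : Type*} [NormedAddCommGroup E] [NormedSpace ℝ E] [NormedAddCommGroup F]
    [NormedSpace ℝ F] (B : F →L[ℝ] F →L[ℝ] ℝ) (D : E →L[ℝ] F) : E →L[ℝ] E →L[ℝ] ℝ :=
  (ContinuousLinearMap.precomp ℝ D).comp (B.comp D)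

section Pull

variable {E F P : Type*} [NormedAddCommGroup E] [NormedSpace ℝ E] [NormedAddCommGroup F]
    [NormedSpace ℝ F] [NormedAddCommGroup P] [NormedSpace ℝ P]

@[simp] lemma pull_apply (B : F →L[ℝ] F →L[ℝ] ℝ) (D : E →L[ℝ] F) (u v : E) :
    pull B D u v = B (D u) (D v) := rfl

lemma ContDiffAt.pull {B : P → F →L[ℝ] F →L[ℝ] ℝ} {D : P → E →L[ℝ] F} {p : P} {k : WithTop ℕ∞}
    (hB : ContDiffAt ℝ k B p) (hD : ContDiffAt ℝ k D p) :
    ContDiffAt ℝ k (fun q => LagVar.pull (B q) (D q)) p := by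
  have h1 : ContDiffAt ℝ k (fun q => (ContinuousLinearMap.compL ℝ E F ℝ).flip (D q)) p :=
    ((ContinuousLinearMap.compL ℝ E F ℝ).flip.contDiff.contDiffAt).comp p hD
  exact h1.clm_comp (hB.clm_comp hD)

end Pull

lemma MetricOn.exists_riemannL {m : ℕ} {g : Euc m → Euc m →L[ℝ] Euc m →L[ℝ] ℝ} {U : Set (Euc m)}
    (hg : MetricOn g U) {y : Euc m} (hy : y ∈ U) (v w : Euc m) :
    ∃ T : Euc m →L[ℝ] Euc m, ∀ u, T u = riemann g y v u w := by
  refine ⟨(fderiv ℝ (christoffelL g) y v).flip w - ((fderiv ℝ (christoffelL g) y).flip v).flip w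
      + (christoffelL g y v).comp ((christoffelL g y).flip w)
      - (christoffelL g y).flip (christoffelL g y v w), fun u => ?_⟩
  rw [hg.riemann_eq hy]
  simp

/-! ### Gradients along a minimal Lagrangian: Hessian, second fundamental form, Bochner formula. -/

namespace MinimalLagrangian

variable {n : ℕ} {G : Euc (2 * n) → Euc (2 * n) →L[ℝ] Euc (2 * n) →L[ℝ] ℝ}
    {J : Euc (2 * n) → Euc (2 * n) →L[ℝ] Euc (2 * n)} {U : Set (Euc (2 * n))}
    {F : Euc n → Euc (2 * n)} {g : Euc n → Euc n →L[ℝ] Euc n →L[ℝ] ℝ} {O : Set (Euc n)}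
    {y : Euc n} {f : Euc n → ℝ}

/-- The gradient of `f` as a vector field along `F`. -/
def gradAlong (F : Euc n → Euc (2 * n)) (g : Euc n → Euc n →L[ℝ] Euc n →L[ℝ] ℝ) (f : Euc n → ℝ)
    (z : Euc n) : Euc (2 * n) :=
  fderiv ℝ F z ((g z).inverse (fderiv ℝ f z))

lemma contDiffAt_coordGrad (h : MinimalLagrangian G J U F g O) (hf : ContDiffOn ℝ ∞ f O)
    (hy : y ∈ O) : ContDiffAt ℝ ∞ (fun z => (g z).inverse (fderiv ℝ f z)) y :=
  (h.metric.contDiffAt_inverse hy).clm_apply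
    ((hf.contDiffAt (h.metric.isOpen.mem_nhds hy)).fderiv_right (by simp))

lemma contDiffAt_gradAlong (h : MinimalLagrangian G J U F g O) (hf : ContDiffOn ℝ ∞ f O)
    (hy : y ∈ O) : ContDiffAt ℝ ∞ (gradAlong F g f) y :=
  (h.contDiffAt_fderiv hy).clm_apply (h.contDiffAt_coordGrad hf hy)

lemma differentiableAt_gradAlong (h : MinimalLagrangian G J U F g O) (hf : ContDiffOn ℝ ∞ f O)
    (hy : y ∈ O) : DifferentiableAt ℝ (gradAlong F g f) y :=
  (h.contDiffAt_gradAlong hf hy).differentiableAt (by simp)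

lemma inner_gradAlong (h : MinimalLagrangian G J U F g O) (hy : y ∈ O) (v : Euc n) :
    G (F y) (gradAlong F g f y) (fderiv ℝ F y v) = fderiv ℝ f y v := by
  rw [gradAlong, ← h.induced y hy, (h.metric.inner y hy).apply_inverse]

/-- The one-form obtained by pairing the gradient with `dF` is `df`, so `sum_inner_covD` applies.
Written as an ambient trace, the Laplacian can be differentiated by means of the ambient curvature.
-/
lemma laplaceCoord_eq_sum (h : MinimalLagrangian G J U F g O) (hf : ContDiffOn ℝ ∞ f O)
    (hy : y ∈ O) : laplaceCoord g f y
      = ∑ i, G (F y) (covD G F (gradAlong F g f) y (stdVec i)) (fderiv ℝ F y (dualVec g y i)) := by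
  rw [laplaceCoord_eq_divCoord, h.sum_inner_covD hy (h.contDiffAt_gradAlong hf hy)]
  apply divCoord_congr
  filter_upwards [h.metric.isOpen.mem_nhds hy] with z hz
  ext v
  exact (h.inner_gradAlong hz v).symm

/-- The Hessian of `f` is symmetric. -/
lemma hess_symm (h : MinimalLagrangian G J U F g O) (hf : ContDiffOn ℝ ∞ f O) (hy : y ∈ O)
    (u v : Euc n) : G (F y) (covD G F (gradAlong F g f) y u) (fderiv ℝ F y v)
      = G (F y) (covD G F (gradAlong F g f) y v) (fderiv ℝ F y u) := by
  have hfy := hf.contDiffAt (h.metric.isOpen.mem_nhds hy)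
  have hW := h.differentiableAt_gradAlong hf hy
  have h1 : ∀ a b, G (F y) (covD G F (gradAlong F g f) y a) (fderiv ℝ F y b)
      = fderiv ℝ (fderiv ℝ f) y a b
        - G (F y) (gradAlong F g f y) (covD G F (fun q => fderiv ℝ F q b) y a) := by
    intro a b
    have h2 := h.fderiv_inner hy hW (h.differentiableAt_fderiv_apply hy b) a
    have h3 : (fun q => G (F q) (gradAlong F g f q) (fderiv ℝ F q b))
        =ᶠ[𝓝 y] fun q => fderiv ℝ f q b := by
      filter_upwards [h.metric.isOpen.mem_nhds hy] with z hz using h.inner_gradAlong hz b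
    have hd : DifferentiableAt ℝ (fderiv ℝ f) y :=
      (hfy.fderiv_right (m := 1) (by norm_cast)).differentiableAt (by simp)
    rw [h3.fderiv_eq, fderiv_clm_apply hd (differentiableAt_const _)] at h2
    simp at h2
    linarith
  have hs : IsSymmSndFDerivAt ℝ f y := hfy.isSymmSndFDerivAt (by simp [ENat.LEInfty.out])
  rw [h1, h1, hs.eq u v, h.covD_fderiv_symm hy u v]

lemma covD_J_fderiv (h : MinimalLagrangian G J U F g O) (hy : y ∈ O) (u v : Euc n) :
    covD G F (fun z => J (F z) (fderiv ℝ F z v)) y u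
      = J (F y) (covD G F (fun z => fderiv ℝ F z v) y u) :=
  h.kahler.covD_J (h.maps y hy) (h.differentiableAt hy) (h.differentiableAt_fderiv_apply hy v) u

lemma differentiableAt_J (h : MinimalLagrangian G J U F g O) (hy : y ∈ O)
    {Y : Euc n → Euc (2 * n)} (hY : DifferentiableAt ℝ Y y) :
    DifferentiableAt ℝ (fun z => J (F z) (Y z)) y :=
  (((h.kahler.contDiffAt (h.maps y hy)).differentiableAt (by simp)).comp y
    (h.differentiableAt hy)).clm_apply hY

/-- The second fundamental form of a Lagrangian immersion is symmetric. -/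
lemma sff_symm (h : MinimalLagrangian G J U F g O) (hf : ContDiffOn ℝ ∞ f O) (hy : y ∈ O)
    (u v : Euc n) : G (F y) (covD G F (gradAlong F g f) y u) (J (F y) (fderiv ℝ F y v))
      = G (F y) (covD G F (gradAlong F g f) y v) (J (F y) (fderiv ℝ F y u)) := by
  have hW := h.differentiableAt_gradAlong hf hy
  -- The gradient is tangent and `J ∂_b F` is normal. Differentiating their zero product, with `J`
  -- parallel, moves the derivative to `∇_a ∂_b F`, which is symmetric.
  have h1 : ∀ a b, G (F y) (covD G F (gradAlong F g f) y a) (J (F y) (fderiv ℝ F y b))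
      = -G (F y) (gradAlong F g f y) (J (F y) (covD G F (fun q => fderiv ℝ F q b) y a)) := by
    intro a b
    rw [← h.covD_J_fderiv hy]
    exact h.inner_covD_of_eventually hy hW
      (h.differentiableAt_J hy (h.differentiableAt_fderiv_apply hy b))
      (fun z hz => h.inner_J_right hz _ b) a
  rw [h1, h1, h.covD_fderiv_symm hy u v]

/-- A Bochner formula: the derivative of `Δf` along `∇f`. -/
lemma fderiv_laplaceCoord (h : MinimalLagrangian G J U F g O) (hf : ContDiffOn ℝ ∞ f O)
    (hy : y ∈ O) :
    fderiv ℝ (laplaceCoord g f) y ((g y).inverse (fderiv ℝ f y))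
      = ∑ i, G (F y) (covD G F (fun z => covD G F (gradAlong F g f) z
          ((g z).inverse (fderiv ℝ f z))) y (stdVec i)) (fderiv ℝ F y (dualVec g y i))
        + ∑ i, G (F y) (riemann G (F y) (gradAlong F g f y) (fderiv ℝ F y (stdVec i))
          (gradAlong F g f y)) (fderiv ℝ F y (dualVec g y i))
        - ∑ i, ∑ a, G (F y) (covD G F (gradAlong F g f) y (stdVec i)) (fderiv ℝ F y (dualVec g y a))
          * G (F y) (covD G F (gradAlong F g f) y (stdVec a)) (fderiv ℝ F y (dualVec g y i))
        + ∑ i, ∑ a, G (F y) (covD G F (gradAlong F g f) y (stdVec i))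
            (J (F y) (fderiv ℝ F y (dualVec g y a)))
          * G (F y) (covD G F (gradAlong F g f) y (stdVec a))
            (J (F y) (fderiv ℝ F y (dualVec g y i))) := by
  have hWs := h.contDiffAt_gradAlong hf hy
  have hW := h.differentiableAt_gradAlong hf hy
  have hws := h.contDiffAt_coordGrad hf hy
  have hw : DifferentiableAt ℝ (fun z => (g z).inverse (fderiv ℝ f z)) y :=
    hws.differentiableAt (by simp)
  have hU := h.maps y hy
  have hG := h.kahler.metric
  have hFs := h.contDiffAt hy
  have hdF := h.differentiableAt_fderiv hy
  set W := gradAlong F g f with hWdef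
  set w : Euc n → Euc n := fun z => (g z).inverse (fderiv ℝ f z) with hwdef
  set dw := fderiv ℝ w y with hdw
  have hDW : ∀ v, DifferentiableAt ℝ (fun z => covD G F W z v) y := fun v =>
    (contDiffAt_covD hG hU hFs hWs contDiffAt_const).differentiableAt (by simp)
  have hFi : ∀ i, DifferentiableAt ℝ (fun z => fderiv ℝ F z (dualVec g z i)) y := fun i =>
    hdF.clm_apply ((h.metric.contDiffAt_dualVec hy i).differentiableAt (by simp))
  have hstep1 : fderiv ℝ (laplaceCoord g f) y (w y)
      = ∑ i, (G (F y) (covD G F (fun z => covD G F W z (stdVec i)) y (w y))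
          (fderiv ℝ F y (dualVec g y i))
        + G (F y) (covD G F W y (stdVec i))
          (covD G F (fun z => fderiv ℝ F z (dualVec g z i)) y (w y))) := by
    have hev : laplaceCoord g f =ᶠ[𝓝 y] fun z => ∑ i, G (F z) (covD G F W z (stdVec i))
        (fderiv ℝ F z (dualVec g z i)) := by
      filter_upwards [h.metric.isOpen.mem_nhds hy] with z hz using h.laplaceCoord_eq_sum hf hz
    have hGF : DifferentiableAt ℝ (fun z => G (F z)) y :=
      (hG.differentiableAt hU).comp y (h.differentiableAt hy)
    rw [hev.fderiv_eq, fderiv_fun_sum fun i _ => (hGF.clm_apply (hDW _)).clm_apply (hFi i),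
      sum_apply]
    exact Finset.sum_congr rfl fun i _ => h.fderiv_inner hy (hDW _) (hFi i) (w y)
  -- the frame part
  have hDe : ∀ a, covD G F (fun z => fderiv ℝ F z (stdVec a)) y (w y)
      = covD G F W y (stdVec a) - fderiv ℝ F y (dw (stdVec a)) := by
    intro a
    rw [h.covD_fderiv_symm hy (w y) (stdVec a), eq_sub_iff_add_eq]
    exact (covD_clm_apply hdF hw (stdVec a)).symm
  -- The derivative of the raised frame `e^i` is found from the constant pairings `⟨∂_a F, e^i⟩ =
  -- δ_a^i`, and below from `⟨J ∂_a F, e^i⟩ = 0`.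
  have hfr1 : ∀ i a, G (F y) (fderiv ℝ F y (stdVec a))
      (covD G F (fun z => fderiv ℝ F z (dualVec g z i)) y (w y))
      = dw (stdVec a) i - G (F y) (covD G F W y (stdVec a)) (fderiv ℝ F y (dualVec g y i)) := by
    intro i a
    have h1 := h.inner_covD_of_eventually hy (h.differentiableAt_fderiv_apply hy (stdVec a)) (hFi i)
      (c := (stdVec a : Euc n) i)
      (fun z hz => by rw [← h.induced z hz, h.metric.inner_dualVec hz]) (w y)
    rw [hDe, map_sub, sub_apply, ← h.induced y hy, h.metric.inner_dualVec hy] at h1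
    linarith
  have hfr2 : ∀ i a, G (F y) (J (F y) (fderiv ℝ F y (stdVec a)))
      (covD G F (fun z => fderiv ℝ F z (dualVec g z i)) y (w y))
      = G (F y) (covD G F W y (stdVec a)) (J (F y) (fderiv ℝ F y (dualVec g y i))) := by
    intro i a
    have h1 := h.inner_covD_of_eventually hy
      (h.differentiableAt_J hy (h.differentiableAt_fderiv_apply hy (stdVec a))) (hFi i)
      (c := 0) (fun z hz => h.lagrangian z hz _ _) (w y)
    rw [h.covD_J_fderiv hy, h.inner_J_left hy, hDe, map_sub, sub_apply, h.inner_J_right hy] at h1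
    linarith
  -- The tangential component of the derivative of the raised frame yields minus the squared Hessian
  -- and a term in `dw`; the `J`-normal component yields plus the squared second fundamental form.
  have hframe : ∀ i, G (F y) (covD G F W y (stdVec i))
      (covD G F (fun z => fderiv ℝ F z (dualVec g z i)) y (w y))
      = ∑ a, G (F y) (covD G F W y (stdVec i)) (fderiv ℝ F y (dualVec g y a)) * dw (stdVec a) i
        - ∑ a, G (F y) (covD G F W y (stdVec i)) (fderiv ℝ F y (dualVec g y a))
          * G (F y) (covD G F W y (stdVec a)) (fderiv ℝ F y (dualVec g y i))
        + ∑ a, G (F y) (covD G F W y (stdVec i)) (J (F y) (fderiv ℝ F y (dualVec g y a)))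
          * G (F y) (covD G F W y (stdVec a)) (J (F y) (fderiv ℝ F y (dualVec g y i))) := by
    intro i
    rw [h.inner_eq_sum hy]
    simp only [hfr1, hfr2]
    rw [← Finset.sum_sub_distrib, ← Finset.sum_add_distrib]
    exact Finset.sum_congr rfl fun a _ => by ring
  -- the curvature part
  have hcurv : ∀ i, covD G F (fun z => covD G F W z (stdVec i)) y (w y)
      = covD G F (fun z => covD G F W z (w z)) y (stdVec i) - covD G F W y (dw (stdVec i))
        + riemann G (F y) (W y) (fderiv ℝ F y (stdVec i)) (W y) := by
    intro i
    have h1 := covD_covD_sub hG hU hFs hWs (w y) (stdVec i)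
    have h2 : covD G F (fun z => covD G F W z (w z)) y (stdVec i)
        = covD G F (fun z => covD G F W z (w y)) y (stdVec i) + covD G F W y (dw (stdVec i)) := by
      have := covD_clm_apply (g := G) (F := F)
        ((contDiffAt_covDL hG hU hFs hWs).differentiableAt (by simp)) hw (stdVec i)
      simpa only [covDL_apply] using this
    have h3 : W y = fderiv ℝ F y (w y) := rfl
    rw [← h3] at h1
    rw [h2, add_sub_cancel_right, ← h1]
    abel
  have hcorr : ∀ i, G (F y) (covD G F W y (dw (stdVec i))) (fderiv ℝ F y (dualVec g y i))
      = ∑ a, dw (stdVec i) a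
        * G (F y) (covD G F W y (stdVec a)) (fderiv ℝ F y (dualVec g y i)) := by
    intro i
    rw [← covDL_apply, ← sum_apply_stdVec (covDL G F W y) (dw (stdVec i)), map_sum, sum_apply]
    exact Finset.sum_congr rfl fun a _ => by simp [covDL_apply]
  -- The terms in `dw` arise only because the coordinate frame is not invariant under the flow of
  -- `w`; the one from the frame cancels the one from the curvature part.
  have hcancel : ∑ i, ∑ a, G (F y) (covD G F W y (stdVec i)) (fderiv ℝ F y (dualVec g y a))
        * dw (stdVec a) i
      = ∑ i, ∑ a, dw (stdVec i) a
        * G (F y) (covD G F W y (stdVec a)) (fderiv ℝ F y (dualVec g y i)) := by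
    rw [Finset.sum_comm]
    exact Finset.sum_congr rfl fun i _ => Finset.sum_congr rfl fun a _ => mul_comm _ _
  rw [hstep1]
  simp only [hcurv, hframe, map_add, map_sub, add_apply, sub_apply, hcorr, Finset.sum_add_distrib,
    Finset.sum_sub_distrib, hcancel]
  ring

end MinimalLagrangian

/-! ### The second variation of the density -/

section SecondVariation

variable {n m : ℕ} {G : Euc m → Euc m →L[ℝ] Euc m →L[ℝ] ℝ} {U : Set (Euc m)}
    {Φ : ℝ × Euc n → Euc m} {Ω : Set (ℝ × Euc n)} {s : ℝ} {y : Euc n}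

/-- The metric induced at the point `y` by the slice `Φ (s, ·)`. -/
def sliceMetric (G : Euc m → Euc m →L[ℝ] Euc m →L[ℝ] ℝ) (Φ : ℝ × Euc n → Euc m) (s : ℝ)
    (y : Euc n) : Euc n →L[ℝ] Euc n →L[ℝ] ℝ :=
  pull (G (Φ (s, y))) ((fderiv ℝ Φ (s, y)).comp (ContinuousLinearMap.inr ℝ ℝ (Euc n)))

lemma sliceMetric_apply (u v : Euc n) : sliceMetric G Φ s y u v
    = G (Φ (s, y)) (fderiv ℝ Φ (s, y) (0, u)) (fderiv ℝ Φ (s, y) (0, v)) := by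
  simp [sliceMetric]

lemma contDiffAt_sliceMetric (hG : MetricOn G U) (hp : Φ (s, y) ∈ U)
    (hΦ : ContDiffAt ℝ ∞ Φ (s, y)) :
    ContDiffAt ℝ ∞ (fun p : ℝ × Euc n => sliceMetric G Φ p.1 p.2) (s, y) := by
  apply ContDiffAt.pull
  · exact (hG.contDiffAt hp).comp (s, y) hΦ
  · exact (hΦ.fderiv_right (by simp)).clm_comp contDiffAt_const

lemma hasDerivAt_mk_left (s : ℝ) (y : Euc n) :
    HasDerivAt (fun t : ℝ => (t, y)) ((1, 0) : ℝ × Euc n) s :=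
  (hasDerivAt_id s).prodMk (hasDerivAt_const s y)

lemma hasFDerivAt_mk_right (s : ℝ) (y : Euc n) :
    HasFDerivAt (fun z : Euc n => (s, z)) (ContinuousLinearMap.inr ℝ ℝ (Euc n)) y :=
  hasFDerivAt_prodMk_right s y

lemma deriv_slice {E : Type*} [NormedAddCommGroup E] [NormedSpace ℝ E] {H : ℝ × Euc n → E}
    (hH : DifferentiableAt ℝ H (s, y)) :
    deriv (fun t => H (t, y)) s = fderiv ℝ H (s, y) (1, 0) :=
  (HasFDerivAt.comp_hasDerivAt s (l := H) (f := fun t : ℝ => (t, y)) hH.hasFDerivAt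
    (hasDerivAt_mk_left s y)).deriv

lemma fderiv_slice {E : Type*} [NormedAddCommGroup E] [NormedSpace ℝ E] {H : ℝ × Euc n → E}
    (hH : DifferentiableAt ℝ H (s, y)) (v : Euc n) :
    fderiv ℝ (fun z => H (s, z)) y v = fderiv ℝ H (s, y) (0, v) := by
  have := (HasFDerivAt.comp y (g := H) (f := fun z : Euc n => (s, z)) hH.hasFDerivAt
    (hasFDerivAt_mk_right s y)).fderiv
  have h2 : fderiv ℝ (fun z => H (s, z)) y
    = (fderiv ℝ H (s, y)).comp (ContinuousLinearMap.inr ℝ ℝ (Euc n)) := this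
  rw [h2]; simp

lemma covD_slice {Y : ℝ × Euc n → Euc m} (hF : DifferentiableAt ℝ Φ (s, y))
    (hY : DifferentiableAt ℝ Y (s, y)) (v : Euc n) :
    covD G (fun z => Φ (s, z)) (fun z => Y (s, z)) y v = covD G Φ Y (s, y) (0, v) := by
  rw [covD, covD, fderiv_slice hF, fderiv_slice hY]

/-- The first derivative of the induced metrics. -/
lemma fderiv_inner_slice (hG : MetricOn G U) {p : ℝ × Euc n} (hp : Φ p ∈ U)
    (hΦ : ContDiffAt ℝ ∞ Φ p) (u v : Euc n) :
    fderiv ℝ (fun q => G (Φ q) (fderiv ℝ Φ q (0, u)) (fderiv ℝ Φ q (0, v))) p (1, 0)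
      = G (Φ p) (covD G Φ (fun q => fderiv ℝ Φ q (1, 0)) p (0, u)) (fderiv ℝ Φ p (0, v))
        + G (Φ p) (fderiv ℝ Φ p (0, u)) (covD G Φ (fun q => fderiv ℝ Φ q (1, 0)) p (0, v)) := by
  have hd : ∀ a, DifferentiableAt ℝ (fun q => fderiv ℝ Φ q a) p := fun a =>
    (((hΦ.fderiv_right (m := 1) (by norm_cast)).differentiableAt (by simp))).clm_apply
      (differentiableAt_const _)
  rw [fderiv_inner_along hG hp (hΦ.differentiableAt (by simp)) (hd _) (hd _),
    covD_fderiv_symm hG hp hΦ (1, 0) (0, u), covD_fderiv_symm hG hp hΦ (1, 0) (0, v)]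

/-- The second derivative of the induced metrics. -/
lemma fderiv_fderiv_inner_slice (hG : MetricOn G U) {p : ℝ × Euc n} (hp : Φ p ∈ U)
    (hΦ : ∀ᶠ q in 𝓝 p, ContDiffAt ℝ ∞ Φ q) (u v : Euc n) :
    fderiv ℝ (fun q => fderiv ℝ
        (fun q => G (Φ q) (fderiv ℝ Φ q (0, u)) (fderiv ℝ Φ q (0, v))) q (1, 0)) p (1, 0)
      = G (Φ p) (covD G Φ (fun q => covD G Φ (fun q => fderiv ℝ Φ q (1, 0)) q (1, 0)) p (0, u)
          + riemann G (Φ p) (fderiv ℝ Φ p (1, 0)) (fderiv ℝ Φ p (0, u)) (fderiv ℝ Φ p (1, 0)))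
          (fderiv ℝ Φ p (0, v))
        + 2 * G (Φ p) (covD G Φ (fun q => fderiv ℝ Φ q (1, 0)) p (0, u))
          (covD G Φ (fun q => fderiv ℝ Φ q (1, 0)) p (0, v))
        + G (Φ p) (covD G Φ (fun q => covD G Φ (fun q => fderiv ℝ Φ q (1, 0)) q (1, 0)) p (0, v)
          + riemann G (Φ p) (fderiv ℝ Φ p (1, 0)) (fderiv ℝ Φ p (0, v)) (fderiv ℝ Φ p (1, 0)))
          (fderiv ℝ Φ p (0, u)) := by
  have hΦp := hΦ.self_of_nhds
  have hΦ1 : DifferentiableAt ℝ Φ p := hΦp.differentiableAt (by simp)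
  have hds : ∀ a, ContDiffAt ℝ ∞ (fun q => fderiv ℝ Φ q a) p := fun a =>
    (hΦp.fderiv_right (by simp)).clm_apply contDiffAt_const
  have hd : ∀ a, DifferentiableAt ℝ (fun q => fderiv ℝ Φ q a) p := fun a =>
    (hds a).differentiableAt (by simp)
  have hdV : ∀ a, DifferentiableAt ℝ (fun q => covD G Φ (fun q => fderiv ℝ Φ q (1, 0)) q a) p :=
    fun a => (contDiffAt_covD hG hp hΦp (hds _) contDiffAt_const).differentiableAt (by simp)
  have hGF : DifferentiableAt ℝ (fun q => G (Φ q)) p := (hG.differentiableAt hp).comp p hΦ1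
  have hev : (fun q => fderiv ℝ
        (fun q => G (Φ q) (fderiv ℝ Φ q (0, u)) (fderiv ℝ Φ q (0, v))) q (1, 0)) =ᶠ[𝓝 p]
      fun p => G (Φ p) (covD G Φ (fun q => fderiv ℝ Φ q (1, 0)) p (0, u)) (fderiv ℝ Φ p (0, v))
        + G (Φ p) (fderiv ℝ Φ p (0, u)) (covD G Φ (fun q => fderiv ℝ Φ q (1, 0)) p (0, v)) := by
    filter_upwards [hΦ, hΦ1.continuousAt.preimage_mem_nhds (hG.isOpen.mem_nhds hp)] with q hq hqU
      using fderiv_inner_slice hG hqU hq u v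
  rw [hev.fderiv_eq, fderiv_fun_add ((hGF.clm_apply (hdV _)).clm_apply (hd _))
    ((hGF.clm_apply (hd _)).clm_apply (hdV _)), add_apply,
    fderiv_inner_along hG hp hΦ1 (hdV _) (hd _), fderiv_inner_along hG hp hΦ1 (hd _) (hdV _)]
  -- Exchanging the time and space derivatives of the velocity costs one curvature term.
  have hcurv : ∀ a, covD G Φ (fun q => covD G Φ (fun q => fderiv ℝ Φ q (1, 0)) q (0, a)) p (1, 0)
      = covD G Φ (fun q => covD G Φ (fun q => fderiv ℝ Φ q (1, 0)) q (1, 0)) p (0, a)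
        + riemann G (Φ p) (fderiv ℝ Φ p (1, 0)) (fderiv ℝ Φ p (0, a)) (fderiv ℝ Φ p (1, 0)) := by
    intro a
    rw [← covD_covD_sub hG hp hΦp (hds (1, 0)) (1, 0) (0, a)]
    abel
  have hs : ∀ a b, G (Φ p) a b = G (Φ p) b a := (hG.inner _ hp).symm
  rw [hcurv, hcurv, covD_fderiv_symm hG hp hΦp (1, 0) (0, u),
    covD_fderiv_symm hG hp hΦp (1, 0) (0, v),
    hs (fderiv ℝ Φ p (0, u)) (_ + _)]
  ring

end SecondVariation

namespace MinimalLagrangian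

variable {n : ℕ} {G : Euc (2 * n) → Euc (2 * n) →L[ℝ] Euc (2 * n) →L[ℝ] ℝ}
    {J : Euc (2 * n) → Euc (2 * n) →L[ℝ] Euc (2 * n)} {U : Set (Euc (2 * n))}
    {Φ : ℝ × Euc n → Euc (2 * n)} {g : Euc n → Euc n →L[ℝ] Euc n →L[ℝ] ℝ} {O : Set (Euc n)}
    {y : Euc n} {f : Euc n → ℝ}

/-- The second variation of the volume density of a minimal Lagrangian immersion under a
deformation with initial velocity `J∇f`. -/
theorem hasDerivAt_deriv_density
    (h : MinimalLagrangian G J U (fun z => Φ (0, z)) g O) (hf : ContDiffOn ℝ ∞ f O) (hy : y ∈ O)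
    (hΦ : ∀ z ∈ O, ∀ᶠ q in 𝓝 ((0 : ℝ), z), ContDiffAt ℝ ∞ Φ q)
    (hV : ∀ z ∈ O, fderiv ℝ Φ (0, z) (1, 0)
      = J (Φ (0, z)) (gradAlong (fun z => Φ (0, z)) g f z))
    {β : Euc n → Euc n →L[ℝ] ℝ}
    (hβ : ∀ z ∈ O, ∀ v, β z v = deriv (fun s => G (Φ (s, z)) (fderiv ℝ Φ (s, z) (1, 0))
      (fderiv ℝ Φ (s, z) (0, v))) 0) :
    HasDerivAt (fun s => deriv (fun s => density (sliceMetric G Φ s y)) s)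
      (sqrtDet g y * (divCoord g β y
        - fderiv ℝ (laplaceCoord g f) y ((g y).inverse (fderiv ℝ f y))
        - ricci G (Φ (0, y)) (gradAlong (fun z => Φ (0, z)) g f y)
          (gradAlong (fun z => Φ (0, z)) g f y))) 0 := by
  have hG := h.kahler.metric
  have hΦs : ∀ z ∈ O, ContDiffAt ℝ ∞ Φ (0, z) := fun z hz => (hΦ z hz).self_of_nhds
  have hΦd : ∀ z ∈ O, DifferentiableAt ℝ Φ (0, z) := fun z hz =>
    (hΦs z hz).differentiableAt (by simp)
  have hU : Φ (0, y) ∈ U := h.maps y hy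
  set F : Euc n → Euc (2 * n) := fun z => Φ (0, z) with hF
  have hUF : F y ∈ U := hU
  set W := gradAlong F g f with hW
  have hdF : ∀ z ∈ O, ∀ v, fderiv ℝ Φ (0, z) (0, v) = fderiv ℝ F z v := fun z hz v =>
    (fderiv_slice (hΦd z hz) v).symm
  have hWd : ∀ z ∈ O, DifferentiableAt ℝ W z := fun z hz => h.differentiableAt_gradAlong hf hz
  have hVs : ∀ z ∈ O, ContDiffAt ℝ ∞ (fun q => fderiv ℝ Φ q (1, 0)) (0, z) := fun z hz =>
    ((hΦs z hz).fderiv_right (by simp)).clm_apply contDiffAt_const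
  set A : Euc n → Euc (2 * n) := fun z =>
    covD G Φ (fun q => fderiv ℝ Φ q (1, 0)) (0, z) (1, 0) with hA
  have hAs : ContDiffAt ℝ ∞ (fun q => covD G Φ (fun q => fderiv ℝ Φ q (1, 0)) q (1, 0)) (0, y) :=
    contDiffAt_covD hG hU (hΦs y hy) (hVs y hy) contDiffAt_const
  have hA0 : ContDiffAt ℝ ∞ A y := hAs.comp y (contDiffAt_const.prodMk contDiffAt_id)
  -- covariant derivatives of the velocity
  have hDV : ∀ z ∈ O, ∀ v, covD G Φ (fun q => fderiv ℝ Φ q (1, 0)) (0, z) (0, v)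
      = J (F z) (covD G F W z v) := by
    intro z hz v
    rw [← covD_slice (hΦd z hz) ((hVs z hz).differentiableAt (by simp)),
      ← h.kahler.covD_J (h.maps z hz) (h.differentiableAt hz) (hWd z hz)]
    apply covD_congr
    filter_upwards [h.metric.isOpen.mem_nhds hz] with q hq using hV q hq
  have hDA : ∀ v, covD G Φ (fun q => covD G Φ (fun q => fderiv ℝ Φ q (1, 0)) q (1, 0)) (0, y) (0, v)
      = covD G F A y v := fun v =>
    (covD_slice (hΦd y hy) (hAs.differentiableAt (by simp)) v).symm
  -- the curve of metrics
  set γ : ℝ → Euc n →L[ℝ] Euc n →L[ℝ] ℝ := fun s => sliceMetric G Φ s y with hγ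
  have hγ0 : γ 0 = g y := by
    ext u v
    rw [hγ]
    simp only
    rw [sliceMetric_apply, hdF y hy, hdF y hy, h.induced y hy]
  have hslice : ContinuousAt (fun s : ℝ => (s, y)) 0 := by fun_prop
  have hΦev : ∀ᶠ s : ℝ in 𝓝 0, ContDiffAt ℝ ∞ Φ (s, y) := hslice.eventually (hΦ y hy)
  have hUev : ∀ᶠ s : ℝ in 𝓝 0, Φ (s, y) ∈ U :=
    hslice.eventually ((hΦd y hy).continuousAt.preimage_mem_nhds (hG.isOpen.mem_nhds hU))
  have hγs : ∀ᶠ s in 𝓝 0, ContDiffAt ℝ ∞ γ s := by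
    filter_upwards [hΦev, hUev] with s h1 h2
    exact (contDiffAt_sliceMetric hG h2 h1).comp s (contDiffAt_id.prodMk contDiffAt_const)
  have hγ1 : ∀ᶠ s in 𝓝 0, HasDerivAt γ (deriv γ s) s := by
    filter_upwards [hγs] with s hs using (hs.differentiableAt (by simp)).hasDerivAt
  have hγ2 : HasDerivAt (deriv γ) (deriv (deriv γ) 0) 0 := by
    have : ContDiffAt ℝ 1 (deriv γ) 0 := by
      have := hγs.self_of_nhds.fderiv_right (m := 1) (by norm_cast)
      exact this.clm_apply contDiffAt_const
    exact (this.differentiableAt (by simp)).hasDerivAt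
  have hsmH : ∀ u v s, ContDiffAt ℝ ∞ Φ (s, y) → Φ (s, y) ∈ U → ContDiffAt ℝ ∞
      (fun q => G (Φ q) (fderiv ℝ Φ q (0, u)) (fderiv ℝ Φ q (0, v))) (s, y) := by
    intro u v s h1 h2
    have h3 : ∀ a, ContDiffAt ℝ ∞ (fun q => fderiv ℝ Φ q a) (s, y) := fun a =>
      (h1.fderiv_right (by simp)).clm_apply contDiffAt_const
    exact (((hG.contDiffAt h2).comp (s, y) h1).clm_apply (h3 _)).clm_apply (h3 _)
  have happ : ∀ {δ : ℝ → Euc n →L[ℝ] Euc n →L[ℝ] ℝ} {s : ℝ}, DifferentiableAt ℝ δ s →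
      ∀ u v, deriv δ s u v = deriv (fun t => δ t u v) s := by
    intro δ s hδ u v
    have h1 := (hδ.hasDerivAt.clm_apply (hasDerivAt_const s u)).clm_apply (hasDerivAt_const s v)
    rw [h1.deriv]
    simp
  have hd1 : ∀ u v, ∀ᶠ s in 𝓝 0, deriv γ s u v = fderiv ℝ (fun q => G (Φ q) (fderiv ℝ Φ q (0, u))
      (fderiv ℝ Φ q (0, v))) (s, y) (1, 0) := by
    intro u v
    filter_upwards [hγs, hΦev, hUev] with s h1 h2 h3
    rw [happ (h1.differentiableAt (by simp)),
      ← deriv_slice ((hsmH u v s h2 h3).differentiableAt (by simp))]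
    simp only [hγ, sliceMetric_apply]
  -- The two halves of the first variation agree by `sff_symm`. Only the normal part of `∇∇f` enters
  -- at first order, not the Hessian of `f`.
  have hγ1v : ∀ u v, deriv γ 0 u v
      = -2 * G (F y) (covD G F W y u) (J (F y) (fderiv ℝ F y v)) := by
    intro u v
    rw [(hd1 u v).self_of_nhds, fderiv_inner_slice hG hU (hΦs y hy), hDV y hy, hDV y hy,
      hdF y hy, hdF y hy, h.symm hy (fderiv ℝ F y u), h.inner_J_left hy, h.inner_J_left hy,
      h.sff_symm hf hy v u]
    ring
  have hγ2v : ∀ u v, deriv (deriv γ) 0 u v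
      = G (F y) (covD G F A y u + riemann G (F y) (J (F y) (W y)) (fderiv ℝ F y u) (J (F y) (W y)))
          (fderiv ℝ F y v)
        + 2 * G (F y) (covD G F W y u) (covD G F W y v)
        + G (F y) (covD G F A y v + riemann G (F y) (J (F y) (W y)) (fderiv ℝ F y v)
          (J (F y) (W y))) (fderiv ℝ F y u) := by
    intro u v
    rw [happ hγ2.differentiableAt, Filter.EventuallyEq.deriv_eq (hd1 u v)]
    have hH := hsmH u v 0 (hΦs y hy) hU
    have hH1 : DifferentiableAt ℝ (fun q => fderiv ℝ (fun q => G (Φ q) (fderiv ℝ Φ q (0, u))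
        (fderiv ℝ Φ q (0, v))) q (1, 0)) (0, y) :=
      ((hH.fderiv_right (m := 1) (by norm_cast)).differentiableAt (by simp)).clm_apply
        (differentiableAt_const _)
    rw [deriv_slice hH1, fderiv_fderiv_inner_slice hG hU (hΦ y hy), hDA, hDA, hDV y hy, hDV y hy,
      hdF y hy, hdF y hy, hV y hy, h.inner_J_J hy]
  -- Injective linear maps form an open set, so the slices remain immersive at `y` for small times.
  have hinner : ∀ᶠ s in 𝓝 0, IsInner (γ s) := by
    have hinj : ∀ᶠ s in 𝓝 (0 : ℝ), Function.Injective ((fderiv ℝ Φ (s, y)).comp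
        (ContinuousLinearMap.inr ℝ ℝ (Euc n))) := by
      have hc : ContinuousAt (fun s : ℝ => (fderiv ℝ Φ (s, y)).comp
          (ContinuousLinearMap.inr ℝ ℝ (Euc n))) 0 := by
        have h1 : ContinuousAt (fderiv ℝ Φ) (0, y) :=
          ((hΦs y hy).fderiv_right (m := 1) (by norm_cast)).continuousAt
        have h2 : ContinuousAt (fun s : ℝ => fderiv ℝ Φ (s, y)) 0 := ContinuousAt.comp (f := fun s : ℝ => (s, y)) h1 hslice
        exact h2.clm_comp continuousAt_const
      refine hc.eventually (ContinuousLinearMap.isOpen_injective.mem_nhds ?_)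
      rw [mem_ofPred_eq, injective_iff_map_eq_zero]
      intro u hu
      have hu' : fderiv ℝ F y u = 0 := by rw [← hdF y hy]; simpa using hu
      apply (h.metric.inner y hy).eq_zero
      rw [h.induced y hy, hu']
      simp
    filter_upwards [hUev, hinj] with s h1 h2
    refine ⟨fun u v => (hG.inner _ h1).symm _ _, fun u hu => (hG.inner _ h1).pos _ ?_⟩
    intro h0
    exact hu (h2 (h0.trans (map_zero _).symm))
  have key := LagVar.hasDerivAt_deriv_density hinner hγ1 hγ2
  refine key.congr_deriv ?_
  have hdual : ∀ i, (γ 0).inverse (EuclideanSpace.proj i) = dualVec g y i := fun i => by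
    rw [hγ0]; rfl
  -- first order trace vanishes
  have htr : ∑ i, G (F y) (covD G F W y (stdVec i)) (J (F y) (fderiv ℝ F y (dualVec g y i))) = 0 := by
    have hJF : ContDiffAt ℝ ∞ (fun z => J (F z)) y :=
      (h.kahler.contDiffAt hU).comp y (h.contDiffAt hy)
    have h1 := h.sum_inner_covD hy (Y := fun z => J (F z) (W z))
      (hJF.clm_apply (h.contDiffAt_gradAlong hf hy))
    have h2 : (fun z => (G (F z) (J (F z) (W z))).comp (fderiv ℝ F z)) =ᶠ[𝓝 y] fun _ => 0 := by
      filter_upwards [h.metric.isOpen.mem_nhds hy] with z hz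
      ext v
      exact h.lagrangian z hz _ v
    rw [divCoord_congr h2] at h1
    have h3 : divCoord g (fun _ => 0) y = 0 := by simp [divCoord]
    rw [h3] at h1
    simp only [h.kahler.covD_J hUF (h.differentiableAt hy) (hWd y hy), h.inner_J_left hy,
      Finset.sum_neg_distrib, neg_eq_zero] at h1
    exact h1
  -- second order terms
  have hnorm : ∑ i, G (F y) (covD G F W y (stdVec i)) (covD G F W y (dualVec g y i))
      = ∑ i, ∑ a, G (F y) (covD G F W y (stdVec i)) (fderiv ℝ F y (dualVec g y a))
          * G (F y) (covD G F W y (stdVec a)) (fderiv ℝ F y (dualVec g y i))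
        + ∑ i, ∑ a, G (F y) (covD G F W y (stdVec i)) (J (F y) (fderiv ℝ F y (dualVec g y a)))
          * G (F y) (covD G F W y (stdVec a)) (J (F y) (fderiv ℝ F y (dualVec g y i))) := by
    rw [← Finset.sum_add_distrib]
    refine Finset.sum_congr rfl fun i _ => ?_
    rw [h.inner_eq_sum hy, ← Finset.sum_add_distrib]
    refine Finset.sum_congr rfl fun a _ => ?_
    rw [h.symm hy (fderiv ℝ F y (stdVec a)), h.symm hy (J (F y) (fderiv ℝ F y (stdVec a))),
      h.hess_symm hf hy (dualVec g y i), h.sff_symm hf hy (dualVec g y i)]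
  obtain ⟨T, hT⟩ := hG.exists_riemannL hU (J (F y) (W y)) (J (F y) (W y))
  have hswap := h.sum_swap hy (covDL G F A y + T.comp (fderiv ℝ F y)) (fderiv ℝ F y)
  simp only [add_apply, ContinuousLinearMap.comp_apply, covDL_apply, hT] at hswap
  -- the one-form
  have hDw : ContDiffAt ℝ ∞ (fun z => covD G F W z ((g z).inverse (fderiv ℝ f z))) y :=
    contDiffAt_covD hG hUF (h.contDiffAt hy) (h.contDiffAt_gradAlong hf hy)
      (h.contDiffAt_coordGrad hf hy)
  -- At time zero `β(v) = ⟨A, ∂_v F⟩ + ⟨J∇f, ∇_v (J∇f)⟩`, and symmetry of the Hessian turns the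
  -- second term into `⟨∇_{∇f} ∇f, ∂_v F⟩`. So the acceleration and the first Bochner term together
  -- form a divergence.
  have hβ' : divCoord g β y = ∑ i, G (F y) (covD G F A y (stdVec i)) (fderiv ℝ F y (dualVec g y i))
      + ∑ i, G (F y) (covD G F (fun z => covD G F W z ((g z).inverse (fderiv ℝ f z))) y
        (stdVec i)) (fderiv ℝ F y (dualVec g y i)) := by
    have h1 := h.sum_inner_covD hy (hA0.add hDw)
    simp only [covD_add (hA0.differentiableAt (by simp)) (hDw.differentiableAt (by simp)),
      map_add, add_apply, Finset.sum_add_distrib] at h1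
    rw [h1]
    apply divCoord_congr
    filter_upwards [h.metric.isOpen.mem_nhds hy] with z hz
    ext v
    have hd : ∀ a, DifferentiableAt ℝ (fun q => fderiv ℝ Φ q a) (0, z) := fun a =>
      (((hΦs z hz).fderiv_right (m := 1) (by norm_cast)).differentiableAt (by simp)).clm_apply
        (differentiableAt_const _)
    have hGF : DifferentiableAt ℝ (fun q => G (Φ q)) (0, z) :=
      (hG.differentiableAt (h.maps z hz)).comp (0, z) (hΦd z hz)
    have hUz : Φ (0, z) ∈ U := h.maps z hz
    rw [hβ z hz, deriv_slice (H := fun q => G (Φ q) (fderiv ℝ Φ q (1, 0)) (fderiv ℝ Φ q (0, v)))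
      ((hGF.clm_apply (hd _)).clm_apply (hd _)),
      fderiv_inner_along hG hUz (hΦd z hz) (hd _) (hd _),
      LagVar.covD_fderiv_symm hG hUz (hΦs z hz) (1, 0) (0, v), hDV z hz, hV z hz,
      hdF z hz, h.inner_J_J hz]
    simp only [ContinuousLinearMap.comp_apply, add_apply]
    congr 1
    rw [h.hess_symm hf hz, h.symm hz]
    rfl
  have hboch := h.fderiv_laplaceCoord hf hy
  have hric := h.sum_riemann hy (W y)
  have hdens : density (γ 0) = sqrtDet g y := by rw [hγ0]; rfl
  have hsq : ∀ i j, deriv γ 0 (stdVec i) (dualVec g y j) * deriv γ 0 (dualVec g y i) (stdVec j)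
      = 4 * (G (F y) (covD G F W y (stdVec i)) (J (F y) (fderiv ℝ F y (dualVec g y j)))
          * G (F y) (covD G F W y (stdVec j)) (J (F y) (fderiv ℝ F y (dualVec g y i)))) := by
    intro i j
    rw [hγ1v, hγ1v, h.sff_symm hf hy (dualVec g y i)]
    ring
  rw [hdens]
  simp only [hdual, hsq, hγ2v]
  simp only [hγ1v, ← Finset.mul_sum, htr, Finset.sum_add_distrib, hnorm]
  rw [← hswap, hβ', hboch]
  simp only [map_add, add_apply, Finset.sum_add_distrib]
  have : ricci G (Φ (0, y)) (W y) (W y) = ricci G (F y) (W y) (W y) := rfl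
  -- The curvature of `J∇f` comes from the second variation and that of `∇f` from the Bochner
  -- formula; they add up to minus the Ricci curvature, while the Hessian and normal terms cancel.
  rw [this, ← neg_neg (ricci G (F y) (W y) (W y)), ← hric]
  ring

end MinimalLagrangian

/-! ### Fields of bilinear forms in charts -/

section Charts

variable {m : ℕ} {N : Type*} [TopologicalSpace N] [ChartedSpace (Euc m) N]

/-- The derivative of the inverse of a chart, as an endomorphism of coordinate space. -/
def symmD (e : OpenPartialHomeomorph N (Euc m)) (y : Euc m) : Euc m →L[ℝ] Euc m :=
  mfderiv (𝓡 m) (𝓡 m) e.symm y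

lemma inChart_eq_pull (h : ∀ x : N, TangentSpace (𝓡 m) x →L[ℝ] TangentSpace (𝓡 m) x →L[ℝ] ℝ)
    (e : OpenPartialHomeomorph N (Euc m)) (y : Euc m) :
    inChart h e y = pull (E := Euc m) (F := Euc m) (h (e.symm y)) (symmD e y) := rfl

variable [IsManifold (𝓡 m) ∞ N] {e e' : OpenPartialHomeomorph N (Euc m)}

lemma chart_mdifferentiable (he : e ∈ atlas (Euc m) N) : e.MDifferentiable (𝓡 m) (𝓡 m) :=
  mdifferentiable_of_mem_atlas he

lemma contMDiffOn_chart (he : e ∈ atlas (Euc m) N) : ContMDiffOn (𝓡 m) (𝓡 m) ∞ e e.source :=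
  contMDiffOn_of_mem_maximalAtlas (IsManifold.subset_maximalAtlas he)

lemma contMDiffOn_chart_symm (he : e ∈ atlas (Euc m) N) :
    ContMDiffOn (𝓡 m) (𝓡 m) ∞ e.symm e.target :=
  contMDiffOn_symm_of_mem_maximalAtlas (IsManifold.subset_maximalAtlas he)

lemma mdifferentiableAt_chart_symm (he : e ∈ atlas (Euc m) N) {y : Euc m} (hy : y ∈ e.target) :
    MDifferentiableAt (𝓡 m) (𝓡 m) e.symm y :=
  (chart_mdifferentiable he).mdifferentiableAt_symm hy

/-- The domain of a change of charts. -/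
lemma isOpen_transition (e e' : OpenPartialHomeomorph N (Euc m)) :
    IsOpen (e.target ∩ e.symm ⁻¹' e'.source) :=
  e.symm.isOpen_inter_preimage e'.open_source

lemma contDiffOn_transition (he : e ∈ atlas (Euc m) N) (he' : e' ∈ atlas (Euc m) N) :
    ContDiffOn ℝ ∞ (fun y => e' (e.symm y)) (e.target ∩ e.symm ⁻¹' e'.source) := by
  rw [← contMDiffOn_iff_contDiffOn]
  exact (contMDiffOn_chart he').comp ((contMDiffOn_chart_symm he).mono inter_subset_left)
    fun y hy => hy.2

lemma symmD_eq_comp (he : e ∈ atlas (Euc m) N) (he' : e' ∈ atlas (Euc m) N) {y : Euc m}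
    (hy : y ∈ e.target) (hy' : e.symm y ∈ e'.source) :
    symmD e y = (symmD e' (e' (e.symm y))).comp (fderiv ℝ (fun y => e' (e.symm y)) y) := by
  have hev : e.symm =ᶠ[𝓝 y] e'.symm ∘ fun y => e' (e.symm y) := by
    filter_upwards [(isOpen_transition e e').mem_nhds ⟨hy, hy'⟩] with z hz
    exact (e'.left_inv hz.2).symm
  have h1 : MDifferentiableAt (𝓡 m) (𝓡 m) (fun y => e' (e.symm y)) y := by
    rw [mdifferentiableAt_iff_differentiableAt]
    exact ((contDiffOn_transition he he').contDiffAt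
      ((isOpen_transition e e').mem_nhds ⟨hy, hy'⟩)).differentiableAt (by simp)
  have h2 := mfderiv_comp y (mdifferentiableAt_chart_symm he' (e'.map_source hy')) h1
  rw [mfderiv_eq_fderiv] at h2
  unfold symmD
  rw [hev.mfderiv_eq, h2]
  rfl

lemma inChart_transition
    (h : ∀ x : N, TangentSpace (𝓡 m) x →L[ℝ] TangentSpace (𝓡 m) x →L[ℝ] ℝ)
    (he : e ∈ atlas (Euc m) N) (he' : e' ∈ atlas (Euc m) N) {y : Euc m}
    (hy : y ∈ e.target) (hy' : e.symm y ∈ e'.source) :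
    inChart h e y = pull (inChart h e' (e' (e.symm y))) (fderiv ℝ (fun y => e' (e.symm y)) y) := by
  rw [inChart_eq_pull, inChart_eq_pull, symmD_eq_comp he he' hy hy', e'.left_inv hy']
  rfl

/-- A smooth Riemannian metric on a manifold, given by its expressions in charts. -/
def SmoothMetric (h : ∀ x : N, TangentSpace (𝓡 m) x →L[ℝ] TangentSpace (𝓡 m) x →L[ℝ] ℝ) : Prop :=
  ∀ e ∈ atlas (Euc m) N, MetricOn (inChart h e) e.target

/-! ### The Riemannian measure -/

/-- The Gram matrix of the pullback is `Aᵀ B A`, so its determinant is multiplied by `(det A)²`. The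
resulting factor is the Jacobian in the change of variables between charts. -/
lemma density_pull (B : Euc m →L[ℝ] Euc m →L[ℝ] ℝ) (D : Euc m →L[ℝ] Euc m) :
    density (pull B D) = |D.det| * density B := by
  set b := (EuclideanSpace.basisFun (Fin m) ℝ).toBasis with hb
  have hbi : ∀ i, b i = stdVec i := fun i => by simp [hb, stdVec]
  set A := LinearMap.toMatrix b b (D : Euc m →ₗ[ℝ] Euc m) with hA
  have hAe : ∀ i j, A i j = D (stdVec j) i := by
    intro i j
    rw [hA, LinearMap.toMatrix_apply, hbi]
    simp [hb]
  have hmat : (Matrix.of fun i j : Fin m => pull B D (stdVec i) (stdVec j))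
      = A.transpose * (Matrix.of fun i j : Fin m => B (stdVec i) (stdVec j)) * A := by
    ext i j
    simp only [Matrix.of_apply, pull_apply, Matrix.mul_apply, Matrix.transpose_apply, hAe]
    rw [apply_eq_sum, Finset.sum_comm]
    refine Finset.sum_congr rfl fun k _ => ?_
    rw [Finset.sum_mul]
    exact Finset.sum_congr rfl fun l _ => by ring
  have hdet : A.det = D.det := by
    rw [hA, LinearMap.det_toMatrix]
  unfold density
  rw [hmat, Matrix.det_mul, Matrix.det_mul, Matrix.det_transpose, hdet]
  have : D.det * (Matrix.of fun i j : Fin m => B (stdVec i) (stdVec j)).det * D.det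
      = D.det ^ 2 * (Matrix.of fun i j : Fin m => B (stdVec i) (stdVec j)).det := by ring
  rw [this, Real.sqrt_mul (sq_nonneg _), Real.sqrt_sq_eq_abs]

variable {h : ∀ x : N, TangentSpace (𝓡 m) x →L[ℝ] TangentSpace (𝓡 m) x →L[ℝ] ℝ}

lemma sqrtDet_transition (he : e ∈ atlas (Euc m) N) (he' : e' ∈ atlas (Euc m) N) {y : Euc m}
    (hy : y ∈ e.target) (hy' : e.symm y ∈ e'.source) :
    sqrtDet (inChart h e) y = |(fderiv ℝ (fun y => e' (e.symm y)) y).det|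
      * sqrtDet (inChart h e') (e' (e.symm y)) := by
  rw [sqrtDet_eq_density, sqrtDet_eq_density, inChart_transition h he he' hy hy', density_pull]

lemma SmoothMetric.contDiffOn_sqrtDet (hh : SmoothMetric h) (he : e ∈ atlas (Euc m) N) :
    ContDiffOn ℝ ∞ (sqrtDet (inChart h e)) e.target := fun _ hy =>
  ((hh e he).contDiffAt_sqrtDet hy).contDiffWithinAt

variable [MeasurableSpace N] [BorelSpace N]

lemma aemeasurable_chart_symm (e : OpenPartialHomeomorph N (Euc m)) :
    AEMeasurable e.symm (volume.restrict e.target) :=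
  e.continuousOn_symm.aemeasurable e.open_target.measurableSet

lemma aemeasurable_chart_symm_withDensity (e : OpenPartialHomeomorph N (Euc m))
    (ρ : Euc m → ENNReal) : AEMeasurable e.symm ((volume.restrict e.target).withDensity ρ) :=
  (aemeasurable_chart_symm e).mono_ac (withDensity_absolutelyContinuous _ _)

lemma measurableSet_preimage_chart (e : OpenPartialHomeomorph N (Euc m)) {A : Set N}
    (hA : MeasurableSet A) : MeasurableSet (e.target ∩ e.symm ⁻¹' A) := by
  have h1 : Measurable (e.target.domRestrict e.symm) := e.continuousOn_symm.domRestrict.measurable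
  have h2 := (MeasurableEmbedding.subtype_coe e.open_target.measurableSet).measurableSet_image.2
    (h1 hA)
  convert h2 using 1
  ext y
  simp [domRestrict, and_comm]

lemma chartMeasure_apply (e : OpenPartialHomeomorph N (Euc m)) {A : Set N}
    (hA : MeasurableSet A) : chartMeasure h e A
      = ∫⁻ y in e.target ∩ e.symm ⁻¹' A, ENNReal.ofReal (sqrtDet (inChart h e) y) := by
  set ρ : Euc m → ENNReal := fun y => ENNReal.ofReal (sqrtDet (inChart h e) y)
  have hS := measurableSet_preimage_chart e hA
  have h0 : ((volume.restrict e.target).withDensity ρ) e.targetᶜ = 0 := by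
    apply withDensity_absolutelyContinuous
    rw [Measure.restrict_apply e.open_target.measurableSet.compl]
    simp
  rw [chartMeasure, Measure.map_apply_of_aemeasurable (aemeasurable_chart_symm_withDensity e ρ) hA,
    ← measure_inter_add_sdiff (e.symm ⁻¹' A) e.open_target.measurableSet, inter_comm,
    measure_mono_null (s := _ \ _) (fun y hy => hy.2) h0, add_zero, withDensity_apply _ hS,
    Measure.restrict_restrict hS, inter_comm, ← inter_assoc, inter_self]

lemma chartMeasure_compl_source (e : OpenPartialHomeomorph N (Euc m)) :
    chartMeasure h e e.sourceᶜ = 0 := by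
  rw [chartMeasure_apply e e.open_source.measurableSet.compl]
  have : e.target ∩ e.symm ⁻¹' e.sourceᶜ = ∅ := by
    ext y
    simp only [mem_inter_iff, mem_preimage, mem_compl_iff, mem_empty_iff_false, iff_false, not_and,
      not_not]
    exact fun hy => e.map_target hy
  rw [this]
  simp

/-- The measures of two charts agree on their overlap. -/
lemma chartMeasure_eq_of_subset (he : e ∈ atlas (Euc m) N) (he' : e' ∈ atlas (Euc m) N) {A : Set N}
    (hA : MeasurableSet A) (hAe : A ⊆ e.source) (hAe' : A ⊆ e'.source) :
    chartMeasure h e A = chartMeasure h e' A := by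
  rw [chartMeasure_apply e hA, chartMeasure_apply e' hA]
  set S := e.target ∩ e.symm ⁻¹' A
  have hS : MeasurableSet S := measurableSet_preimage_chart e hA
  have himg : (fun y => e' (e.symm y)) '' S = e'.target ∩ e'.symm ⁻¹' A := by
    ext z
    constructor
    · rintro ⟨y, ⟨hy, hyA⟩, rfl⟩
      exact ⟨e'.map_source (hAe' hyA), by simpa [e'.left_inv (hAe' hyA)] using hyA⟩
    · rintro ⟨hz, hzA⟩
      refine ⟨e (e'.symm z), ⟨e.map_source (hAe hzA), ?_⟩, ?_⟩
      · simpa [e.left_inv (hAe hzA)] using hzA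
      · simp [e.left_inv (hAe hzA), e'.right_inv hz]
  have hd : ∀ y ∈ S, HasFDerivWithinAt (fun y => e' (e.symm y))
      (fderiv ℝ (fun y => e' (e.symm y)) y) S y := fun y hy =>
    (((contDiffOn_transition he he').contDiffAt ((isOpen_transition e e').mem_nhds
      ⟨hy.1, hAe' hy.2⟩)).differentiableAt (by simp)).hasFDerivAt.hasFDerivWithinAt
  have hinj : InjOn (fun y => e' (e.symm y)) S := by
    intro y hy z hz hyz
    have h1 := e'.injOn (hAe' hy.2) (hAe' hz.2) hyz
    exact e.symm.injOn hy.1 hz.1 h1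
  rw [← himg, lintegral_image_eq_lintegral_abs_det_fderiv_mul volume hS hd hinj]
  refine setLIntegral_congr_fun hS fun y hy => ?_
  rw [sqrtDet_transition he he' hy.1 (hAe' hy.2), ENNReal.ofReal_mul (abs_nonneg _)]

/-- For `e'` only the part of a set inside both sources carries mass, and there the two measures
agree. -/
lemma chartMeasure_restrict_le (he : e ∈ atlas (Euc m) N) (he' : e' ∈ atlas (Euc m) N) :
    (chartMeasure h e').restrict e.source ≤ chartMeasure h e := by
  refine Measure.le_iff.2 fun B hB => ?_
  rw [Measure.restrict_apply hB]
  have h1 : chartMeasure h e' (B ∩ e.source) = chartMeasure h e' (B ∩ e.source ∩ e'.source) := by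
    rw [← measure_inter_add_sdiff (B ∩ e.source) e'.open_source.measurableSet,
      measure_mono_null (s := _ \ _) (fun y hy => hy.2) (chartMeasure_compl_source (h := h) e'), add_zero]
  rw [h1, ← chartMeasure_eq_of_subset he he' ((hB.inter e.open_source.measurableSet).inter
    e'.open_source.measurableSet) (fun x hx => hx.1.2) fun x hx => hx.2]
  exact measure_mono fun x hx => hx.1.1

/-- On the domain of a chart the Riemannian measure is the measure of the chart. -/
lemma riemannianMeasure_restrict (he : e ∈ atlas (Euc m) N) :
    (riemannianMeasure h).restrict e.source = chartMeasure h e := by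
  apply le_antisymm
  -- The supremum is dominated by one explicit measure: each chart measure is at most that of `e`
  -- inside `e.source`, and the crude bound `⊤` outside disappears on restriction.
  · have hle : riemannianMeasure h
        ≤ chartMeasure h e + (⊤ : Measure N).restrict e.sourceᶜ := by
      refine iSup₂_le fun e' he' => ?_
      rw [← Measure.restrict_add_restrict_compl (μ := chartMeasure h e')
        e.open_source.measurableSet]
      exact add_le_add (chartMeasure_restrict_le he he') (Measure.restrict_mono_measure le_top _)
    refine (Measure.restrict_mono_measure hle e.source).trans ?_
    rw [Measure.restrict_add, Measure.restrict_restrict e.open_source.measurableSet]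
    simp [Measure.restrict_le_self]
  · have h1 : (chartMeasure h e).restrict e.source = chartMeasure h e :=
      Measure.restrict_eq_self_of_ae_mem (by
        rw [ae_iff]
        exact chartMeasure_compl_source e)
    rw [← h1]
    exact Measure.restrict_mono_measure (le_iSup₂ (f := fun e (_ : e ∈ atlas (Euc m) N) =>
      chartMeasure h e) e he) _

lemma SmoothMetric.setIntegral_source (hh : SmoothMetric h) (he : e ∈ atlas (Euc m) N) {u : N → ℝ}
    (hu : ContinuousOn u e.source) :
    ∫ x in e.source, u x ∂(riemannianMeasure h)
      = ∫ y in e.target, sqrtDet (inChart h e) y * u (e.symm y) := by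
  have hum : AEStronglyMeasurable u ((riemannianMeasure h).restrict e.source) :=
    hu.aestronglyMeasurable e.open_source.measurableSet
  rw [riemannianMeasure_restrict he] at hum ⊢
  rw [chartMeasure] at hum ⊢
  rw [integral_map (aemeasurable_chart_symm_withDensity e _) hum]
  have hm : AEMeasurable (fun y => (sqrtDet (inChart h e) y).toNNReal)
      (volume.restrict e.target) :=
    ((hh.contDiffOn_sqrtDet he).continuousOn.aemeasurable e.open_target.measurableSet).real_toNNReal
  have := integral_withDensity_eq_integral_smul₀ hm (fun y => u (e.symm y))
  refine Eq.trans this ?_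
  refine setIntegral_congr_fun e.open_target.measurableSet fun y hy => ?_
  have hpos := (hh e he).sqrtDet_pos hy
  simp [NNReal.smul_def, hpos.le]

end Charts

/-! ### Functions with compact support in an open set -/

section Indicator

variable {E F : Type*} [NormedAddCommGroup E] [NormedSpace ℝ E] [NormedAddCommGroup F]
    [NormedSpace ℝ F] {O K : Set E} {a : E → F}

lemma indicator_eventuallyEq (hO : IsOpen O) {y : E} (hy : y ∈ O) :
    O.indicator a =ᶠ[𝓝 y] a := by
  filter_upwards [hO.mem_nhds hy] with z hz using indicator_of_mem hz a

lemma indicator_eventuallyEq_zero (hK : IsClosed K) (ha : ∀ y ∈ O, y ∉ K → a y = 0) {y : E}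
    (hy : y ∉ K) : O.indicator a =ᶠ[𝓝 y] 0 := by
  filter_upwards [hK.isOpen_compl.mem_nhds hy] with z hz
  by_cases hzO : z ∈ O
  · rw [indicator_of_mem hzO, ha z hzO hz]; rfl
  · rw [indicator_of_notMem hzO]; rfl

/-- Near a point of `K` the extension by zero equals `a`, and near any other point it vanishes.
These cases are exhaustive, so the boundary of `O` needs no attention. -/
lemma contDiff_indicator {k : WithTop ℕ∞} (hO : IsOpen O) (hK : IsClosed K) (hKO : K ⊆ O)
    (hs : ContDiffOn ℝ k a O) (ha : ∀ y ∈ O, y ∉ K → a y = 0) :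
    ContDiff ℝ k (O.indicator a) := by
  rw [contDiff_iff_contDiffAt]
  intro y
  by_cases hy : y ∈ K
  · exact (hs.contDiffAt (hO.mem_nhds (hKO hy))).congr_of_eventuallyEq
      (indicator_eventuallyEq hO (hKO hy))
  · exact contDiffAt_const.congr_of_eventuallyEq (indicator_eventuallyEq_zero hK ha hy)

lemma hasCompactSupport_indicator (hK : IsCompact K) (ha : ∀ y ∈ O, y ∉ K → a y = 0) :
    HasCompactSupport (O.indicator a) := by
  refine HasCompactSupport.intro hK fun y hy => ?_
  by_cases hyO : y ∈ O
  · rw [indicator_of_mem hyO, ha y hyO hy]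
  · rw [indicator_of_notMem hyO]

end Indicator

/-! ### The divergence theorem on open subsets of coordinate space. -/

section Divergence

variable {m : ℕ}

/-- Integration by parts against the constant function `1`. -/
lemma integral_fderiv_eq_zero {u : Euc m → ℝ} (hu : ContDiff ℝ 1 u) (hc : HasCompactSupport u)
    (v : Euc m) : ∫ y, fderiv ℝ u y v = 0 := by
  have hcf : HasCompactSupport (fun y => fderiv ℝ u y v) := hc.fderiv_apply ℝ v
  have hcont : Continuous (fun y => fderiv ℝ u y v) :=
    (hu.continuous_fderiv (by simp)).clm_apply continuous_const
  have h := integral_mul_fderiv_eq_neg_fderiv_mul_of_integrable (μ := volume) (v := v)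
    (f := fun _ : Euc m => (1 : ℝ)) (g := u) (by simp)
    (by simpa using hcont.integrable_of_hasCompactSupport hcf)
    (by simpa using hu.continuous.integrable_of_hasCompactSupport hc)
    (fun _ _ => differentiableAt_const _) (fun _ _ => hu.differentiable (by simp) _)
  simpa using h

/-- The divergence theorem for fields with compact support in an open set. -/
lemma setIntegral_sum_fderiv_eq_zero {O K : Set (Euc m)} {X : Fin m → Euc m → ℝ} (hO : IsOpen O)
    (hK : IsCompact K) (hKO : K ⊆ O) (hX : ∀ i, ContDiffOn ℝ 1 (X i) O)
    (h0 : ∀ i, ∀ y ∈ O, y ∉ K → X i y = 0) :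
    ∫ y in O, ∑ i, fderiv ℝ (X i) y (stdVec i) = 0 := by
  have hcd : ∀ i, ContDiff ℝ 1 (O.indicator (X i)) := fun i =>
    contDiff_indicator hO hK.isClosed hKO (hX i) (h0 i)
  have hcs : ∀ i, HasCompactSupport (O.indicator (X i)) := fun i =>
    hasCompactSupport_indicator hK (h0 i)
  have hint : ∀ i, Integrable (fun y => fderiv ℝ (O.indicator (X i)) y (stdVec i)) := fun i =>
    (((hcd i).continuous_fderiv (by simp)).clm_apply continuous_const).integrable_of_hasCompactSupport
      ((hcs i).fderiv_apply ℝ _)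
  have h1 : ∫ y, ∑ i, fderiv ℝ (O.indicator (X i)) y (stdVec i) = 0 := by
    rw [integral_finsetSum _ fun i _ => hint i]
    exact Finset.sum_eq_zero fun i _ => integral_fderiv_eq_zero (hcd i) (hcs i) _
  have h2 : ∫ y in O, ∑ i, fderiv ℝ (O.indicator (X i)) y (stdVec i)
      = ∫ y, ∑ i, fderiv ℝ (O.indicator (X i)) y (stdVec i) := by
    refine setIntegral_eq_integral_of_forall_compl_eq_zero fun y hy => ?_
    refine Finset.sum_eq_zero fun i _ => ?_
    rw [(indicator_eventuallyEq_zero hK.isClosed (h0 i) fun hyK => hy (hKO hyK)).fderiv_eq]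
    simp
  rw [← h1, ← h2]
  refine setIntegral_congr_fun hO.measurableSet fun y hy => ?_
  refine Finset.sum_congr rfl fun i _ => ?_
  rw [(indicator_eventuallyEq hO hy).fderiv_eq]

end Divergence

/-! ### The Riemannian measure of a compact manifold -/

section Compact

variable {m : ℕ} {N : Type*} [TopologicalSpace N] [ChartedSpace (Euc m) N]
  [IsManifold (𝓡 m) ∞ N] {e : OpenPartialHomeomorph N (Euc m)}
  {h : ∀ x : N, TangentSpace (𝓡 m) x →L[ℝ] TangentSpace (𝓡 m) x →L[ℝ] ℝ}
  [MeasurableSpace N] [BorelSpace N]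

lemma riemannianMeasure_apply (he : e ∈ atlas (Euc m) N) {A : Set N} (hA : MeasurableSet A)
    (hAe : A ⊆ e.source) : riemannianMeasure h A
      = ∫⁻ y in e.target ∩ e.symm ⁻¹' A, ENNReal.ofReal (sqrtDet (inChart h e) y) := by
  rw [← chartMeasure_apply e hA, ← riemannianMeasure_restrict he, Measure.restrict_apply hA,
    inter_eq_self_of_subset_left hAe]

/-- By compactness, neighbourhoods of finite mass suffice, and the density is integrable on a closed
coordinate ball. -/
lemma SmoothMetric.isFiniteMeasure [CompactSpace N] (hh : SmoothMetric h) :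
    IsFiniteMeasure (riemannianMeasure h) := by
  refine ⟨isCompact_univ.measure_lt_top_of_nhdsWithin fun x _ => ?_⟩
  rw [nhdsWithin_univ]
  set e := chartAt (Euc m) x
  have he : e ∈ atlas (Euc m) N := chart_mem_atlas _ x
  have hx : x ∈ e.source := mem_chart_source _ x
  obtain ⟨r, hr, hball⟩ := Metric.nhds_basis_closedBall.mem_iff.1
    (e.open_target.mem_nhds (e.map_source hx))
  have hV : IsOpen (e.source ∩ e ⁻¹' Metric.ball (e x) r) :=
    e.isOpen_inter_preimage Metric.isOpen_ball
  refine ⟨e.source ∩ e ⁻¹' Metric.ball (e x) r, hV.mem_nhds ⟨hx, Metric.mem_ball_self hr⟩, ?_⟩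
  rw [riemannianMeasure_apply he hV.measurableSet inter_subset_left]
  have hc : ContinuousOn (sqrtDet (inChart h e)) (Metric.closedBall (e x) r) :=
    (hh.contDiffOn_sqrtDet he).continuousOn.mono hball
  have hint : IntegrableOn (sqrtDet (inChart h e)) (Metric.closedBall (e x) r) :=
    hc.integrableOn_compact (isCompact_closedBall _ _)
  refine lt_of_le_of_lt (lintegral_mono_set ?_) hint.setLIntegral_lt_top
  rintro y ⟨hy, _, hy2⟩
  rw [mem_preimage, e.right_inv hy] at hy2
  exact Metric.ball_subset_closedBall hy2

lemma SmoothMetric.isOpenPosMeasure (hh : SmoothMetric h) :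
    (riemannianMeasure h).IsOpenPosMeasure := by
  refine ⟨fun V hV ⟨x, hx⟩ h0 => ?_⟩
  set e := chartAt (Euc m) x
  have he : e ∈ atlas (Euc m) N := chart_mem_atlas _ x
  have hxe : x ∈ e.source := mem_chart_source _ x
  have h1 : riemannianMeasure h (V ∩ e.source) = 0 := measure_mono_null inter_subset_left h0
  have hopen : IsOpen (e.target ∩ e.symm ⁻¹' (V ∩ e.source)) :=
    e.symm.isOpen_inter_preimage (hV.inter e.open_source)
  rw [riemannianMeasure_apply he (hV.inter e.open_source).measurableSet inter_subset_right,
    lintegral_eq_zero_iff' ?_] at h1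
  · have h2 : ∀ᵐ y ∂(volume.restrict (e.target ∩ e.symm ⁻¹' (V ∩ e.source))), False := by
      filter_upwards [h1, ae_restrict_mem hopen.measurableSet] with y hy hy2
      have hpos := (hh e he).sqrtDet_pos hy2.1
      simp only [Pi.zero_apply, ENNReal.ofReal_eq_zero] at hy
      linarith
    rw [Filter.eventually_false_iff_eq_bot, ae_eq_bot, Measure.restrict_eq_zero] at h2
    refine (hopen.measure_pos volume ⟨e x, e.map_source hxe, ?_⟩).ne' h2
    rw [mem_preimage, e.left_inv hxe]
    exact ⟨hx, hxe⟩
  · exact (((hh.contDiffOn_sqrtDet he).continuousOn.mono inter_subset_left).aemeasurable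
      hopen.measurableSet).ennreal_ofReal

lemma SmoothMetric.integral_of_support (hh : SmoothMetric h) (he : e ∈ atlas (Euc m) N) {u : N → ℝ}
    (hu : ContinuousOn u e.source) (h0 : ∀ x ∉ e.source, u x = 0) :
    ∫ x, u x ∂(riemannianMeasure h) = ∫ y in e.target, sqrtDet (inChart h e) y * u (e.symm y) := by
  rw [← hh.setIntegral_source he hu, setIntegral_eq_integral_of_forall_compl_eq_zero h0]

/-- A partition of unity is locally finite, so on a compact manifold only finitely many members are
nonzero. Finite sums avoid any exchange of limits later. -/
lemma exists_finite_partition (m : ℕ) (N : Type*) [TopologicalSpace N] [ChartedSpace (Euc m) N]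
    [IsManifold (𝓡 m) ∞ N] [CompactSpace N] [T2Space N] :
    ∃ (t : Finset N) (ρ : N → N → ℝ), (∀ i, ContMDiff (𝓡 m) 𝓘(ℝ, ℝ) ∞ (ρ i)) ∧
      (∀ i, tsupport (ρ i) ⊆ (chartAt (Euc m) i).source) ∧ ∀ x, ∑ i ∈ t, ρ i x = 1 := by
  obtain ⟨f, hf⟩ := SmoothPartitionOfUnity.exists_isSubordinate_chartAt_source (𝓡 m) N
  have hfin : {i | (Function.support (f i)).Nonempty}.Finite :=
    f.locallyFinite.finite_nonempty_of_compact
  refine ⟨hfin.toFinset, fun i => f i, fun i => (f i).contMDiff, fun i => hf i, fun x => ?_⟩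
  rw [← f.sum_eq_one (mem_univ x), finsum_eq_sum_of_support_subset]
  intro i hi
  simp only [Finite.coe_toFinset]
  exact ⟨x, hi⟩

end Compact

/-! ### One-forms, their inner product and their divergence. -/

section Forms

variable {m : ℕ} {N : Type*} [TopologicalSpace N] [ChartedSpace (Euc m) N]

/-- Coordinate expression of a one-form. -/
def formInChart (β : N → Euc m →L[ℝ] ℝ) (e : OpenPartialHomeomorph N (Euc m)) (y : Euc m) :
    Euc m →L[ℝ] ℝ := (β (e.symm y)).comp (symmD e y)

/-- A smooth one-form. -/
def SmoothForm (β : N → Euc m →L[ℝ] ℝ) : Prop :=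
  ∀ e ∈ atlas (Euc m) N, ContDiffOn ℝ ∞ (formInChart β e) e.target

/-- The differential of a function. -/
def dForm (u : N → ℝ) (x : N) : Euc m →L[ℝ] ℝ := mfderiv (𝓡 m) 𝓘(ℝ, ℝ) u x

/-- The value of a field of bilinear forms, as a form on coordinate space. -/
def fiberForm (h : ∀ x : N, TangentSpace (𝓡 m) x →L[ℝ] TangentSpace (𝓡 m) x →L[ℝ] ℝ) (x : N) :
    Euc m →L[ℝ] Euc m →L[ℝ] ℝ := h x

/-- The inner product of one-forms. -/
def formInner (h : ∀ x : N, TangentSpace (𝓡 m) x →L[ℝ] TangentSpace (𝓡 m) x →L[ℝ] ℝ)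
    (α β : N → Euc m →L[ℝ] ℝ) (x : N) : ℝ :=
  α x ((fiberForm h x).inverse (β x))

/-- The divergence of a one-form, in the preferred chart. -/
def divForm (h : ∀ x : N, TangentSpace (𝓡 m) x →L[ℝ] TangentSpace (𝓡 m) x →L[ℝ] ℝ)
    (β : N → Euc m →L[ℝ] ℝ) (x : N) : ℝ :=
  divCoord (inChart h (chartAt (Euc m) x)) (formInChart β (chartAt (Euc m) x))
    (chartAt (Euc m) x x)

variable [IsManifold (𝓡 m) ∞ N] {e e' : OpenPartialHomeomorph N (Euc m)}
  {h : ∀ x : N, TangentSpace (𝓡 m) x →L[ℝ] TangentSpace (𝓡 m) x →L[ℝ] ℝ}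
  {α β : N → Euc m →L[ℝ] ℝ} {u v : N → ℝ}

lemma symmD_bijective (he : e ∈ atlas (Euc m) N) {y : Euc m} (hy : y ∈ e.target) :
    Function.Bijective (symmD e y) :=
  (chart_mdifferentiable he).symm.mfderiv_bijective hy

lemma SmoothMetric.isInner (hh : SmoothMetric h) (x : N) : IsInner (fiberForm h x) := by
  set e := chartAt (Euc m) x
  have he : e ∈ atlas (Euc m) N := chart_mem_atlas _ x
  have hx : x ∈ e.source := mem_chart_source _ x
  have hb := symmD_bijective he (e.map_source hx)
  have hi := (hh e he).inner (e x) (e.map_source hx)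
  rw [inChart_eq_pull, e.left_inv hx] at hi
  refine ⟨fun v w => ?_, fun v hv => ?_⟩
  · obtain ⟨v, rfl⟩ := hb.2 v
    obtain ⟨w, rfl⟩ := hb.2 w
    exact hi.symm v w
  · obtain ⟨v, rfl⟩ := hb.2 v
    refine hi.pos v fun h0 => hv ?_
    rw [h0, map_zero]

/-- Raising an index is natural under the isomorphism `symmD e y`; both sides are tested against its
image, which is the whole space. -/
lemma SmoothMetric.inverse_chart (hh : SmoothMetric h) (he : e ∈ atlas (Euc m) N) {y : Euc m}
    (hy : y ∈ e.target) : (fiberForm h (e.symm y)).inverse (β (e.symm y))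
      = symmD e y ((inChart h e y).inverse (formInChart β e y)) := by
  have hi := (hh e he).inner y hy
  have hx := hh.isInner (e.symm y)
  refine hx.ext fun v => ?_
  obtain ⟨v, rfl⟩ := (symmD_bijective he hy).2 v
  have h1 := congrArg (fun T : Euc m →L[ℝ] ℝ => T v) (hi.apply_inverse (formInChart β e y))
  rw [hx.apply_inverse]
  exact h1.symm

lemma SmoothMetric.formInner_chart (hh : SmoothMetric h) (he : e ∈ atlas (Euc m) N) {y : Euc m}
    (hy : y ∈ e.target) : formInner h α β (e.symm y)
      = formInChart α e y ((inChart h e y).inverse (formInChart β e y)) := by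
  rw [formInner, hh.inverse_chart he hy]
  rfl

lemma contDiffOn_comp_chart_symm (he : e ∈ atlas (Euc m) N) (hu : ContMDiff (𝓡 m) 𝓘(ℝ, ℝ) ∞ u) :
    ContDiffOn ℝ ∞ (fun y => u (e.symm y)) e.target := by
  rw [← contMDiffOn_iff_contDiffOn]
  exact hu.comp_contMDiffOn (contMDiffOn_chart_symm he)

lemma formInChart_dForm (he : e ∈ atlas (Euc m) N) {y : Euc m} (hy : y ∈ e.target)
    (hu : ContMDiff (𝓡 m) 𝓘(ℝ, ℝ) ∞ u) :
    formInChart (dForm u) e y = fderiv ℝ (fun y => u (e.symm y)) y := by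
  rw [← mfderiv_eq_fderiv]
  have := mfderiv_comp y ((hu.mdifferentiable (by simp)) (e.symm y))
    (mdifferentiableAt_chart_symm he hy)
  exact this.symm

lemma smoothForm_dForm (hu : ContMDiff (𝓡 m) 𝓘(ℝ, ℝ) ∞ u) : SmoothForm (m := m) (dForm u) := by
  intro e he
  refine ContDiffOn.congr (f := fderiv ℝ (fun y => u (e.symm y))) ?_
    fun y hy => formInChart_dForm he hy hu
  exact (contDiffOn_comp_chart_symm he hu).fderiv_of_isOpen e.open_target (by simp)

lemma laplaceCoord_chart (he : e ∈ atlas (Euc m) N) {y : Euc m} (hy : y ∈ e.target)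
    (hu : ContMDiff (𝓡 m) 𝓘(ℝ, ℝ) ∞ u) :
    laplaceCoord (inChart h e) (fun y => u (e.symm y)) y
      = divCoord (inChart h e) (formInChart (dForm u) e) y := by
  rw [laplaceCoord_eq_divCoord]
  apply divCoord_congr
  filter_upwards [e.open_target.mem_nhds hy] with z hz using (formInChart_dForm he hz hu).symm

lemma laplacian_eq_divForm (hu : ContMDiff (𝓡 m) 𝓘(ℝ, ℝ) ∞ u) (x : N) :
    laplacian h u x = divForm h (dForm u) x :=
  laplaceCoord_chart (chart_mem_atlas _ x) (mem_chart_target _ x) hu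

lemma dForm_eq_zero {x : N} (hx : x ∉ tsupport u) : dForm (m := m) u x = 0 := by
  have : u =ᶠ[𝓝 x] fun _ => (0 : ℝ) := notMem_tsupport_iff_eventuallyEq.1 hx
  unfold dForm
  rw [this.mfderiv_eq, mfderiv_const]
  rfl

lemma dForm_add (hu : ContMDiff (𝓡 m) 𝓘(ℝ, ℝ) ∞ u) (hv : ContMDiff (𝓡 m) 𝓘(ℝ, ℝ) ∞ v) (x : N) :
    dForm (m := m) (fun x => u x + v x) x = dForm u x + dForm v x :=
  mfderiv_add ((hu.mdifferentiable (by simp)) x) ((hv.mdifferentiable (by simp)) x)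

lemma dForm_const (c : ℝ) (x : N) : dForm (m := m) (fun _ : N => c) x = 0 := by
  unfold dForm
  rw [mfderiv_const]
  rfl

lemma dForm_sum {ι : Type*} (t : Finset ι) {w : ι → N → ℝ}
    (hw : ∀ i, ContMDiff (𝓡 m) 𝓘(ℝ, ℝ) ∞ (w i)) (x : N) :
    dForm (m := m) (fun x => ∑ i ∈ t, w i x) x = ∑ i ∈ t, dForm (w i) x := by
  classical
  induction t using Finset.induction_on with
  | empty => simp [dForm_const]
  | insert a s ha ih =>
    simp only [Finset.sum_insert ha]
    rw [dForm_add (hw a), ih]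
    exact contMDiff_finsetSum fun i _ => hw i

lemma dForm_mul (hu : ContMDiff (𝓡 m) 𝓘(ℝ, ℝ) ∞ u) (hv : ContMDiff (𝓡 m) 𝓘(ℝ, ℝ) ∞ v) (x : N) :
    dForm (m := m) (fun x => u x * v x) x = u x • dForm v x + v x • dForm u x :=
  (((hu.mdifferentiable (by simp)) x).hasMFDerivAt.mul
    ((hv.mdifferentiable (by simp)) x).hasMFDerivAt).mfderiv

lemma MetricOn.contDiffAt_divCoord {g : Euc m → Euc m →L[ℝ] Euc m →L[ℝ] ℝ} {O : Set (Euc m)}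
    (hg : MetricOn g O) {b : Euc m → Euc m →L[ℝ] ℝ} (hb : ContDiffOn ℝ ∞ b O) {y : Euc m}
    (hy : y ∈ O) : ContDiffAt ℝ ∞ (divCoord g b) y := by
  have hs := hg.contDiffAt_sqrtDet hy
  have hZ : ContDiffAt ℝ ∞ (fun z => (g z).inverse (b z)) y :=
    (hg.contDiffAt_inverse hy).clm_apply (hb.contDiffAt (hg.isOpen.mem_nhds hy))
  refine (hs.inv (hg.sqrtDet_pos hy).ne').mul (ContDiffAt.sum fun i _ => ?_)
  have h1 : ContDiffAt ℝ ∞ (fun z => sqrtDet g z * ((g z).inverse (b z)) i) y :=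
    hs.mul ((EuclideanSpace.proj i : Euc m →L[ℝ] ℝ).contDiff.contDiffAt.comp y hZ)
  exact (h1.fderiv_right (by simp)).clm_apply contDiffAt_const

lemma SmoothMetric.contDiffOn_divCoord (hh : SmoothMetric h) (hβ : SmoothForm β)
    (he : e ∈ atlas (Euc m) N) :
    ContDiffOn ℝ ∞ (divCoord (inChart h e) (formInChart β e)) e.target := fun _ hy =>
  ((hh e he).contDiffAt_divCoord (hβ e he) hy).contDiffWithinAt

lemma SmoothMetric.contDiffOn_formInner (hh : SmoothMetric h) (hα : SmoothForm α)
    (hβ : SmoothForm β) (he : e ∈ atlas (Euc m) N) :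
    ContDiffOn ℝ ∞ (fun y => formInner h α β (e.symm y)) e.target := by
  refine ContDiffOn.congr (f := fun y => formInChart α e y ((inChart h e y).inverse
    (formInChart β e y))) ?_ fun y hy => hh.formInner_chart he hy
  intro y hy
  have h2 := (hβ e he).contDiffAt (e.open_target.mem_nhds hy)
  have h3 := (hα e he).contDiffAt (e.open_target.mem_nhds hy)
  exact (h3.clm_apply (((hh e he).contDiffAt_inverse hy).clm_apply h2)).contDiffWithinAt

/-- A function is smooth if it is smooth in charts. -/
lemma contMDiff_of_charts (hu : ∀ e ∈ atlas (Euc m) N, ContDiffOn ℝ ∞ (fun y => u (e.symm y)) e.target) :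
    ContMDiff (𝓡 m) 𝓘(ℝ, ℝ) ∞ u := by
  intro x
  set e := chartAt (Euc m) x
  have he : e ∈ atlas (Euc m) N := chart_mem_atlas _ x
  have h1 : ContMDiffOn (𝓡 m) 𝓘(ℝ, ℝ) ∞ (fun x => u (e.symm (e x))) e.source :=
    ((contMDiffOn_iff_contDiffOn.2 (hu e he)).comp (contMDiffOn_chart he)
      fun x hx => e.map_source hx)
  have h2 : ContMDiffOn (𝓡 m) 𝓘(ℝ, ℝ) ∞ u e.source :=
    h1.congr fun x hx => by rw [e.left_inv hx]
  exact h2.contMDiffAt (e.open_source.mem_nhds (mem_chart_source _ x))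

lemma SmoothMetric.contMDiff_formInner (hh : SmoothMetric h) (hα : SmoothForm α)
    (hβ : SmoothForm β) : ContMDiff (𝓡 m) 𝓘(ℝ, ℝ) ∞ (formInner h α β) :=
  contMDiff_of_charts fun _ he => hh.contDiffOn_formInner hα hβ he

end Forms

/-! ### Green's formula on a compact manifold. -/

section Green

variable {m : ℕ} {N : Type*} [TopologicalSpace N] [ChartedSpace (Euc m) N]
  [IsManifold (𝓡 m) ∞ N] {e e' : OpenPartialHomeomorph N (Euc m)}
  {h : ∀ x : N, TangentSpace (𝓡 m) x →L[ℝ] TangentSpace (𝓡 m) x →L[ℝ] ℝ}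
  {α β : N → Euc m →L[ℝ] ℝ} {u v : N → ℝ}

lemma integrableOn_of_compact_support {O K : Set (Euc m)} {a : Euc m → ℝ} (hO : IsOpen O)
    (hK : IsCompact K) (hKO : K ⊆ O) (ha : ContinuousOn a O) (h0 : ∀ y ∈ O, y ∉ K → a y = 0) :
    IntegrableOn a O :=
  ((ha.mono hKO).integrableOn_compact hK).of_forall_sdiff_eq_zero hO.measurableSet
    fun y hy => h0 y hy.1 hy.2

variable [MeasurableSpace N] [BorelSpace N] [CompactSpace N] [T2Space N]

/-- Green's formula for a function supported in the domain of a chart. -/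
lemma SmoothMetric.integral_mul_divCoord (hh : SmoothMetric h) (hβ : SmoothForm β)
    (he : e ∈ atlas (Euc m) N) (hu : ContMDiff (𝓡 m) 𝓘(ℝ, ℝ) ∞ u) (hs : tsupport u ⊆ e.source) :
    ∫ x, u x * divCoord (inChart h e) (formInChart β e) (e x) ∂(riemannianMeasure h)
      = -∫ x, formInner h (dForm u) β x ∂(riemannianMeasure h) := by
  set g := inChart h e with hg
  set b := formInChart β e with hb
  have hgm : MetricOn g e.target := hh e he
  have hbs := hβ e he
  set K := e '' tsupport u with hKdef
  have hK : IsCompact K :=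
    (isClosed_tsupport u).isCompact.image_of_continuousOn (e.continuousOn.mono hs)
  have hKt : K ⊆ e.target := by
    rintro _ ⟨x, hx, rfl⟩
    exact e.map_source (hs hx)
  have hoff : ∀ y ∈ e.target, y ∉ K → e.symm y ∉ tsupport u := fun y hy hyK hyu =>
    hyK ⟨e.symm y, hyu, e.right_inv hy⟩
  have hus := contDiffOn_comp_chart_symm he hu
  have hu0 : ∀ y ∈ e.target, y ∉ K → u (e.symm y) = 0 := fun y hy hyK =>
    image_eq_zero_of_notMem_tsupport (hoff y hy hyK)
  have hZ : ∀ y ∈ e.target, ContDiffAt ℝ ∞ (fun z => (g z).inverse (b z)) y := fun y hy =>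
    (hgm.contDiffAt_inverse hy).clm_apply (hbs.contDiffAt (e.open_target.mem_nhds hy))
  have hsZ : ∀ i, ∀ y ∈ e.target,
      ContDiffAt ℝ ∞ (fun z => sqrtDet g z * ((g z).inverse (b z)) i) y := fun i y hy =>
    (hgm.contDiffAt_sqrtDet hy).mul
      ((EuclideanSpace.proj i : Euc m →L[ℝ] ℝ).contDiff.contDiffAt.comp y (hZ y hy))
  have hua : ∀ y ∈ e.target, ContDiffAt ℝ ∞ (fun z => u (e.symm z)) y := fun y hy =>
    hus.contDiffAt (e.open_target.mem_nhds hy)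
  -- The field `u √det g · b^♯` has compact support in the chart, so its divergence integrates to
  -- zero; the product rule splits it into the two sides.
  have hdiv := setIntegral_sum_fderiv_eq_zero
    (X := fun i z => u (e.symm z) * (sqrtDet g z * ((g z).inverse (b z)) i)) e.open_target hK hKt
    (fun i y hy => (((hua y hy).mul (hsZ i y hy)).of_le (by norm_cast)).contDiffWithinAt)
    (fun i y hy hyK => by simp [hu0 y hy hyK])
  have hpt : ∀ y ∈ e.target,
      ∑ i, fderiv ℝ (fun z => u (e.symm z) * (sqrtDet g z * ((g z).inverse (b z)) i)) y (stdVec i)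
      = sqrtDet g y * (u (e.symm y) * divCoord g b y)
        + sqrtDet g y * formInner h (dForm u) β (e.symm y) := by
    intro y hy
    have hpos := hgm.sqrtDet_pos hy
    have h1 : ∀ i, fderiv ℝ (fun z => u (e.symm z) * (sqrtDet g z * ((g z).inverse (b z)) i)) y
        (stdVec i) = u (e.symm y) * fderiv ℝ (fun z => sqrtDet g z * ((g z).inverse (b z)) i) y
          (stdVec i) + sqrtDet g y * (((g y).inverse (b y)) i
          * fderiv ℝ (fun z => u (e.symm z)) y (stdVec i)) := by
      intro i
      rw [fderiv_fun_mul ((hua y hy).differentiableAt (by simp))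
        ((hsZ i y hy).differentiableAt (by simp))]
      simp
      ring
    have h2 : ∑ i, ((g y).inverse (b y)) i * fderiv ℝ (fun z => u (e.symm z)) y (stdVec i)
        = fderiv ℝ (fun z => u (e.symm z)) y ((g y).inverse (b y)) := by
      rw [← sum_apply_stdVec (fderiv ℝ (fun z => u (e.symm z)) y)]; simp
    simp only [h1, Finset.sum_add_distrib, ← Finset.mul_sum]
    rw [h2, hh.formInner_chart he hy, formInChart_dForm he hy hu, divCoord, ← hg, ← hb]
    field_simp
  rw [setIntegral_congr_fun e.open_target.measurableSet hpt] at hdiv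
  have hc1 : ContinuousOn (fun y => u (e.symm y) * divCoord g b y) e.target :=
    hus.continuousOn.mul (hh.contDiffOn_divCoord hβ he).continuousOn
  have hc2 : ContinuousOn (fun y => formInner h (dForm u) β (e.symm y)) e.target :=
    (hh.contDiffOn_formInner (smoothForm_dForm hu) hβ he).continuousOn
  have hsc := (hh.contDiffOn_sqrtDet he).continuousOn
  have h0' : ∀ x, x ∉ tsupport u → formInner h (dForm u) β x = 0 := by
    intro x hx
    rw [formInner, dForm_eq_zero hx]
    rfl
  rw [integral_add] at hdiv
  · rw [hh.integral_of_support he, hh.integral_of_support he]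
    · rw [eq_neg_iff_add_eq_zero, ← hdiv]
      congr 1
      refine setIntegral_congr_fun e.open_target.measurableSet fun y hy => ?_
      simp only [e.right_inv hy]
      rfl
    · exact (hh.contMDiff_formInner (smoothForm_dForm hu) hβ).continuous.continuousOn
    · exact fun x hx => h0' x fun hx' => hx (hs hx')
    · exact hu.continuous.continuousOn.mul ((hh.contDiffOn_divCoord hβ he).continuousOn.comp
        e.continuousOn fun x hx => e.map_source hx)
    · intro x hx
      rw [image_eq_zero_of_notMem_tsupport fun hx' => hx (hs hx'), zero_mul]
  · exact integrableOn_of_compact_support e.open_target hK hKt (hsc.mul hc1)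
      fun y hy hyK => by simp [hu0 y hy hyK]
  · exact integrableOn_of_compact_support e.open_target hK hKt (hsc.mul hc2)
      fun y hy hyK => by rw [h0' _ (hoff y hy hyK), mul_zero]

/-- The divergence does not depend on the chart. -/
lemma SmoothMetric.divCoord_eq_divCoord (hh : SmoothMetric h) (hβ : SmoothForm β)
    (he : e ∈ atlas (Euc m) N) (he' : e' ∈ atlas (Euc m) N) {x : N} (hx : x ∈ e.source)
    (hx' : x ∈ e'.source) : divCoord (inChart h e) (formInChart β e) (e x)
      = divCoord (inChart h e') (formInChart β e') (e' x) := by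
  have := hh.isFiniteMeasure
  have := hh.isOpenPosMeasure
  set V := e.source ∩ e'.source
  have hV : IsOpen V := e.open_source.inter e'.open_source
  have hc : ∀ e₁ ∈ atlas (Euc m) N, ContinuousOn (fun x => divCoord (inChart h e₁)
      (formInChart β e₁) (e₁ x)) e₁.source := fun e₁ he₁ =>
    (hh.contDiffOn_divCoord hβ he₁).continuousOn.comp e₁.continuousOn fun x hx => e₁.map_source hx
  have hc1 := (hc e he).mono (inter_subset_left : V ⊆ _)
  have hc2 := (hc e' he').mono (inter_subset_right : V ⊆ _)
  have hloc : LocallyIntegrableOn (fun x => divCoord (inChart h e) (formInChart β e) (e x)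
      - divCoord (inChart h e') (formInChart β e') (e' x)) V (riemannianMeasure h) :=
    (hc1.sub hc2).locallyIntegrableOn hV.measurableSet
  -- No coordinate change is computed: both divergences satisfy the same Green formula against every
  -- test function supported in the overlap, and both are continuous there.
  have hae := hV.ae_eq_zero_of_integral_contMDiff_smul_eq_zero (𝓡 m) hloc
    fun w hw hwc hws => ?_
  · have hae2 : (fun x => divCoord (inChart h e) (formInChart β e) (e x))
        =ᵐ[(riemannianMeasure h).restrict V]
        fun x => divCoord (inChart h e') (formInChart β e') (e' x) := by
      rw [Filter.EventuallyEq, ae_restrict_iff' hV.measurableSet]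
      filter_upwards [hae] with z hz hzV using sub_eq_zero.1 (hz hzV)
    exact Measure.eqOn_open_of_ae_eq hae2 hV hc1 hc2 ⟨hx, hx'⟩
  · have hint : ∀ e₁ ∈ atlas (Euc m) N, tsupport w ⊆ e₁.source → Integrable (fun x => w x *
        divCoord (inChart h e₁) (formInChart β e₁) (e₁ x)) (riemannianMeasure h) := by
      intro e₁ he₁ hws₁
      have hcont : Continuous (fun x => w x * divCoord (inChart h e₁) (formInChart β e₁) (e₁ x)) := by
        rw [continuous_iff_continuousAt]
        intro z
        by_cases hz : z ∈ tsupport w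
        · exact hw.continuous.continuousAt.mul ((hc e₁ he₁).continuousAt
            (e₁.open_source.mem_nhds (hws₁ hz)))
        · have : (fun x => w x * divCoord (inChart h e₁) (formInChart β e₁) (e₁ x))
              =ᶠ[𝓝 z] fun _ => 0 := by
            filter_upwards [notMem_tsupport_iff_eventuallyEq.1 hz] with a ha
            simp [ha]
          exact continuousAt_const.congr this.symm
      exact hcont.integrable_of_hasCompactSupport (HasCompactSupport.of_compactSpace _)
    have h1 := hh.integral_mul_divCoord hβ he hw (hws.trans inter_subset_left)
    have h2 := hh.integral_mul_divCoord hβ he' hw (hws.trans inter_subset_right)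
    simp only [smul_eq_mul, mul_sub]
    rw [integral_sub (hint e he (hws.trans inter_subset_left))
      (hint e' he' (hws.trans inter_subset_right)), h1, h2, sub_self]

lemma SmoothMetric.divForm_eq (hh : SmoothMetric h) (hβ : SmoothForm β)
    (he : e ∈ atlas (Euc m) N) {x : N} (hx : x ∈ e.source) :
    divForm h β x = divCoord (inChart h e) (formInChart β e) (e x) :=
  hh.divCoord_eq_divCoord hβ (chart_mem_atlas _ x) he (mem_chart_source _ x) hx

lemma SmoothMetric.contMDiff_divForm (hh : SmoothMetric h) (hβ : SmoothForm β) :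
    ContMDiff (𝓡 m) 𝓘(ℝ, ℝ) ∞ (divForm h β) := by
  refine contMDiff_of_charts fun e he => (hh.contDiffOn_divCoord hβ he).congr fun y hy => ?_
  rw [hh.divForm_eq hβ he (e.map_target hy), e.right_inv hy]

lemma SmoothMetric.contMDiff_laplacian (hh : SmoothMetric h) (hu : ContMDiff (𝓡 m) 𝓘(ℝ, ℝ) ∞ u) :
    ContMDiff (𝓡 m) 𝓘(ℝ, ℝ) ∞ (laplacian h u) := by
  rw [funext (laplacian_eq_divForm (h := h) hu)]
  exact hh.contMDiff_divForm (smoothForm_dForm hu)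

lemma SmoothMetric.laplacian_chart (hh : SmoothMetric h) (hu : ContMDiff (𝓡 m) 𝓘(ℝ, ℝ) ∞ u)
    (he : e ∈ atlas (Euc m) N) {y : Euc m} (hy : y ∈ e.target) :
    laplacian h u (e.symm y) = laplaceCoord (inChart h e) (fun y => u (e.symm y)) y := by
  rw [laplacian_eq_divForm hu, hh.divForm_eq (smoothForm_dForm hu) he (e.map_target hy),
    e.right_inv hy, laplaceCoord_chart he hy hu]

lemma SmoothMetric.integrable (hh : SmoothMetric h) (hu : Continuous u) :
    Integrable u (riemannianMeasure h) :=
  have := hh.isFiniteMeasure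
  hu.integrable_of_hasCompactSupport (HasCompactSupport.of_compactSpace _)

/-- Green's formula. -/
lemma SmoothMetric.integral_mul_divForm (hh : SmoothMetric h) (hβ : SmoothForm β)
    (hu : ContMDiff (𝓡 m) 𝓘(ℝ, ℝ) ∞ u) :
    ∫ x, u x * divForm h β x ∂(riemannianMeasure h)
      = -∫ x, formInner h (dForm u) β x ∂(riemannianMeasure h) := by
  obtain ⟨t, ρ, hρ, hsub, hsum⟩ := exists_finite_partition m N
  have hρu : ∀ i, ContMDiff (𝓡 m) 𝓘(ℝ, ℝ) ∞ (fun x => ρ i x * u x) := fun i => (hρ i).mul hu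
  have hts : ∀ i, tsupport (fun x => ρ i x * u x) ⊆ (chartAt (Euc m) i).source := fun i =>
    (tsupport_mul_subset_left (f := ρ i)).trans (hsub i)
  have hd := hh.contMDiff_divForm hβ
  have h1 : ∀ i, ∫ x, ρ i x * u x * divForm h β x ∂(riemannianMeasure h)
      = -∫ x, formInner h (dForm fun x => ρ i x * u x) β x ∂(riemannianMeasure h) := by
    intro i
    rw [← hh.integral_mul_divCoord hβ (chart_mem_atlas _ i) (hρu i) (hts i)]
    congr 1
    ext x
    by_cases hx : x ∈ tsupport (fun x => ρ i x * u x)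
    · rw [hh.divForm_eq hβ (chart_mem_atlas _ i) (hts i hx)]
    · rw [image_eq_zero_of_notMem_tsupport hx, zero_mul, zero_mul]
  have hu' : u = fun x => ∑ i ∈ t, ρ i x * u x := by
    ext x
    rw [← Finset.sum_mul, hsum, one_mul]
  have h2 : ∀ x, u x * divForm h β x = ∑ i ∈ t, ρ i x * u x * divForm h β x := fun x => by
    rw [← Finset.sum_mul, ← Finset.sum_mul, hsum, one_mul]
  have h3 : ∀ x, formInner h (dForm u) β x
      = ∑ i ∈ t, formInner h (dForm fun x => ρ i x * u x) β x := by
    intro x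
    simp only [formInner]
    conv_lhs => rw [hu', dForm_sum t hρu, sum_apply]
  simp only [h2, h3]
  rw [integral_finsetSum, integral_finsetSum, ← Finset.sum_neg_distrib]
  · exact Finset.sum_congr rfl fun i _ => h1 i
  · exact fun i _ => hh.integrable
      (hh.contMDiff_formInner (smoothForm_dForm (hρu i)) hβ).continuous
  · exact fun i _ => hh.integrable ((hρu i).continuous.mul hd.continuous)

lemma SmoothMetric.formInner_comm (hh : SmoothMetric h) (x : N) :
    formInner h α β x = formInner h β α x := by
  have hi := hh.isInner x
  unfold formInner
  rw [← hi.apply_inverse (α x), ← hi.apply_inverse (β x), hi.inverse_apply, hi.inverse_apply, hi.symm]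

lemma SmoothMetric.formInner_self_nonneg (hh : SmoothMetric h) (x : N) :
    0 ≤ formInner h α α x := by
  have hi := hh.isInner x
  unfold formInner
  nth_rw 1 [← hi.apply_inverse (α x)]
  exact hi.nonneg _

lemma SmoothMetric.eq_zero_of_formInner_self (hh : SmoothMetric h) {x : N}
    (h0 : formInner h α α x = 0) : α x = 0 := by
  have hi := hh.isInner x
  unfold formInner at h0
  nth_rw 1 [← hi.apply_inverse (α x)] at h0
  rw [← hi.apply_inverse (α x), hi.eq_zero h0, map_zero]

lemma SmoothMetric.integral_mul_laplacian (hh : SmoothMetric h)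
    (hu : ContMDiff (𝓡 m) 𝓘(ℝ, ℝ) ∞ u) (hv : ContMDiff (𝓡 m) 𝓘(ℝ, ℝ) ∞ v) :
    ∫ x, u x * laplacian h v x ∂(riemannianMeasure h)
      = -∫ x, formInner h (dForm u) (dForm v) x ∂(riemannianMeasure h) := by
  simp only [laplacian_eq_divForm hv]
  exact hh.integral_mul_divForm (smoothForm_dForm hv) hu

lemma SmoothMetric.integral_laplacian_comm (hh : SmoothMetric h)
    (hu : ContMDiff (𝓡 m) 𝓘(ℝ, ℝ) ∞ u) (hv : ContMDiff (𝓡 m) 𝓘(ℝ, ℝ) ∞ v) :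
    ∫ x, u x * laplacian h v x ∂(riemannianMeasure h)
      = ∫ x, laplacian h u x * v x ∂(riemannianMeasure h) := by
  have h1 := hh.integral_mul_laplacian hv hu
  simp only [mul_comm (v _)] at h1
  rw [hh.integral_mul_laplacian hu hv, h1]
  simp only [hh.formInner_comm (α := dForm v)]

end Green

/-! ### An abstract spectral gap for operators with compact form embedding. -/

section Spectral

open scoped InnerProductSpace

variable {H : Type*} [NormedAddCommGroup H] [InnerProductSpace ℝ H]

/-- A nonnegative symmetric form vanishes only on the kernel of its operator. -/
theorem apply_eq_zero_of_inner_self_eq_zero {B : H →L[ℝ] H}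
    (hsymm : ∀ x y, ⟪B x, y⟫_ℝ = ⟪x, B y⟫_ℝ) (hpos : ∀ x, 0 ≤ ⟪B x, x⟫_ℝ) {x : H}
    (hx : ⟪B x, x⟫_ℝ = 0) : B x = 0 := by
  set c := ⟪B (B x), B x⟫_ℝ with hc
  have key : ∀ t : ℝ, 0 ≤ -2 * t * ‖B x‖ ^ 2 + t ^ 2 * c := by
    intro t
    have h := hpos (x - t • B x)
    have h1 : ⟪B (B x), x⟫_ℝ = ‖B x‖ ^ 2 := by rw [hsymm, real_inner_self_eq_norm_sq]
    simp only [map_sub, map_smul, inner_sub_left, inner_sub_right, inner_smul_left,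
      inner_smul_right, hx, h1, real_inner_self_eq_norm_sq, ← hc] at h
    simp at h
    linarith
  have hc0 : 0 ≤ c := hpos _
  -- At this value of `t` the quadratic expression is strictly negative unless `B x = 0`.
  have h := key (‖B x‖ ^ 2 / (c + 1))
  have h2 : -2 * (‖B x‖ ^ 2 / (c + 1)) * ‖B x‖ ^ 2 + (‖B x‖ ^ 2 / (c + 1)) ^ 2 * c
      = -((‖B x‖ ^ 2) ^ 2 * (c + 2) / (c + 1) ^ 2) := by field_simp; ring
  rw [h2] at h
  have h3 : 0 ≤ (‖B x‖ ^ 2) ^ 2 * (c + 2) / (c + 1) ^ 2 := by positivity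
  have h4 : (‖B x‖ ^ 2) ^ 2 * (c + 2) / (c + 1) ^ 2 = 0 := by linarith
  rw [div_eq_zero_iff, mul_eq_zero] at h4
  rcases h4 with (h4 | h4) | h4
  · simpa using h4
  · linarith
  · have : c + 1 = 0 := by simpa using h4
    linarith

variable [CompleteSpace H]

/-- A quadratic polynomial in a compact symmetric operator is nonnegative if it is nonnegative
at the eigenvalues. -/
theorem inner_quadratic_nonneg {T : H →L[ℝ] H} (hT : IsCompactOperator T)
    (hsymm : (T : H →ₗ[ℝ] H).IsSymmetric) {c : ℝ}
    (heig : ∀ μ : ℝ, ∀ u : H, u ≠ 0 → T u = μ • u → 0 ≤ (1 - μ) * (c - μ)) (x : H) :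
    0 ≤ ⟪c • x - T x, x - T x⟫_ℝ := by
  -- Eigenvectors of a compact symmetric operator, those for zero included, span a dense subspace;
  -- finite orthogonal sums then suffice.
  have hdense : Dense ((⨆ μ, Module.End.eigenspace (T : H →ₗ[ℝ] H) μ : Submodule ℝ H) : Set H) := by
    rw [Submodule.dense_iff_topologicalClosure_eq_top, Submodule.topologicalClosure_eq_top_iff]
    exact ContinuousLinearMap.orthogonalComplement_iSup_eigenspaces_eq_bot hT hsymm
  refine hdense.induction ?_ (isClosed_le (by fun_prop) (by fun_prop)) x
  intro x hx
  obtain ⟨f, hf, rfl⟩ := (Submodule.mem_iSup_iff_exists_finsupp _ _).1 hx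
  have hTf : ∀ μ, T (f μ) = μ • f μ := fun μ => Module.End.mem_eigenspace_iff.1 (hf μ)
  have horth : ∀ μ ν, μ ≠ ν → ⟪f μ, f ν⟫_ℝ = 0 := fun μ ν h =>
    hsymm.orthogonalFamily_eigenspaces h ⟨f μ, hf μ⟩ ⟨f ν, hf ν⟩
  have h1 : c • (f.sum fun _ x => x) - T (f.sum fun _ x => x) = ∑ μ ∈ f.support, (c - μ) • f μ := by
    simp only [Finsupp.sum, map_sum, Finset.smul_sum, hTf, ← Finset.sum_sub_distrib, sub_smul]
  have h2 : (f.sum fun _ x => x) - T (f.sum fun _ x => x) = ∑ μ ∈ f.support, (1 - μ) • f μ := by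
    simp only [Finsupp.sum, map_sum, hTf, ← Finset.sum_sub_distrib, sub_smul, one_smul]
  rw [h1, h2, sum_inner]
  refine Finset.sum_nonneg fun μ hμ => ?_
  rw [inner_sum, Finset.sum_eq_single μ]
  · rw [inner_smul_left, inner_smul_right, real_inner_self_eq_norm_sq]
    have := heig μ (f μ) (Finsupp.mem_support_iff.1 hμ) (hTf μ)
    simp only [conj_trivial]
    nlinarith [sq_nonneg ‖f μ‖]
  · intro ν _ hν
    rw [inner_smul_left, inner_smul_right, horth _ _ hν.symm]; simp
  · exact fun h => absurd hμ h

variable {V : Type*} [NormedAddCommGroup V] [InnerProductSpace ℝ V] [CompleteSpace V] {D : Type*}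

/-- The spectral gap of an operator `a` whose form domain `V` embeds compactly in `H`. -/
theorem spectral_gap_of_compact {j : D → V} {ι : V →L[ℝ] H} {a : D → H}
    (hι : IsCompactOperator ι) (hle : ∀ p, ‖ι p‖ ≤ ‖p‖)
    (hform : ∀ p v, ⟪p, j v⟫_ℝ = ⟪ι p, ι (j v) + a v⟫_ℝ) {lam : ℝ} (hlam : 0 < lam)
    (hleast : ∀ r : ℝ, 0 < r → ∀ u : H, u ≠ 0 → (∀ v, ⟪u, a v⟫_ℝ = r * ⟪u, ι (j v)⟫_ℝ) → lam ≤ r)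
    (f : D) :
    lam * ⟪ι (j f), a f⟫_ℝ ≤ ‖a f‖ ^ 2 ∧
      (lam * ⟪ι (j f), a f⟫_ℝ = ‖a f‖ ^ 2 → ∀ v, ⟪a f, a v⟫_ℝ = lam * ⟪a f, ι (j v)⟫_ℝ) := by
  -- If `A` denotes the operator `a`, then `T = ι ι*` is the resolvent `(1 + A)⁻¹`; `hTv` expresses
  -- this on the domain.
  set T : H →L[ℝ] H := ι.comp (ContinuousLinearMap.adjoint ι) with hTdef
  have hTc : IsCompactOperator T := hι.comp_clm _
  have hTs : ∀ x y, ⟪T x, y⟫_ℝ = ⟪x, T y⟫_ℝ := by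
    intro x y
    simp only [hTdef, ContinuousLinearMap.comp_apply]
    rw [← ContinuousLinearMap.adjoint_inner_right, ContinuousLinearMap.adjoint_inner_left]
  have hadj : ∀ v, ContinuousLinearMap.adjoint ι (ι (j v) + a v) = j v := by
    intro v
    refine ext_inner_left ℝ fun p => ?_
    rw [ContinuousLinearMap.adjoint_inner_right, hform]
  have hTv : ∀ v, T (ι (j v) + a v) = ι (j v) := fun v => by
    rw [hTdef, ContinuousLinearMap.comp_apply, hadj]
  -- Eigenvalues `r ≥ lam` of `A` correspond to eigenvalues `1/(1 + r) ≤ c` of `T`, and the kernel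
  -- of `A` to the eigenvalue `1`. Hence `(1 - μ)(c - μ) ≥ 0` throughout.
  set c : ℝ := 1 / (1 + lam) with hc
  have hcpos : 0 < c := by positivity
  have hcl : c * (1 + lam) = 1 := by rw [hc]; field_simp
  have hweak : ∀ (u : H) (μ : ℝ), T u = μ • u → ∀ v, ⟪u, ι (j v)⟫_ℝ =
      μ * (⟪u, ι (j v)⟫_ℝ + ⟪u, a v⟫_ℝ) := by
    intro u μ hu v
    nth_rw 1 [← hTv v]
    rw [← hTs, hu, inner_smul_left, inner_add_right]; simp
  have heig : ∀ μ : ℝ, ∀ u : H, u ≠ 0 → T u = μ • u → 0 ≤ (1 - μ) * (c - μ) := by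
    intro μ u hu0 hu
    set p := ContinuousLinearMap.adjoint ι u with hp
    have hιp : ι p = μ • u := hu
    have hpn : ‖p‖ ^ 2 = μ * ‖u‖ ^ 2 := by
      rw [← real_inner_self_eq_norm_sq, hp, ContinuousLinearMap.adjoint_inner_right, ← hp, hιp,
        inner_smul_left, real_inner_self_eq_norm_sq]; simp
    have hun : 0 < ‖u‖ ^ 2 := by positivity
    have hμ0 : 0 ≤ μ := by
      by_contra h
      push Not at h
      nlinarith [sq_nonneg ‖p‖]
    have hμ1 : μ ≤ 1 := by
      have h1 := hle p
      rw [hιp, norm_smul] at h1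
      have h2 : (‖μ‖ * ‖u‖) ^ 2 ≤ ‖p‖ ^ 2 := by gcongr
      rw [mul_pow, hpn, Real.norm_eq_abs, sq_abs] at h2
      by_contra h
      push Not at h
      nlinarith [mul_pos (mul_pos (zero_lt_one.trans h) (sub_pos.2 h)) hun]
    rcases hμ0.eq_or_lt with h0 | h0
    · rw [← h0]; simpa using hcpos.le
    rcases hμ1.eq_or_lt with h1 | h1
    · rw [h1]; simp
    -- For `0 < μ < 1` an eigenvector of `T` is a weak eigenvector of `A` for `1/μ - 1 > 0`.
    have hr : lam ≤ 1 / μ - 1 := by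
      refine hleast _ ?_ u hu0 fun v => ?_
      · rw [sub_pos, lt_div_iff₀ h0]; linarith
      · have h := hweak u μ hu v
        field_simp
        linarith
    have : μ * (1 + lam) ≤ 1 := by
      have : (1 + lam) ≤ 1 / μ := by linarith
      rw [le_div_iff₀ h0] at this
      linarith
    have hμc : μ ≤ c := by
      rw [hc, le_div_iff₀ (by positivity)]; exact this
    exact mul_nonneg (by linarith) (by linarith)
  have hnn : ∀ x : H, 0 ≤ ⟪c • x - T x, x - T x⟫_ℝ := inner_quadratic_nonneg hTc hTs heig
  set g := ι (j f) + a f with hg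
  have hg1 : g - T g = a f := by rw [hg, hTv]; abel
  -- At `g = (1 + A) f` one has `T g = f` and `(1 - T) g = A f`; with `1 - c = lam c` the form
  -- becomes `c` times the difference to be estimated.
  have hval : ⟪c • g - T g, g - T g⟫_ℝ = c * (‖a f‖ ^ 2 - lam * ⟪ι (j f), a f⟫_ℝ) := by
    rw [hg1, hg, hTv, smul_add, inner_sub_left, inner_add_left, inner_smul_left, inner_smul_left,
      real_inner_self_eq_norm_sq]
    simp only [conj_trivial]
    have : lam * c = 1 - c := by linarith
    linear_combination ⟪ι (j f), a f⟫_ℝ * this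
  refine ⟨?_, fun heq => ?_⟩
  · have := hnn g
    rw [hval] at this
    have := nonneg_of_mul_nonneg_right this hcpos
    linarith
  · set B : H →L[ℝ] H := (ContinuousLinearMap.id ℝ H - T).comp (c • ContinuousLinearMap.id ℝ H - T)
      with hB
    have hBi : ∀ x y, ⟪B x, y⟫_ℝ = ⟪c • x - T x, y - T y⟫_ℝ := by
      intro x y
      simp only [hB, ContinuousLinearMap.comp_apply, sub_apply, smul_apply,
        ContinuousLinearMap.id_apply, inner_sub_left, inner_sub_right, hTs]
    have hBs : ∀ x y, ⟪B x, y⟫_ℝ = ⟪x, B y⟫_ℝ := by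
      intro x y
      rw [real_inner_comm (B y) x, hBi, hBi]
      simp only [inner_sub_left, inner_sub_right, inner_smul_left, conj_trivial, hTs]
      rw [real_inner_comm x y, real_inner_comm (T x) y, real_inner_comm (T (T x)) y, hTs, hTs, hTs]
    -- Equality puts `g` in the kernel of `(1 - T)(c - T)`. The factors commute and `(1 - T) g = A
    -- f`, so `T (A f) = c A f`.
    have hB0 : B g = 0 := by
      refine apply_eq_zero_of_inner_self_eq_zero hBs (fun x => by rw [hBi]; exact hnn x) ?_
      rw [hBi, hval, heq]; simp
    have hTa : T (a f) = c • a f := by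
      have : B g = c • (g - T g) - T (g - T g) := by
        simp only [hB, ContinuousLinearMap.comp_apply, sub_apply, smul_apply,
          ContinuousLinearMap.id_apply, map_sub, map_smul, smul_sub]
      rw [hB0, hg1] at this
      exact (sub_eq_zero.1 this.symm).symm
    intro v
    have h := hweak _ _ hTa v
    have h2 := congrArg ((1 + lam) * ·) h
    rw [← mul_assoc, mul_comm (1 + lam) c, hcl] at h2
    linarith

/-- The spectral gap of a nonnegative symmetric operator with relatively compact form balls. -/
theorem spectral_gap {D : Type*} [AddCommGroup D] [Module ℝ D] {i : D →ₗ[ℝ] H} {a : D → H}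
    (hsymm : ∀ u v, ⟪i u, a v⟫_ℝ = ⟪a u, i v⟫_ℝ) (hnonneg : ∀ u, 0 ≤ ⟪i u, a u⟫_ℝ)
    (hbdd : TotallyBounded (i '' {u | ‖i u‖ ^ 2 + ⟪i u, a u⟫_ℝ ≤ 1})) {lam : ℝ} (hlam : 0 < lam)
    (hleast : ∀ r : ℝ, 0 < r → ∀ u : H, u ≠ 0 → (∀ v, ⟪u, a v⟫_ℝ = r * ⟪u, i v⟫_ℝ) → lam ≤ r)
    (f : D) :
    lam * ⟪i f, a f⟫_ℝ ≤ ‖a f‖ ^ 2 ∧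
      (lam * ⟪i f, a f⟫_ℝ = ‖a f‖ ^ 2 → ∀ v, ⟪a f, a v⟫_ℝ = lam * ⟪a f, i v⟫_ℝ) := by
  -- The form inner product `⟨u, v⟩ + ⟨u, A v⟩`. It may be degenerate, since `i` need not be
  -- injective; the completion of `D` then serves as the form domain.
  let core : PreInnerProductSpace.Core ℝ D :=
    { inner := fun u v => ⟪i u, i v⟫_ℝ + ⟪i u, a v⟫_ℝ
      conj_inner_symm := fun u v => by
        simp only [conj_trivial]
        rw [real_inner_comm, hsymm v u, real_inner_comm (i u) (a v)]
      re_inner_nonneg := fun u => by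
        simp only [RCLike.re_to_real]
        have := hnonneg u
        have := real_inner_self_nonneg (x := i u)
        linarith
      add_left := fun u v w => by simp only [map_add, inner_add_left]; ring
      smul_left := fun u v r => by
        simp only [map_smul, inner_smul_left]; ring }
  let _ : SeminormedAddCommGroup D :=
    @InnerProductSpace.Core.toSeminormedAddCommGroup ℝ D _ _ _ core
  let _ : InnerProductSpace ℝ D := InnerProductSpace.ofCore core
  have hinner : ∀ u v : D, ⟪u, v⟫_ℝ = ⟪i u, i v⟫_ℝ + ⟪i u, a v⟫_ℝ := fun u v => rfl
  have hnorm : ∀ u : D, ‖u‖ ^ 2 = ‖i u‖ ^ 2 + ⟪i u, a u⟫_ℝ := by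
    intro u
    rw [← real_inner_self_eq_norm_sq, hinner, real_inner_self_eq_norm_sq]
  let e : D →ₗ[ℝ] UniformSpace.Completion D :=
    (UniformSpace.Completion.toComplL (𝕜 := ℝ) (E := D)).toLinearMap
  have he : DenseRange e := UniformSpace.Completion.denseRange_coe
  have hen : ∀ u, ‖e u‖ = ‖u‖ := UniformSpace.Completion.norm_coe
  have hi : ∀ u, ‖i u‖ ≤ 1 * ‖e u‖ := by
    intro u
    rw [one_mul, hen]
    refine le_of_sq_le_sq ?_ (norm_nonneg _)
    rw [hnorm]; linarith [hnonneg u]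
  set ι : UniformSpace.Completion D →L[ℝ] H := i.extendOfNorm e
  have hιe : ∀ u, ι (e u) = i u := LinearMap.extendOfNorm_eq he ⟨1, hi⟩
  have hle : ∀ p, ‖ι p‖ ≤ ‖p‖ := fun p => by
    simpa using LinearMap.norm_extendOfNorm_apply_le he 1 hi p
  have hform : ∀ p v, ⟪p, e v⟫_ℝ = ⟪ι p, ι (e v) + a v⟫_ℝ := by
    intro p v
    refine he.induction_on (p := fun p => ⟪p, e v⟫_ℝ = ⟪ι p, ι (e v) + a v⟫_ℝ) p
      (isClosed_eq (by fun_prop) (by fun_prop)) fun u => ?_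
    rw [hιe, hιe, inner_add_right, ← hinner]
    exact UniformSpace.Completion.inner_coe u v
  -- By density of `D` in the completion, the image of the open unit ball lies in the closure of the
  -- totally bounded image of the form ball.
  have hcomp : IsCompactOperator ι := by
    refine ⟨closure (i '' {u | ‖i u‖ ^ 2 + ⟪i u, a u⟫_ℝ ≤ 1}),
      hbdd.closure.isCompact_of_isClosed isClosed_closure, ?_⟩
    refine Filter.mem_of_superset (Metric.ball_mem_nhds 0 one_pos) fun p hp => ?_
    have h1 := he.open_subset_closure_inter Metric.isOpen_ball hp
    have h2 := image_closure_subset_closure_image ι.continuous (mem_image_of_mem ι h1)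
    refine closure_mono ?_ h2
    rintro _ ⟨_, ⟨hq, u, rfl⟩, rfl⟩
    refine ⟨u, ?_, (hιe u).symm⟩
    rw [mem_ball_zero_iff, hen] at hq
    rw [mem_ofPred_eq, ← hnorm]
    nlinarith [norm_nonneg u]
  have := spectral_gap_of_compact hcomp hle hform hlam (by simpa only [hιe] using hleast) f
  simpa only [hιe] using this

end Spectral

/-! ### Rellich's theorem in coordinate space, by averages over small cubes. -/

section Rellich

/-- A set is totally bounded if finitely many bounded functions determine its points up to small
errors. -/
theorem totallyBounded_image_of_discretization {D H : Type*} [PseudoMetricSpace H] {i : D → H}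
    {S : Set D}
    (h : ∀ ε > 0, ∃ (κ : Type*) (_ : Fintype κ) (Λ : D → κ → ℝ) (δ : ℝ), 0 < δ ∧
      Bornology.IsBounded (Λ '' S) ∧
      ∀ u ∈ S, ∀ v ∈ S, dist (Λ u) (Λ v) < δ → dist (i u) (i v) < ε) :
    TotallyBounded (i '' S) := by
  rw [Metric.totallyBounded_iff]
  intro ε hε
  obtain ⟨κ, _, Λ, δ, hδ, hb, hΛ⟩ := h ε hε
  have htb : TotallyBounded (Λ '' S) :=
    hb.isCompact_closure.totallyBounded.subset subset_closure
  obtain ⟨t, hts, htf, htc⟩ := Metric.finite_approx_of_totallyBounded htb δ hδ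
  choose p hpS hp using fun z : t => hts z.2
  have := htf.to_subtype
  refine ⟨range fun z => i (p z), finite_range _, ?_⟩
  rintro _ ⟨u, hu, rfl⟩
  have := htc (mem_image_of_mem Λ hu)
  simp only [mem_iUnion, exists_prop] at this ⊢
  obtain ⟨z, hz, hd⟩ := this
  refine ⟨_, ⟨⟨z, hz⟩, rfl⟩, hΛ u hu _ (hpS _) ?_⟩
  rw [hp]; exact hd

/-- The variance of `g` on `[0, 1]` is nonnegative. -/
theorem sq_intervalIntegral_le {g : ℝ → ℝ} (hg : Continuous g) :
    (∫ t in (0 : ℝ)..1, g t) ^ 2 ≤ ∫ t in (0 : ℝ)..1, g t ^ 2 := by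
  set c := ∫ t in (0 : ℝ)..1, g t with hc
  have h : 0 ≤ ∫ t in (0 : ℝ)..1, (g t - c) ^ 2 :=
    intervalIntegral.integral_nonneg zero_le_one fun t _ => sq_nonneg _
  have h2 : ∫ t in (0 : ℝ)..1, (g t - c) ^ 2 = (∫ t in (0 : ℝ)..1, g t ^ 2) - c ^ 2 := by
    have : ∀ t, (g t - c) ^ 2 = g t ^ 2 - (2 * c) * g t + c ^ 2 := fun t => by ring
    simp only [this]
    rw [intervalIntegral.integral_add (Continuous.intervalIntegrable (by fun_prop) _ _)
      (Continuous.intervalIntegrable (by fun_prop) _ _),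
      intervalIntegral.integral_sub (Continuous.intervalIntegrable (by fun_prop) _ _)
      (Continuous.intervalIntegrable (by fun_prop) _ _), intervalIntegral.integral_const_mul, ← hc]
    simp; ring
  linarith

variable {m : ℕ}

theorem sq_sub_le_intervalIntegral {v : Euc m → ℝ} (hv : ContDiff ℝ 1 v) (x h : Euc m) :
    (v (x + h) - v x) ^ 2 ≤ ‖h‖ ^ 2 * ∫ t in (0 : ℝ)..1, ‖fderiv ℝ v (x + t • h)‖ ^ 2 := by
  have hd : Continuous (fderiv ℝ v) := hv.continuous_fderiv one_ne_zero
  have hder : ∀ t : ℝ, HasDerivAt (fun t : ℝ => v (x + t • h)) (fderiv ℝ v (x + t • h) h) t := by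
    intro t
    have h1 : HasDerivAt (fun t : ℝ => x + t • h) h t := by
      simpa using ((hasDerivAt_id t).smul_const h).const_add x
    exact ((hv.differentiable one_ne_zero _).hasFDerivAt).comp_hasDerivAt t h1
  have hint := intervalIntegral.integral_eq_sub_of_hasDerivAt (a := 0) (b := 1)
    (fun t _ => hder t) (Continuous.intervalIntegrable (by fun_prop) _ _)
  simp only [one_smul, zero_smul, add_zero] at hint
  rw [← hint]
  refine (sq_intervalIntegral_le (by fun_prop)).trans ?_
  rw [← intervalIntegral.integral_const_mul]
  refine intervalIntegral.integral_mono_on zero_le_one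
    (Continuous.intervalIntegrable (by fun_prop) _ _)
    (Continuous.intervalIntegrable (by fun_prop) _ _) fun t _ => ?_
  rw [← mul_pow, ← sq_abs, ← Real.norm_eq_abs, mul_comm]
  gcongr
  exact ContinuousLinearMap.le_opNorm _ _

/-- The pointwise bound along the segment is integrated in `x`; translation invariance removes the
shift `t • h`, and the remaining integral over `t` has mass one. -/
theorem lintegral_sq_sub_le {v : Euc m → ℝ} (hv : ContDiff ℝ 1 v) (h : Euc m) :
    ∫⁻ x, ENNReal.ofReal ((v (x + h) - v x) ^ 2)
      ≤ ENNReal.ofReal (‖h‖ ^ 2) * ∫⁻ x, ENNReal.ofReal (‖fderiv ℝ v x‖ ^ 2) := by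
  have hd : Continuous (fderiv ℝ v) := hv.continuous_fderiv one_ne_zero
  have hpt : ∀ x, ENNReal.ofReal ((v (x + h) - v x) ^ 2) ≤ ENNReal.ofReal (‖h‖ ^ 2) *
      ∫⁻ t in Ioc (0 : ℝ) 1, ENNReal.ofReal (‖fderiv ℝ v (x + t • h)‖ ^ 2) := by
    intro x
    refine (ENNReal.ofReal_le_ofReal (sq_sub_le_intervalIntegral hv x h)).trans ?_
    rw [ENNReal.ofReal_mul (by positivity), intervalIntegral.integral_of_le zero_le_one,
      ofReal_integral_eq_lintegral_ofReal]
    · exact (Continuous.integrableOn_Icc (by fun_prop)).mono_set Ioc_subset_Icc_self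
    · exact Filter.Eventually.of_forall fun t => sq_nonneg _
  refine (lintegral_mono hpt).trans ?_
  rw [lintegral_const_mul' _ _ ENNReal.ofReal_ne_top]
  refine mul_le_mul_right ?_ _
  rw [lintegral_lintegral_swap]
  · have : ∀ t : ℝ, ∫⁻ x, ENNReal.ofReal (‖fderiv ℝ v (x + t • h)‖ ^ 2)
        = ∫⁻ x, ENNReal.ofReal (‖fderiv ℝ v x‖ ^ 2) := fun t =>
      lintegral_add_right_eq_self (fun x => ENNReal.ofReal (‖fderiv ℝ v x‖ ^ 2)) (t • h)
    simp only [this]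
    simp
  · refine Measurable.aemeasurable ?_
    refine ENNReal.measurable_ofReal.comp (Continuous.measurable ?_)
    exact (show Continuous fun p : Euc m × ℝ => ‖fderiv ℝ v (p.1 + p.2 • h)‖ ^ 2 by fun_prop)

/-- The half-open cube with edge `δ` and lower corner `δ k`. -/
def cube (δ : ℝ) (k : Fin m → ℤ) : Set (Euc m) := {x | ∀ i, ⌊x i / δ⌋ = k i}

theorem measurableSet_cube (δ : ℝ) (k : Fin m → ℤ) : MeasurableSet (cube δ k) := by
  have : cube δ k = ⋂ i, {x : Euc m | ⌊x i / δ⌋ = k i} := by ext; simp [cube]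
  rw [this]
  refine MeasurableSet.iInter fun i => ?_
  have : Measurable fun x : Euc m => ⌊x i / δ⌋ :=
    Int.measurable_floor.comp (Continuous.measurable (by fun_prop))
  exact this (measurableSet_singleton (k i))

theorem norm_sub_le_of_mem_cube {δ : ℝ} (hδ : 0 < δ) {k : Fin m → ℤ} {x y : Euc m}
    (hx : x ∈ cube δ k) (hy : y ∈ cube δ k) : ‖y - x‖ ≤ δ * √m := by
  rw [EuclideanSpace.norm_eq]
  have : ∀ i, ‖(y - x) i‖ ^ 2 ≤ δ ^ 2 := by
    intro i
    have h := Int.abs_sub_lt_one_of_floor_eq_floor ((hx i).trans (hy i).symm)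
    rw [← sub_div, abs_div, abs_of_pos hδ, div_lt_one hδ, abs_sub_comm] at h
    have : ‖(y - x) i‖ ≤ δ := h.le
    gcongr
  calc √(∑ i, ‖(y - x) i‖ ^ 2) ≤ √(∑ i : Fin m, δ ^ 2) :=
        Real.sqrt_le_sqrt (Finset.sum_le_sum fun i _ => this i)
    _ = δ * √m := by
        simp only [Finset.sum_const, Finset.card_univ, Fintype.card_fin, nsmul_eq_mul]
        rw [mul_comm, Real.sqrt_mul (sq_nonneg _), Real.sqrt_sq hδ.le]

theorem cube_subset_closedBall {δ : ℝ} (hδ : 0 < δ) {k : Fin m → ℤ} {x : Euc m}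
    (hx : x ∈ cube δ k) : cube δ k ⊆ Metric.closedBall x (δ * √m) := fun y hy => by
  rw [Metric.mem_closedBall, dist_eq_norm]; exact norm_sub_le_of_mem_cube hδ hx hy

open scoped Pointwise in
-- The cube is a translate of the unit cube scaled by `δ`. Of the unit cube only finite positive
-- volume is used.
theorem volume_cube {δ : ℝ} (hδ : 0 < δ) (k : Fin m → ℤ) :
    volume (cube δ k) = ENNReal.ofReal (δ ^ m) * volume (cube (m := m) 1 0) := by
  set w : Euc m := WithLp.toLp 2 fun i => δ * k i with hw
  have h1 : cube δ k = (fun x => x + -w) ⁻¹' (δ • cube 1 0) := by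
    ext x
    rw [mem_preimage, mem_smul_set_iff_inv_smul_mem₀ hδ.ne']
    refine forall_congr' fun i => ?_
    have : (δ⁻¹ • (x + -w)) i / 1 = x i / δ - k i := by
      simp [hw]; field_simp; ring
    rw [this, Int.floor_sub_intCast]
    simp [sub_eq_zero]
  rw [h1, measure_preimage_add_right, Measure.addHaar_smul]
  simp [abs_of_pos hδ]

theorem volume_cube_one_pos : 0 < volume (cube (m := m) 1 0) := by
  have hopen : IsOpen {x : Euc m | ∀ i, 0 < x i ∧ x i < 1} := by
    have : {x : Euc m | ∀ i, 0 < x i ∧ x i < 1} = ⋂ i, {x : Euc m | 0 < x i ∧ x i < 1} := by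
      ext; simp
    rw [this]
    refine isOpen_iInter_of_finite fun i => ?_
    have hi : Continuous fun x : Euc m => x i := by fun_prop
    exact isOpen_Ioo.preimage hi
  refine (hopen.measure_pos volume ⟨WithLp.toLp 2 fun _ => 1 / 2, fun i => ?_⟩).trans_le
    (measure_mono fun x hx i => ?_)
  · simp; norm_num
  · simp only [div_one, Pi.zero_apply, Int.floor_eq_zero_iff]
    exact ⟨(hx i).1.le, (hx i).2⟩

theorem volume_cube_lt_top {δ : ℝ} (hδ : 0 < δ) (k : Fin m → ℤ) : volume (cube δ k) < ⊤ := by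
  rcases (cube δ k).eq_empty_or_nonempty with h | ⟨x, hx⟩
  · simp [h]
  · exact (measure_mono (cube_subset_closedBall hδ hx)).trans_lt measure_closedBall_lt_top

section

variable {α : Type*} [MeasurableSpace α] {ν : Measure α} [IsFiniteMeasure ν] {v : α → ℝ}

theorem integrable_sq_sub (hv : Integrable v ν) (hv2 : Integrable (fun x => v x ^ 2) ν) (c : ℝ) :
    Integrable (fun y => (c - v y) ^ 2) ν := by
  have : ∀ y, (c - v y) ^ 2 = c ^ 2 - (2 * c) * v y + v y ^ 2 := fun y => by ring
  simp only [this]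
  exact ((integrable_const _).sub (hv.const_mul _)).add hv2

theorem integral_sq_sub (hv : Integrable v ν) (hv2 : Integrable (fun x => v x ^ 2) ν) (c : ℝ) :
    ∫ y, (c - v y) ^ 2 ∂ν
      = ν.real univ * c ^ 2 - 2 * (∫ y, v y ∂ν) * c + ∫ y, v y ^ 2 ∂ν := by
  have : ∀ y, (c - v y) ^ 2 = c ^ 2 - (2 * c) * v y + v y ^ 2 := fun y => by ring
  have h1 : Integrable (fun y => c ^ 2 - (2 * c) * v y) ν :=
    (integrable_const _).sub (hv.const_mul _)
  simp only [this]
  rw [integral_add h1 hv2, integral_sub (integrable_const _) (hv.const_mul _), integral_const_mul,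
    integral_const, smul_eq_mul]
  ring

theorem integrable_integral_sq_sub (hv : Integrable v ν) (hv2 : Integrable (fun x => v x ^ 2) ν) :
    Integrable (fun x => ∫ y, (v x - v y) ^ 2 ∂ν) ν := by
  simp only [integral_sq_sub hv hv2]
  exact ((hv2.const_mul _).sub (hv.const_mul _)).add (integrable_const _)

/-- The double integral is a variance. A bound on the oscillation over a cube thus bounds `∫ v²` by
the square of a single integral plus an error. -/
theorem integral_integral_sq_sub (hv : Integrable v ν) (hv2 : Integrable (fun x => v x ^ 2) ν) :
    ∫ x, ∫ y, (v x - v y) ^ 2 ∂ν ∂ν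
      = 2 * (ν.real univ * ∫ x, v x ^ 2 ∂ν - (∫ x, v x ∂ν) ^ 2) := by
  have h1 : Integrable (fun x => ν.real univ * v x ^ 2 - 2 * (∫ y, v y ∂ν) * v x) ν :=
    (hv2.const_mul _).sub (hv.const_mul _)
  simp only [integral_sq_sub hv hv2]
  rw [integral_add h1 (integrable_const _), integral_sub (hv2.const_mul _) (hv.const_mul _),
    integral_const_mul, integral_const_mul, integral_const, smul_eq_mul]
  ring

theorem ofReal_integral_integral_sq_sub (hv : Integrable v ν)
    (hv2 : Integrable (fun x => v x ^ 2) ν) :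
    ENNReal.ofReal (∫ x, ∫ y, (v x - v y) ^ 2 ∂ν ∂ν)
      = ∫⁻ x, ∫⁻ y, ENNReal.ofReal ((v x - v y) ^ 2) ∂ν ∂ν := by
  rw [ofReal_integral_eq_lintegral_ofReal (integrable_integral_sq_sub hv hv2)
    (Filter.Eventually.of_forall fun x => integral_nonneg fun y => sq_nonneg _)]
  exact lintegral_congr fun x => ofReal_integral_eq_lintegral_ofReal (integrable_sq_sub hv hv2 _)
      (Filter.Eventually.of_forall fun y => sq_nonneg _)

end

/-- The oscillation over cubes of a grid is controlled by the gradient. -/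
theorem sum_lintegral_cube_le {v : Euc m → ℝ} (hv : ContDiff ℝ 1 v) {δ : ℝ} (hδ : 0 < δ)
    (t : Finset (Fin m → ℤ)) :
    ∑ k ∈ t, ∫⁻ x in cube δ k, ∫⁻ y in cube δ k, ENNReal.ofReal ((v x - v y) ^ 2)
      ≤ volume (Metric.closedBall (0 : Euc m) (δ * √m)) * ENNReal.ofReal ((δ * √m) ^ 2)
        * ∫⁻ x, ENNReal.ofReal (‖fderiv ℝ v x‖ ^ 2) := by
  -- Two points of a cube differ by a vector of the ball `B`, so the inner integral may be taken
  -- over displacements `h ∈ B`, and the translation estimate applies to each `h`.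
  set B := Metric.closedBall (0 : Euc m) (δ * √m) with hB
  set Ψ : Euc m → ENNReal := fun x => ∫⁻ h in B, ENNReal.ofReal ((v (x + h) - v x) ^ 2) with hΨ
  have hvc := hv.continuous
  have h1 : ∀ k, ∀ x ∈ cube δ k,
      ∫⁻ y in cube δ k, ENNReal.ofReal ((v x - v y) ^ 2) ≤ Ψ x := by
    intro k x hx
    have : Ψ x = ∫⁻ y in Metric.closedBall x (δ * √m), ENNReal.ofReal ((v y - v x) ^ 2) := by
      rw [hΨ]
      simp only
      rw [← lintegral_indicator Metric.isClosed_closedBall.measurableSet,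
        ← lintegral_indicator Metric.isClosed_closedBall.measurableSet,
        ← lintegral_add_left_eq_self ((Metric.closedBall x (δ * √m)).indicator _) x]
      refine lintegral_congr fun h => ?_
      simp [indicator]
    rw [this]
    refine (lintegral_mono_set (cube_subset_closedBall hδ hx)).trans (le_of_eq ?_)
    exact lintegral_congr fun y => by congr 1; ring
  have h2 : ∑ k ∈ t, ∫⁻ x in cube δ k, Ψ x = ∫⁻ x in ⋃ k ∈ t, cube δ k, Ψ x := by
    refine (lintegral_biUnion_finset ?_ (fun k _ => measurableSet_cube δ k) _).symm
    intro k _ l _ hkl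
    refine Set.disjoint_left.2 fun x hx hx' => hkl ?_
    funext i
    exact (hx i).symm.trans (hx' i)
  calc _ ≤ ∑ k ∈ t, ∫⁻ x in cube δ k, Ψ x := Finset.sum_le_sum fun k _ =>
        setLIntegral_mono' (measurableSet_cube δ k) (h1 k)
    _ ≤ ∫⁻ x, Ψ x := by rw [h2]; exact setLIntegral_le_lintegral _ _
    _ = ∫⁻ h in B, ∫⁻ x, ENNReal.ofReal ((v (x + h) - v x) ^ 2) := by
        rw [hΨ, lintegral_lintegral_swap]
        refine (ENNReal.measurable_ofReal.comp (Continuous.measurable ?_)).aemeasurable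
        exact (show Continuous fun p : Euc m × Euc m => (v (p.1 + p.2) - v p.1) ^ 2 by fun_prop)
    _ ≤ ∫⁻ _h in B, ENNReal.ofReal ((δ * √m) ^ 2)
          * ∫⁻ x, ENNReal.ofReal (‖fderiv ℝ v x‖ ^ 2) := by
        refine setLIntegral_mono' Metric.isClosed_closedBall.measurableSet fun h hh => ?_
        refine (lintegral_sq_sub_le hv h).trans ?_
        have : ‖h‖ ≤ δ * √m := by simpa [hB] using hh
        gcongr
    _ = _ := by rw [setLIntegral_const]; ring

/-- A compactly supported function is small in the mean if its gradient is bounded and finitely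
many averages of it vanish. -/
theorem exists_cubes_integral_sq_le {K : Set (Euc m)} (hK : IsCompact K) {ε : ℝ} (hε : 0 < ε) :
    ∃ (t : Finset (Fin m → ℤ)) (δ C : ℝ), 0 < δ ∧ 0 < C ∧ ∀ v : Euc m → ℝ, ContDiff ℝ 1 v →
      (∀ x ∉ K, v x = 0) →
      (∀ k ∈ t, (∫ x in cube δ k, v x) ^ 2 ≤ C * ∫ x, v x ^ 2) ∧
      ∫ x, v x ^ 2 ≤ C * ∑ k ∈ t, (∫ x in cube δ k, v x) ^ 2 + ε * ∫ x, ‖fderiv ℝ v x‖ ^ 2 := by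
  set c₁ := volume.real (cube (m := m) 1 0) with hc₁
  have hc₁pos : 0 < c₁ :=
    ENNReal.toReal_pos volume_cube_one_pos.ne' (volume_cube_lt_top one_pos _).ne
  set b₁ := volume.real (Metric.closedBall (0 : Euc m) (√m)) with hb₁
  -- This is the final coefficient of the gradient term: the factor `δ ^ m` in the volume of the
  -- ball cancels that of the cube, so the coefficient tends to zero with `δ`.
  obtain ⟨δ, hδ, hδε⟩ : ∃ δ : ℝ, 0 < δ ∧ b₁ / (2 * c₁) * (δ * √m) ^ 2 ≤ ε := by
    have hlim : Filter.Tendsto (fun δ : ℝ => b₁ / (2 * c₁) * (δ * √m) ^ 2) (𝓝[>] 0) (𝓝 0) := by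
      have : Continuous (fun δ : ℝ => b₁ / (2 * c₁) * (δ * √m) ^ 2) := by fun_prop
      simpa using (this.tendsto 0).mono_left nhdsWithin_le_nhds
    obtain ⟨δ, h1, h2⟩ := ((hlim.eventually_le_const hε).and self_mem_nhdsWithin).exists
    exact ⟨δ, h2, h1⟩
  set c := δ ^ m * c₁ with hc
  have hcpos : 0 < c := by positivity
  have hvol : ∀ k : Fin m → ℤ, volume.real (cube δ k) = c := by
    intro k
    rw [Measure.real, volume_cube hδ, ENNReal.toReal_mul, ENNReal.toReal_ofReal (by positivity)]
    rfl
  have hball : volume (Metric.closedBall (0 : Euc m) (δ * √m)) = ENNReal.ofReal (δ ^ m * b₁) := by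
    rw [Measure.addHaar_closedBall_mul _ _ hδ.le (Real.sqrt_nonneg _),
      ENNReal.ofReal_mul (by positivity), hb₁, Measure.real,
      ENNReal.ofReal_toReal measure_closedBall_lt_top.ne]
    simp
  obtain ⟨t, ht⟩ : ∃ t : Finset (Fin m → ℤ), K ⊆ ⋃ k ∈ t, cube δ k := by
    obtain ⟨ρ, hρ⟩ := hK.isBounded.exists_norm_le
    refine ⟨Fintype.piFinset fun _ => Finset.Icc ⌊-ρ / δ⌋ ⌊ρ / δ⌋, fun x hx => ?_⟩
    simp only [mem_iUnion, Fintype.mem_piFinset, Finset.mem_Icc, exists_prop]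
    refine ⟨fun i => ⌊x i / δ⌋, fun i => ?_, fun i => rfl⟩
    have h1 : |x i| ≤ ρ := (PiLp.norm_apply_le x i).trans (hρ x hx)
    obtain ⟨h2, h3⟩ := abs_le.1 h1
    exact ⟨Int.floor_le_floor (by gcongr), Int.floor_le_floor (by gcongr)⟩
  refine ⟨t, δ, max c c⁻¹, hδ, by positivity, fun v hv hvK => ?_⟩
  have hvc := hv.continuous
  have hsupp : HasCompactSupport v := HasCompactSupport.intro hK hvK
  have hvi : Integrable v := hvc.integrable_of_hasCompactSupport hsupp
  have hv2i : Integrable fun x => v x ^ 2 :=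
    (hvc.pow 2).integrable_of_hasCompactSupport (by
      refine HasCompactSupport.intro hK fun x hx => ?_
      simp [hvK x hx])
  have hfin : ∀ k : Fin m → ℤ, IsFiniteMeasure (volume.restrict (cube δ k)) := fun k =>
    ⟨by rw [Measure.restrict_apply_univ]; exact volume_cube_lt_top hδ k⟩
  set I : (Fin m → ℤ) → ℝ := fun k => ∫ x in cube δ k, ∫ y in cube δ k, (v x - v y) ^ 2 with hI
  have hI0 : ∀ k, 0 ≤ I k := fun k => integral_nonneg fun x => integral_nonneg fun y => sq_nonneg _
  have hIk : ∀ k, I k = 2 * (c * (∫ x in cube δ k, v x ^ 2) - (∫ x in cube δ k, v x) ^ 2) := by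
    intro k
    rw [hI]
    simp only
    rw [integral_integral_sq_sub hvi.integrableOn hv2i.integrableOn]
    simp [hvol k]
  have hle : ∀ k, ∫ x in cube δ k, v x ^ 2 ≤ ∫ x, v x ^ 2 := fun k =>
    setIntegral_le_integral hv2i (Filter.Eventually.of_forall fun x => sq_nonneg _)
  have hsum : ∫ x, v x ^ 2 = ∑ k ∈ t, ∫ x in cube δ k, v x ^ 2 := by
    rw [← integral_biUnion_finset t (fun k _ => measurableSet_cube δ k) _
      fun k _ => hv2i.integrableOn]
    · refine (setIntegral_eq_integral_of_forall_compl_eq_zero fun x hx => ?_).symm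
      rw [hvK x fun h => hx (ht h)]; simp
    · intro k _ l _ hkl
      refine Set.disjoint_left.2 fun x hx hx' => hkl ?_
      funext i
      exact (hx i).symm.trans (hx' i)
  have hgi : Integrable fun x => ‖fderiv ℝ v x‖ ^ 2 := by
    have hd : Continuous (fderiv ℝ v) := hv.continuous_fderiv one_ne_zero
    have hds : HasCompactSupport (fderiv ℝ v) := hsupp.fderiv (𝕜 := ℝ)
    refine Continuous.integrable_of_hasCompactSupport (by fun_prop) ?_
    refine HasCompactSupport.intro hds fun x hx => ?_
    simp [image_eq_zero_of_notMem_tsupport hx]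
  have hsumI : ∑ k ∈ t, I k ≤ δ ^ m * b₁ * (δ * √m) ^ 2 * ∫ x, ‖fderiv ℝ v x‖ ^ 2 := by
    have h := sum_lintegral_cube_le hv hδ t
    have hIe : ∀ k, ∫⁻ x in cube δ k, ∫⁻ y in cube δ k, ENNReal.ofReal ((v x - v y) ^ 2)
        = ENNReal.ofReal (I k) := fun k =>
      (ofReal_integral_integral_sq_sub hvi.integrableOn hv2i.integrableOn).symm
    simp only [hIe] at h
    rw [← ENNReal.ofReal_sum_of_nonneg fun k _ => hI0 k, hball,
      ← ofReal_integral_eq_lintegral_ofReal hgi (Filter.Eventually.of_forall fun x => sq_nonneg _),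
      ← ENNReal.ofReal_mul (by positivity), ← ENNReal.ofReal_mul (by positivity)] at h
    exact (ENNReal.ofReal_le_ofReal_iff (by positivity)).1 h
  refine ⟨fun k hk => ?_, ?_⟩
  · have h1 := hI0 k
    rw [hIk] at h1
    have h2 : c * ∫ x in cube δ k, v x ^ 2 ≤ max c c⁻¹ * ∫ x, v x ^ 2 :=
      mul_le_mul (le_max_left _ _) (hle k) (integral_nonneg fun x => sq_nonneg _) (by positivity)
    linarith
  · have h1 : ∀ k, ∫ x in cube δ k, v x ^ 2
        = c⁻¹ * (∫ x in cube δ k, v x) ^ 2 + (2 * c)⁻¹ * I k := by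
      intro k; rw [hIk]; field_simp; ring
    have h2 : (0 : ℝ) ≤ ∫ x, ‖fderiv ℝ v x‖ ^ 2 := integral_nonneg fun x => sq_nonneg _
    have h3 : 0 ≤ ∑ k ∈ t, (∫ x in cube δ k, v x) ^ 2 := Finset.sum_nonneg fun k _ => sq_nonneg _
    rw [hsum]
    simp only [h1, Finset.sum_add_distrib, ← Finset.mul_sum]
    have h4 : (2 * c)⁻¹ * (δ ^ m * b₁ * (δ * √m) ^ 2) = b₁ / (2 * c₁) * (δ * √m) ^ 2 := by
      rw [hc]; field_simp
    refine add_le_add (mul_le_mul_of_nonneg_right (le_max_right _ _) h3) ?_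
    calc (2 * c)⁻¹ * ∑ k ∈ t, I k
        ≤ (2 * c)⁻¹ * (δ ^ m * b₁ * (δ * √m) ^ 2 * ∫ x, ‖fderiv ℝ v x‖ ^ 2) := by gcongr
      _ = (b₁ / (2 * c₁) * (δ * √m) ^ 2) * ∫ x, ‖fderiv ℝ v x‖ ^ 2 := by rw [← h4]; ring
      _ ≤ ε * ∫ x, ‖fderiv ℝ v x‖ ^ 2 := by gcongr

end Rellich

/-! ### Sobolev norms on a compact manifold and in its charts. -/

section SobolevManifold

lemma IsInner.sq_apply_le {m : ℕ} {B : Euc m →L[ℝ] Euc m →L[ℝ] ℝ} (hB : IsInner B) (v w : Euc m) :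
    B v w ^ 2 ≤ B v v * B w w := by
  have h : ∀ t : ℝ, 0 ≤ B v v * (t * t) + (2 * B v w) * t + B w w := by
    intro t
    have h1 := hB.nonneg (t • v + w)
    simp only [map_add, map_smul, add_apply, smul_apply, smul_eq_mul, hB.symm w v] at h1
    linarith
  have := discrim_le_zero h
  rw [discrim] at this
  nlinarith

/-- Cauchy–Schwarz for `B` applied to `α v = B p v`, with `p` the raised covector. It compares the
Euclidean norm of a differential with its Riemannian norm. -/
lemma IsInner.norm_sq_le {m : ℕ} {B : Euc m →L[ℝ] Euc m →L[ℝ] ℝ} (hB : IsInner B)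
    (α : Euc m →L[ℝ] ℝ) : ‖α‖ ^ 2 ≤ ‖B‖ * α (B.inverse α) := by
  set p := B.inverse α with hp
  have hα : B p = α := hB.apply_inverse α
  have h0 : 0 ≤ α p := by rw [← hα]; exact hB.nonneg p
  have hle : ‖α‖ ≤ √(‖B‖ * α p) := by
    refine ContinuousLinearMap.opNorm_le_bound _ (Real.sqrt_nonneg _) fun v => ?_
    refine abs_le_of_sq_le_sq ?_ (by positivity)
    rw [mul_pow, Real.sq_sqrt (by positivity)]
    have h1 := hB.sq_apply_le p v
    rw [hα] at h1
    have h2 : B v v ≤ ‖B‖ * ‖v‖ * ‖v‖ := (le_abs_self _).trans (B.le_opNorm₂ v v)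
    calc α v ^ 2 ≤ α p * B v v := h1
      _ ≤ α p * (‖B‖ * ‖v‖ * ‖v‖) := by gcongr
      _ = ‖B‖ * α p * ‖v‖ ^ 2 := by ring
  calc ‖α‖ ^ 2 ≤ √(‖B‖ * α p) ^ 2 := by gcongr
    _ = _ := Real.sq_sqrt (by positivity)

variable {m : ℕ} {N : Type*} [TopologicalSpace N] [ChartedSpace (Euc m) N]
  [IsManifold (𝓡 m) ∞ N] {e : OpenPartialHomeomorph N (Euc m)}
  {h : ∀ x : N, TangentSpace (𝓡 m) x →L[ℝ] TangentSpace (𝓡 m) x →L[ℝ] ℝ}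
  {α β : N → Euc m →L[ℝ] ℝ} {u v w ρ : N → ℝ}

/-- A function in a chart, extended by zero. -/
def chartFun (e : OpenPartialHomeomorph N (Euc m)) (w : N → ℝ) : Euc m → ℝ :=
  e.target.indicator fun y => w (e.symm y)

lemma comp_symm_eq_zero {A : Set N} (h0 : ∀ x ∉ A, w x = 0) {y : Euc m} (hy : y ∈ e.target)
    (hyK : y ∉ e '' A) : w (e.symm y) = 0 :=
  h0 _ fun hA => hyK ⟨_, hA, e.right_inv hy⟩

lemma isCompact_image_chart {A : Set N} (hA : IsCompact A) (hs : A ⊆ e.source) :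
    IsCompact (e '' A) := hA.image_of_continuousOn (e.continuousOn.mono hs)

lemma image_chart_subset {A : Set N} (hs : A ⊆ e.source) : e '' A ⊆ e.target := by
  rintro _ ⟨x, hx, rfl⟩; exact e.map_source (hs hx)

lemma chartFun_eq_zero {A : Set N} (h0 : ∀ x ∉ A, w x = 0) {y : Euc m} (hyK : y ∉ e '' A) :
    chartFun e w y = 0 := by
  by_cases hy : y ∈ e.target
  · rw [chartFun, indicator_of_mem hy, comp_symm_eq_zero h0 hy hyK]
  · rw [chartFun, indicator_of_notMem hy]

lemma contDiff_chartFun {A : Set N} (hA : IsCompact A) (hs : A ⊆ e.source)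
    (he : e ∈ atlas (Euc m) N) (hw : ContMDiff (𝓡 m) 𝓘(ℝ, ℝ) ∞ w) (h0 : ∀ x ∉ A, w x = 0) :
    ContDiff ℝ ∞ (chartFun e w) :=
  contDiff_indicator e.open_target (isCompact_image_chart hA hs).isClosed (image_chart_subset hs)
    (contDiffOn_comp_chart_symm he hw) fun _ hy hyK => comp_symm_eq_zero h0 hy hyK

lemma fderiv_chartFun (he : e ∈ atlas (Euc m) N) (hw : ContMDiff (𝓡 m) 𝓘(ℝ, ℝ) ∞ w) {y : Euc m}
    (hy : y ∈ e.target) : fderiv ℝ (chartFun e w) y = formInChart (dForm w) e y := by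
  rw [formInChart_dForm he hy hw]
  exact (indicator_eventuallyEq e.open_target hy).fderiv_eq

variable [MeasurableSpace N] [BorelSpace N] [CompactSpace N] [T2Space N]

/-- Comparison of Sobolev norms on the manifold and in a chart. -/
lemma SmoothMetric.exists_chart_bounds (hh : SmoothMetric h) (he : e ∈ atlas (Euc m) N) {A : Set N}
    (hAc : IsClosed A) (hs : A ⊆ e.source) :
    ∃ C : ℝ, 0 < C ∧ ∀ w : N → ℝ, ContMDiff (𝓡 m) 𝓘(ℝ, ℝ) ∞ w → (∀ x ∉ A, w x = 0) →
      ∫ x, w x ^ 2 ∂(riemannianMeasure h) ≤ C * ∫ y, chartFun e w y ^ 2 ∧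
      ∫ y, chartFun e w y ^ 2 ≤ C * ∫ x, w x ^ 2 ∂(riemannianMeasure h) ∧
      ∫ y, ‖fderiv ℝ (chartFun e w) y‖ ^ 2
        ≤ C * ∫ x, formInner h (dForm w) (dForm w) x ∂(riemannianMeasure h) := by
  set K := e '' A with hKdef
  have hK : IsCompact K := isCompact_image_chart hAc.isCompact hs
  have hKt : K ⊆ e.target := image_chart_subset hs
  have hg := hh e he
  have hsc : ContinuousOn (sqrtDet (inChart h e)) e.target := (hh.contDiffOn_sqrtDet he).continuousOn
  have hpos : ∀ y ∈ e.target, 0 < sqrtDet (inChart h e) y := fun y hy => hg.sqrtDet_pos hy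
  obtain ⟨C₁, hC₁⟩ := hK.exists_bound_of_continuousOn (hsc.mono hKt)
  obtain ⟨C₂, hC₂⟩ := hK.exists_bound_of_continuousOn
    ((hsc.inv₀ fun y hy => (hpos y hy).ne').mono hKt)
  obtain ⟨C₃, hC₃⟩ := hK.exists_bound_of_continuousOn (hg.smooth.continuousOn.mono hKt)
  -- `C` bounds the density, its inverse and the metric on the compact set. The gradient comparison
  -- uses one factor for the density and one for the metric, whence `C * C`.
  set C := max 1 (max C₁ (max C₂ C₃)) with hC
  have hC1 : 1 ≤ C := le_max_left _ _
  have hCpos : 0 < C := by linarith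
  have hb1 : ∀ y ∈ K, sqrtDet (inChart h e) y ≤ C := fun y hy =>
    (le_abs_self _).trans ((hC₁ y hy).trans ((le_max_left _ _).trans (le_max_right _ _)))
  have hb2 : ∀ y ∈ K, 1 ≤ C * sqrtDet (inChart h e) y := by
    intro y hy
    have h1 : (sqrtDet (inChart h e) y)⁻¹ ≤ C := (le_abs_self _).trans ((hC₂ y hy).trans
      ((le_max_left _ _).trans ((le_max_right _ _).trans (le_max_right _ _))))
    rwa [inv_le_iff_one_le_mul₀ (hpos y (hKt hy))] at h1
  have hb3 : ∀ y ∈ K, ‖inChart h e y‖ ≤ C := fun y hy => (hC₃ y hy).trans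
    ((le_max_right _ _).trans ((le_max_right _ _).trans (le_max_right _ _)))
  refine ⟨C * C, by positivity, fun w hw h0 => ?_⟩
  have hwc : ContinuousOn (fun y => w (e.symm y)) e.target :=
    (contDiffOn_comp_chart_symm he hw).continuousOn
  have hz : ∀ y ∈ e.target, y ∉ K → w (e.symm y) = 0 := fun y hy hyK => comp_symm_eq_zero h0 hy hyK
  have hwi : ∫ x, w x ^ 2 ∂(riemannianMeasure h)
      = ∫ y in e.target, sqrtDet (inChart h e) y * w (e.symm y) ^ 2 :=
    hh.integral_of_support he (hw.continuous.pow 2).continuousOn fun x hx => by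
      rw [h0 x fun hxA => hx (hs hxA)]; simp
  have hvi : ∫ y, chartFun e w y ^ 2 = ∫ y in e.target, w (e.symm y) ^ 2 := by
    rw [← integral_indicator e.open_target.measurableSet]
    congr 1; funext y
    by_cases hy : y ∈ e.target <;> simp [chartFun, hy]
  have hi1 : IntegrableOn (fun y => sqrtDet (inChart h e) y * w (e.symm y) ^ 2) e.target :=
    integrableOn_of_compact_support e.open_target hK hKt (hsc.mul (hwc.pow 2)) fun y hy hyK => by
      simp [hz y hy hyK]
  have hi2 : IntegrableOn (fun y => w (e.symm y) ^ 2) e.target :=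
    integrableOn_of_compact_support e.open_target hK hKt (hwc.pow 2) fun y hy hyK => by
      simp [hz y hy hyK]
  refine ⟨?_, ?_, ?_⟩
  · rw [hwi, hvi, ← integral_const_mul]
    refine setIntegral_mono_on hi1 (hi2.const_mul _) e.open_target.measurableSet fun y hy => ?_
    by_cases hyK : y ∈ K
    · have : sqrtDet (inChart h e) y ≤ C * C := (hb1 y hyK).trans (by nlinarith)
      gcongr
    · simp [hz y hy hyK]
  · rw [hwi, hvi, ← integral_const_mul]
    refine setIntegral_mono_on hi2 (hi1.const_mul _) e.open_target.measurableSet fun y hy => ?_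
    by_cases hyK : y ∈ K
    · have h1 : 1 ≤ C * C * sqrtDet (inChart h e) y := by nlinarith [hb2 y hyK, hpos y hy]
      rw [← mul_assoc]
      exact le_mul_of_one_le_left (sq_nonneg _) h1
    · simp [hz y hy hyK]
  · have hdz : ∀ x ∉ A, dForm (m := m) w x = 0 := by
      intro x hx
      have : w =ᶠ[𝓝 x] fun _ => (0 : ℝ) := by
        filter_upwards [hAc.isOpen_compl.mem_nhds hx] with z hz using h0 z hz
      unfold dForm
      rw [this.mfderiv_eq, mfderiv_const]
      rfl
    have hfz : ∀ x ∉ A, formInner h (dForm w) (dForm w) x = 0 := fun x hx => by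
      simp [formInner, hdz x hx]
    have hfc := (hh.contMDiff_formInner (smoothForm_dForm hw) (smoothForm_dForm hw)).continuous
    have hfi : ∫ x, formInner h (dForm w) (dForm w) x ∂(riemannianMeasure h)
        = ∫ y in e.target, sqrtDet (inChart h e) y * formInner h (dForm w) (dForm w) (e.symm y) :=
      hh.integral_of_support he hfc.continuousOn fun x hx => hfz x fun hxA => hx (hs hxA)
    have hdi : ∫ y, ‖fderiv ℝ (chartFun e w) y‖ ^ 2
        = ∫ y in e.target, ‖formInChart (dForm w) e y‖ ^ 2 := by
      rw [← integral_indicator e.open_target.measurableSet]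
      congr 1; funext y
      by_cases hy : y ∈ e.target
      · rw [indicator_of_mem hy, fderiv_chartFun he hw hy]
      · rw [indicator_of_notMem hy]
        have : chartFun e w =ᶠ[𝓝 y] 0 := indicator_eventuallyEq_zero hK.isClosed hz
          fun hyK => hy (hKt hyK)
        rw [this.fderiv_eq]
        simp
    have hzf : ∀ y ∈ e.target, y ∉ K → formInChart (dForm w) e y = 0 := by
      intro y hy hyK
      rw [formInChart, hdz _ fun hA => hyK ⟨_, hA, e.right_inv hy⟩]
      simp
    rw [hfi, hdi, ← integral_const_mul]
    refine setIntegral_mono_on ?_ (Integrable.const_mul ?_ _) e.open_target.measurableSet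
      fun y hy => ?_
    · exact integrableOn_of_compact_support e.open_target hK hKt
        ((smoothForm_dForm hw e he).continuousOn.norm.pow 2) fun y hy hyK => by simp [hzf y hy hyK]
    · exact integrableOn_of_compact_support e.open_target hK hKt
        (hsc.mul (hh.contDiffOn_formInner (smoothForm_dForm hw) (smoothForm_dForm hw)
          he).continuousOn) fun y hy hyK => by
          rw [hfz _ fun hA => hyK ⟨_, hA, e.right_inv hy⟩, mul_zero]
    · rw [hh.formInner_chart he hy]
      by_cases hyK : y ∈ K
      · set a := formInChart (dForm w) e y
        have h1 := (hg.inner y hy).norm_sq_le a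
        have h2 : 0 ≤ a ((inChart h e y).inverse a) := by
          have := hh.formInner_self_nonneg (α := dForm w) (e.symm y)
          rwa [hh.formInner_chart he hy] at this
        calc ‖a‖ ^ 2 ≤ ‖inChart h e y‖ * a ((inChart h e y).inverse a) := h1
          _ ≤ C * a ((inChart h e y).inverse a) := by gcongr; exact hb3 y hyK
          _ ≤ (C * sqrtDet (inChart h e) y) * (C * a ((inChart h e y).inverse a)) :=
              le_mul_of_one_le_left (by positivity) (hb2 y hyK)
          _ = _ := by ring
      · simp [hzf y hy hyK]

/-- Positivity of the form on `α - β`. -/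
lemma SmoothMetric.formInner_add_self_le (hh : SmoothMetric h) (x : N) :
    formInner h (fun x => α x + β x) (fun x => α x + β x) x
      ≤ 2 * formInner h α α x + 2 * formInner h β β x := by
  have h1 := hh.formInner_self_nonneg (α := fun x => α x - β x) x
  have h2 := hh.formInner_comm (α := α) (β := β) x
  simp only [formInner, map_add, map_sub, add_apply, sub_apply] at h1 h2 ⊢
  linarith

/-- The square of the Sobolev norm. -/
def sobolev (h : ∀ x : N, TangentSpace (𝓡 m) x →L[ℝ] TangentSpace (𝓡 m) x →L[ℝ] ℝ)
    (u : N → ℝ) : ℝ :=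
  ∫ x, u x ^ 2 ∂(riemannianMeasure h)
    + ∫ x, formInner h (dForm u) (dForm u) x ∂(riemannianMeasure h)

lemma SmoothMetric.integral_formInner_nonneg (hh : SmoothMetric h) :
    0 ≤ ∫ x, formInner h α α x ∂(riemannianMeasure h) :=
  integral_nonneg fun x => hh.formInner_self_nonneg x

lemma SmoothMetric.sobolev_nonneg (hh : SmoothMetric h) : 0 ≤ sobolev h u :=
  add_nonneg (integral_nonneg fun _ => sq_nonneg _) hh.integral_formInner_nonneg

lemma SmoothMetric.integral_sq_le_sobolev (hh : SmoothMetric h) :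
    ∫ x, u x ^ 2 ∂(riemannianMeasure h) ≤ sobolev h u :=
  le_add_of_nonneg_right hh.integral_formInner_nonneg

lemma SmoothMetric.integrable_formInner (hh : SmoothMetric h)
    (hu : ContMDiff (𝓡 m) 𝓘(ℝ, ℝ) ∞ u) (hv : ContMDiff (𝓡 m) 𝓘(ℝ, ℝ) ∞ v) :
    Integrable (formInner h (dForm u) (dForm v)) (riemannianMeasure h) :=
  hh.integrable (hh.contMDiff_formInner (smoothForm_dForm hu) (smoothForm_dForm hv)).continuous

lemma SmoothMetric.sobolev_sub_le (hh : SmoothMetric h) (hu : ContMDiff (𝓡 m) 𝓘(ℝ, ℝ) ∞ u)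
    (hv : ContMDiff (𝓡 m) 𝓘(ℝ, ℝ) ∞ v) :
    sobolev h (fun x => u x - v x) ≤ 2 * sobolev h u + 2 * sobolev h v := by
  have hui : Integrable (fun x => 2 * u x ^ 2) (riemannianMeasure h) :=
    (hh.integrable (hu.continuous.pow 2)).const_mul 2
  have hvi : Integrable (fun x => 2 * v x ^ 2) (riemannianMeasure h) :=
    (hh.integrable (hv.continuous.pow 2)).const_mul 2
  have hdu := (hh.integrable_formInner hu hu).const_mul 2
  have hdv := (hh.integrable_formInner hv hv).const_mul 2
  have hsub := hu.sub hv
  have h1 : ∫ x, (u x - v x) ^ 2 ∂(riemannianMeasure h)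
      ≤ 2 * ∫ x, u x ^ 2 ∂(riemannianMeasure h) + 2 * ∫ x, v x ^ 2 ∂(riemannianMeasure h) := by
    rw [← integral_const_mul, ← integral_const_mul, ← integral_add hui hvi]
    refine integral_mono (hh.integrable ((hu.continuous.sub hv.continuous).pow 2)) (hui.add hvi)
      fun x => ?_
    have := sq_nonneg (u x + v x)
    simp only
    nlinarith
  have h2 : ∫ x, formInner h (dForm fun x => u x - v x) (dForm fun x => u x - v x) x
        ∂(riemannianMeasure h)
      ≤ 2 * ∫ x, formInner h (dForm u) (dForm u) x ∂(riemannianMeasure h)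
        + 2 * ∫ x, formInner h (dForm v) (dForm v) x ∂(riemannianMeasure h) := by
    rw [← integral_const_mul, ← integral_const_mul, ← integral_add hdu hdv]
    refine integral_mono (hh.integrable_formInner hsub hsub) (hdu.add hdv) fun x => ?_
    have h3 := hh.formInner_add_self_le (α := dForm u) (β := fun x => -dForm v x) x
    have h4 : dForm (m := m) (fun x => u x - v x) x = dForm u x + -dForm v x := by
      rw [← sub_eq_add_neg]
      exact mfderiv_sub ((hu.mdifferentiable (by simp)) x) ((hv.mdifferentiable (by simp)) x)
    simp only [formInner, map_neg, neg_apply, neg_neg] at h3 ⊢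
    rw [h4]
    simpa using h3
  unfold sobolev
  linarith

/-- Since `d(ρu) = ρ du + u dρ` with `ρ²` and `|dρ|²` bounded on the compact manifold,
multiplication by a cutoff is bounded in the Sobolev norm. -/
lemma SmoothMetric.exists_formInner_mul_le (hh : SmoothMetric h)
    (hρ : ContMDiff (𝓡 m) 𝓘(ℝ, ℝ) ∞ ρ) :
    ∃ C : ℝ, 0 < C ∧ ∀ u : N → ℝ, ContMDiff (𝓡 m) 𝓘(ℝ, ℝ) ∞ u →
      ∫ x, (ρ x * u x) ^ 2 ∂(riemannianMeasure h) ≤ C * sobolev h u ∧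
      ∫ x, formInner h (dForm fun x => ρ x * u x) (dForm fun x => ρ x * u x) x
        ∂(riemannianMeasure h) ≤ C * sobolev h u := by
  obtain ⟨C₁, hC₁⟩ := isCompact_univ.exists_bound_of_continuousOn
    (hρ.continuous.pow 2).continuousOn
  obtain ⟨C₂, hC₂⟩ := isCompact_univ.exists_bound_of_continuousOn
    (hh.contMDiff_formInner (smoothForm_dForm hρ) (smoothForm_dForm hρ)).continuous.continuousOn
  set C := max 1 (max C₁ C₂)
  have hC : 0 < C := lt_max_of_lt_left one_pos
  have hb1 : ∀ x, ρ x ^ 2 ≤ C := fun x =>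
    (le_abs_self _).trans ((hC₁ x (mem_univ x)).trans ((le_max_left _ _).trans (le_max_right _ _)))
  have hb2 : ∀ x, formInner h (dForm ρ) (dForm ρ) x ≤ C := fun x =>
    (le_abs_self _).trans ((hC₂ x (mem_univ x)).trans ((le_max_right _ _).trans (le_max_right _ _)))
  refine ⟨2 * C, by positivity, fun u hu => ⟨?_, ?_⟩⟩
  · have h1 : ∫ x, (ρ x * u x) ^ 2 ∂(riemannianMeasure h)
        ≤ C * ∫ x, u x ^ 2 ∂(riemannianMeasure h) := by
      rw [← integral_const_mul]
      refine integral_mono (hh.integrable ((hρ.continuous.mul hu.continuous).pow 2))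
        ((hh.integrable (hu.continuous.pow 2)).const_mul _) fun x => ?_
      simp only [mul_pow]
      exact mul_le_mul_of_nonneg_right (hb1 x) (sq_nonneg _)
    have h2 := hh.integral_sq_le_sobolev (u := u)
    have h3 := hh.sobolev_nonneg (u := u)
    nlinarith
  · have hdu := (hh.integrable_formInner hu hu).const_mul (2 * C)
    have hui : Integrable (fun x => 2 * C * u x ^ 2) (riemannianMeasure h) :=
      (hh.integrable (hu.continuous.pow 2)).const_mul _
    rw [sobolev, mul_add, ← integral_const_mul, ← integral_const_mul, ← integral_add hui hdu]
    refine integral_mono (hh.integrable_formInner (hρ.mul hu) (hρ.mul hu)) (hui.add hdu) fun x => ?_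
    have h3 := hh.formInner_add_self_le (α := fun x => ρ x • dForm u x)
      (β := fun x => u x • dForm ρ x) x
    have h4 := hb1 x
    have h5 := hb2 x
    have h6 := hh.formInner_self_nonneg (α := dForm u) x
    have h7 := sq_nonneg (u x)
    simp only [formInner, map_smul, smul_apply, smul_eq_mul] at h3 h5 h6 ⊢
    rw [dForm_mul hρ hu]
    refine h3.trans ?_
    nlinarith [mul_le_mul_of_nonneg_right h4 h6, mul_le_mul_of_nonneg_right h5 h7]

end SobolevManifold

/-! ### Rellich's theorem on a compact manifold. -/

section RellichManifold

universe uN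

variable {m : ℕ} {N : Type uN} [TopologicalSpace N] [ChartedSpace (Euc m) N]
  [IsManifold (𝓡 m) ∞ N] {e : OpenPartialHomeomorph N (Euc m)}
  {h : ∀ x : N, TangentSpace (𝓡 m) x →L[ℝ] TangentSpace (𝓡 m) x →L[ℝ] ℝ}
  {u v w ρ : N → ℝ} [MeasurableSpace N] [BorelSpace N] [CompactSpace N] [T2Space N]

/-- The integral of `ρ u` over a coordinate cube. -/
def cubeIntegral (e : OpenPartialHomeomorph N (Euc m)) (ρ : N → ℝ) (δ : ℝ) (k : Fin m → ℤ)
    (u : N → ℝ) : ℝ :=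
  ∫ y in cube δ k, chartFun e (fun x => ρ x * u x) y

lemma cubeIntegral_sub (he : e ∈ atlas (Euc m) N) (hρ : ContMDiff (𝓡 m) 𝓘(ℝ, ℝ) ∞ ρ)
    (hs : tsupport ρ ⊆ e.source) (hu : ContMDiff (𝓡 m) 𝓘(ℝ, ℝ) ∞ u)
    (hv : ContMDiff (𝓡 m) 𝓘(ℝ, ℝ) ∞ v) (δ : ℝ) (k : Fin m → ℤ) :
    cubeIntegral e ρ δ k (fun x => u x - v x) = cubeIntegral e ρ δ k u - cubeIntegral e ρ δ k v := by
  have hA : IsCompact (tsupport ρ) := (isClosed_tsupport ρ).isCompact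
  have hint : ∀ w : N → ℝ, ContMDiff (𝓡 m) 𝓘(ℝ, ℝ) ∞ w →
      Integrable (chartFun e (fun x => ρ x * w x)) := by
    intro w hw
    have h0 : ∀ x ∉ tsupport ρ, ρ x * w x = 0 := fun x hx => by
      rw [image_eq_zero_of_notMem_tsupport hx, zero_mul]
    exact (contDiff_chartFun hA hs he (hρ.mul hw) h0).continuous.integrable_of_hasCompactSupport
      (HasCompactSupport.intro (isCompact_image_chart hA hs) fun y hy => chartFun_eq_zero h0 hy)
  rw [cubeIntegral, cubeIntegral, cubeIntegral,
    ← integral_sub (hint u hu).integrableOn (hint v hv).integrableOn]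
  congr 1; funext y
  by_cases hy : y ∈ e.target
  · simp [chartFun, hy]; ring
  · simp [chartFun, hy]

/-- Transfers `exists_cubes_integral_sq_le` to the manifold. The error `ε / (C₁ * C₁ * C₂)` pays for
the chart comparison twice, for the function and for its gradient, and once for the cutoff. -/
lemma SmoothMetric.exists_cubes (hh : SmoothMetric h) (he : e ∈ atlas (Euc m) N)
    (hρ : ContMDiff (𝓡 m) 𝓘(ℝ, ℝ) ∞ ρ) (hs : tsupport ρ ⊆ e.source) {ε : ℝ} (hε : 0 < ε) :
    ∃ (t : Finset (Fin m → ℤ)) (δ C : ℝ), 0 < C ∧ ∀ u : N → ℝ, ContMDiff (𝓡 m) 𝓘(ℝ, ℝ) ∞ u →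
      (∀ k ∈ t, cubeIntegral e ρ δ k u ^ 2 ≤ C * sobolev h u) ∧
      ∫ x, (ρ x * u x) ^ 2 ∂(riemannianMeasure h)
        ≤ C * ∑ k ∈ t, cubeIntegral e ρ δ k u ^ 2 + ε * sobolev h u := by
  have hA : IsCompact (tsupport ρ) := (isClosed_tsupport ρ).isCompact
  obtain ⟨C₁, hC₁, hb⟩ := hh.exists_chart_bounds he (isClosed_tsupport ρ) hs
  obtain ⟨C₂, hC₂, hm⟩ := hh.exists_formInner_mul_le hρ
  obtain ⟨t, δ, C₃, _, hC₃, hcube⟩ := exists_cubes_integral_sq_le (isCompact_image_chart hA hs)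
    (ε := ε / (C₁ * C₁ * C₂)) (by positivity)
  have hle₁ : C₁ * C₃ ≤ max (C₁ * C₃) (C₃ * C₁ * C₂) := le_max_left _ _
  have hle₂ : C₃ * C₁ * C₂ ≤ max (C₁ * C₃) (C₃ * C₁ * C₂) := le_max_right _ _
  refine ⟨t, δ, max (C₁ * C₃) (C₃ * C₁ * C₂), by positivity, fun u hu => ?_⟩
  have h0 : ∀ x ∉ tsupport ρ, ρ x * u x = 0 := fun x hx => by
    rw [image_eq_zero_of_notMem_tsupport hx, zero_mul]
  have hw := hρ.mul hu
  obtain ⟨b1, b2, b3⟩ := hb _ hw h0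
  obtain ⟨m1, m2⟩ := hm u hu
  obtain ⟨c1, c2⟩ := hcube _ ((contDiff_chartFun hA hs he hw h0).of_le (by norm_cast))
    fun y hy => chartFun_eq_zero h0 hy
  have hE := hh.sobolev_nonneg (u := u)
  refine ⟨fun k hk => ?_, ?_⟩
  · calc cubeIntegral e ρ δ k u ^ 2 ≤ C₃ * ∫ y, chartFun e (fun x => ρ x * u x) y ^ 2 := c1 k hk
      _ ≤ C₃ * (C₁ * (C₂ * sobolev h u)) := by
        refine mul_le_mul_of_nonneg_left (b2.trans ?_) hC₃.le
        exact mul_le_mul_of_nonneg_left m1 hC₁.le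
      _ = C₃ * C₁ * C₂ * sobolev h u := by ring
      _ ≤ _ := by gcongr
  · have hS : 0 ≤ ∑ k ∈ t, cubeIntegral e ρ δ k u ^ 2 := Finset.sum_nonneg fun k _ => sq_nonneg _
    calc ∫ x, (ρ x * u x) ^ 2 ∂(riemannianMeasure h)
        ≤ C₁ * ∫ y, chartFun e (fun x => ρ x * u x) y ^ 2 := b1
      _ ≤ C₁ * (C₃ * ∑ k ∈ t, cubeIntegral e ρ δ k u ^ 2
            + ε / (C₁ * C₁ * C₂) * (C₁ * (C₂ * sobolev h u))) := by
        refine mul_le_mul_of_nonneg_left (c2.trans ?_) hC₁.le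
        refine add_le_add le_rfl (mul_le_mul_of_nonneg_left (b3.trans ?_) (by positivity))
        exact mul_le_mul_of_nonneg_left m2 hC₁.le
      _ = C₁ * C₃ * ∑ k ∈ t, cubeIntegral e ρ δ k u ^ 2 + ε * sobolev h u := by
        field_simp
      _ ≤ _ := by gcongr

/-- Finitely many linear functionals control a function in the mean, up to a small multiple of its
Sobolev norm. -/
theorem SmoothMetric.exists_functionals (hh : SmoothMetric h) {ε : ℝ} (hε : 0 < ε) :
    ∃ (κ : Type uN) (_ : Fintype κ) (l : κ → (N → ℝ) → ℝ) (C : ℝ), 0 < C ∧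
      (∀ k u v, ContMDiff (𝓡 m) 𝓘(ℝ, ℝ) ∞ u → ContMDiff (𝓡 m) 𝓘(ℝ, ℝ) ∞ v →
        l k (fun x => u x - v x) = l k u - l k v) ∧
      ∀ u : N → ℝ, ContMDiff (𝓡 m) 𝓘(ℝ, ℝ) ∞ u → (∀ k, l k u ^ 2 ≤ C * sobolev h u) ∧
        ∫ x, u x ^ 2 ∂(riemannianMeasure h) ≤ C * ∑ k, l k u ^ 2 + ε * sobolev h u := by
  obtain ⟨t, ρ, hρ, hsub, hsum⟩ := exists_finite_partition m N
  set n : ℝ := (t.card : ℝ) with hn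
  have hn0 : 0 ≤ n := Nat.cast_nonneg _
  -- With `n` members of the partition, squaring the sum costs a factor `n` and adding the errors
  -- another; the `+ 1` covers `n = 0`.
  choose s δ C hC hcube using fun i => hh.exists_cubes (chart_mem_atlas (Euc m) i) (hρ i) (hsub i)
    (ε := ε / (n * n + 1)) (by positivity)
  set Ct : ℝ := (n + 1) * (1 + ∑ i ∈ t, C i) with hCt
  have hS0 : 0 ≤ ∑ i ∈ t, C i := Finset.sum_nonneg fun i _ => (hC i).le
  have hCi : ∀ i ∈ t, C i ≤ 1 + ∑ i ∈ t, C i := fun i hi =>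
    (Finset.single_le_sum (f := C) (fun j _ => (hC j).le) hi).trans (by linarith)
  refine ⟨(i : t) × s i, inferInstance,
    fun k => cubeIntegral (chartAt (Euc m) (k.1 : N)) (ρ k.1) (δ k.1) k.2, Ct, by positivity,
    fun k u v hu hv => cubeIntegral_sub (chart_mem_atlas _ _) (hρ _) (hsub _) hu hv _ _,
    fun u hu => ⟨?_, ?_⟩⟩
  · have hE := hh.sobolev_nonneg (u := u)
    rintro ⟨⟨i, hi⟩, ⟨k, hk⟩⟩
    refine ((hcube i u hu).1 k hk).trans ?_
    gcongr
    refine (hCi i hi).trans ?_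
    exact le_mul_of_one_le_left (by positivity) (by linarith)
  · have hE := hh.sobolev_nonneg (u := u)
    have h1 : ∫ x, u x ^ 2 ∂(riemannianMeasure h)
        ≤ n * ∑ i ∈ t, ∫ x, (ρ i x * u x) ^ 2 ∂(riemannianMeasure h) := by
      have hint : ∀ i ∈ t, Integrable (fun x => (ρ i x * u x) ^ 2) (riemannianMeasure h) :=
        fun i _ => hh.integrable (((hρ i).continuous.mul hu.continuous).pow 2)
      rw [← integral_finsetSum t hint, ← integral_const_mul]
      refine integral_mono (hh.integrable (hu.continuous.pow 2))
        ((integrable_finsetSum t hint).const_mul _) fun x => ?_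
      have : u x = ∑ i ∈ t, ρ i x * u x := by rw [← Finset.sum_mul, hsum, one_mul]
      simp only
      nth_rw 1 [this]
      exact sq_sum_le_card_mul_sum_sq
    set S : N → ℝ := fun i =>
      ∑ k ∈ s i, cubeIntegral (chartAt (Euc m) i) (ρ i) (δ i) k u ^ 2 with hS
    have hSnn : ∀ i, 0 ≤ S i := fun i => Finset.sum_nonneg fun k _ => sq_nonneg _
    have h2 : ∑ i ∈ t, ∫ x, (ρ i x * u x) ^ 2 ∂(riemannianMeasure h)
        ≤ (1 + ∑ i ∈ t, C i) * ∑ i ∈ t, S i + n * (ε / (n * n + 1) * sobolev h u) := by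
      have : n * (ε / (n * n + 1) * sobolev h u) = ∑ i ∈ t, ε / (n * n + 1) * sobolev h u := by
        simp [hn]
      rw [this, Finset.mul_sum, ← Finset.sum_add_distrib]
      refine Finset.sum_le_sum fun i hi => ((hcube i u hu).2).trans ?_
      refine add_le_add (mul_le_mul_of_nonneg_right (hCi i hi) (hSnn i)) le_rfl
    have h3 : ∑ k : (i : t) × s i,
        cubeIntegral (chartAt (Euc m) (k.1 : N)) (ρ k.1) (δ k.1) k.2 u ^ 2 = ∑ i ∈ t, S i := by
      rw [Fintype.sum_sigma, ← Finset.sum_coe_sort t S]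
      refine Finset.sum_congr rfl fun i _ => ?_
      exact Finset.sum_coe_sort (s i)
        (fun k => cubeIntegral (chartAt (Euc m) (i : N)) (ρ i) (δ i) k u ^ 2)
    rw [h3]
    have hSt : 0 ≤ ∑ i ∈ t, S i := Finset.sum_nonneg fun i _ => hSnn i
    have h4 : n * n * (ε / (n * n + 1)) ≤ ε := by
      rw [mul_div_assoc', div_le_iff₀ (by positivity)]; nlinarith
    calc ∫ x, u x ^ 2 ∂(riemannianMeasure h)
        ≤ n * ((1 + ∑ i ∈ t, C i) * ∑ i ∈ t, S i + n * (ε / (n * n + 1) * sobolev h u)) :=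
          h1.trans (mul_le_mul_of_nonneg_left h2 hn0)
      _ = n * (1 + ∑ i ∈ t, C i) * ∑ i ∈ t, S i + n * n * (ε / (n * n + 1)) * sobolev h u := by ring
      _ ≤ _ := by
        refine add_le_add (mul_le_mul_of_nonneg_right ?_ hSt) (mul_le_mul_of_nonneg_right h4 hE)
        rw [hCt]
        gcongr
        linarith

/-! ### The spectrum of the Laplace operator -/

lemma SmoothMetric.memLp (hh : SmoothMetric h) (hu : Continuous u) :
    MemLp u 2 (riemannianMeasure h) :=
  have := hh.isFiniteMeasure
  hu.memLp_of_hasCompactSupport (HasCompactSupport.of_compactSpace _)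

open scoped InnerProductSpace

lemma inner_toLp {μ : Measure N} (U : Lp ℝ 2 μ) (hv : MemLp v 2 μ) :
    ⟪U, hv.toLp v⟫_ℝ = ∫ x, U x * v x ∂μ := by
  rw [L2.inner_def]
  refine integral_congr_ae ?_
  filter_upwards [hv.coeFn_toLp] with x hx
  rw [hx]
  simp [mul_comm]

lemma inner_toLp_toLp {μ : Measure N} (hu : MemLp u 2 μ) (hv : MemLp v 2 μ) :
    ⟪hu.toLp u, hv.toLp v⟫_ℝ = ∫ x, u x * v x ∂μ := by
  rw [inner_toLp]
  refine integral_congr_ae ?_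
  filter_upwards [hu.coeFn_toLp] with x hx
  rw [hx]

/-- Spectral gap: `λ ∫ |du|² ≤ ∫ (Δu)²` if there is no eigenvalue between `0` and `λ`. -/
theorem SmoothMetric.spectral_gap (hh : SmoothMetric h) {lam : ℝ} (hlam : IsFirstEigenvalue h lam)
    (hu : ContMDiff (𝓡 m) 𝓘(ℝ, ℝ) ∞ u) :
    lam * ∫ x, formInner h (dForm u) (dForm u) x ∂(riemannianMeasure h)
        ≤ ∫ x, laplacian h u x ^ 2 ∂(riemannianMeasure h) ∧
      (lam * ∫ x, formInner h (dForm u) (dForm u) x ∂(riemannianMeasure h)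
          = ∫ x, laplacian h u x ^ 2 ∂(riemannianMeasure h) →
        ∀ v : N → ℝ, ContMDiff (𝓡 m) 𝓘(ℝ, ℝ) ∞ v →
          ∫ x, laplacian h u x * laplacian h v x ∂(riemannianMeasure h)
            = -(lam * ∫ x, laplacian h u x * v x ∂(riemannianMeasure h))) := by
  set μ := riemannianMeasure h with hμ
  -- The domain is the space of smooth functions; the Sobolev space appears only as its abstract
  -- completion.
  let D : Submodule ℝ (N → ℝ) :=
    { carrier := {u | ContMDiff (𝓡 m) 𝓘(ℝ, ℝ) ∞ u}
      add_mem' := fun ha hb => ContMDiff.add ha hb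
      zero_mem' := contMDiff_const
      smul_mem' := fun c _ hu => contMDiff_const.mul hu }
  have hDL : ∀ u : D, MemLp (u : N → ℝ) 2 μ := fun u => hh.memLp u.2.continuous
  let i : D →ₗ[ℝ] Lp ℝ 2 μ :=
    { toFun := fun u => (hDL u).toLp u
      map_add' := fun u v => MemLp.toLp_add (hDL u) (hDL v)
      map_smul' := fun c u => MemLp.toLp_const_smul c (hDL u) }
  have haL : ∀ u : D, MemLp (fun x => -laplacian h (u : N → ℝ) x) 2 μ := fun u =>
    hh.memLp (hh.contMDiff_laplacian u.2).continuous.neg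
  let a : D → Lp ℝ 2 μ := fun u => (haL u).toLp _
  have hia : ∀ u v : D, ⟪i u, a v⟫_ℝ = -∫ x, (u : N → ℝ) x * laplacian h v x ∂μ := by
    intro u v
    refine (inner_toLp_toLp (hDL u) (haL v)).trans ?_
    simp only [mul_neg, integral_neg]
  have hia2 : ∀ u v : D, ⟪i u, a v⟫_ℝ = ∫ x, formInner h (dForm u) (dForm v) x ∂μ := by
    intro u v
    rw [hia, hh.integral_mul_laplacian u.2 v.2, neg_neg]
  have hin : ∀ u : D, ‖i u‖ ^ 2 = ∫ x, (u : N → ℝ) x ^ 2 ∂μ := by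
    intro u
    rw [← real_inner_self_eq_norm_sq]
    refine (inner_toLp_toLp (hDL u) (hDL u)).trans ?_
    simp only [sq]
  have haa : ∀ u v : D, ⟪a u, a v⟫_ℝ = ∫ x, laplacian h u x * laplacian h v x ∂μ := by
    intro u v
    refine (inner_toLp_toLp (haL u) (haL v)).trans ?_
    simp only [neg_mul_neg]
  have hai : ∀ u v : D, ⟪a u, i v⟫_ℝ = -∫ x, laplacian h u x * (v : N → ℝ) x ∂μ := by
    intro u v
    refine (inner_toLp_toLp (haL u) (hDL v)).trans ?_
    simp only [neg_mul, integral_neg]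
  have hbdd : TotallyBounded (i '' {u | ‖i u‖ ^ 2 + ⟪i u, a u⟫_ℝ ≤ 1}) := by
    have hsob : ∀ u : D, ‖i u‖ ^ 2 + ⟪i u, a u⟫_ℝ = sobolev h u := fun u => by
      rw [hin, hia2]; rfl
    simp only [hsob]
    refine totallyBounded_image_of_discretization fun ε hε => ?_
    -- For `u, v` in the form ball the Sobolev square of `u - v` is at most `4`, so this error
    -- contributes at most `ε²/4`, and the functionals contribute as much again.
    obtain ⟨κ, _, l, C, hC, hlin, hl⟩ := hh.exists_functionals (ε := ε ^ 2 / 16) (by positivity)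
    obtain ⟨δ, hδ, hδε⟩ : ∃ δ : ℝ, 0 < δ ∧ C * (Fintype.card κ * δ ^ 2) ≤ ε ^ 2 / 4 := by
      have hlim : Filter.Tendsto (fun δ : ℝ => C * (Fintype.card κ * δ ^ 2)) (𝓝[>] 0) (𝓝 0) := by
        have : Continuous (fun δ : ℝ => C * (Fintype.card κ * δ ^ 2)) := by fun_prop
        simpa using (this.tendsto 0).mono_left nhdsWithin_le_nhds
      obtain ⟨δ, h1, h2⟩ :=
        ((hlim.eventually_le_const (by positivity : 0 < ε ^ 2 / 4)).and self_mem_nhdsWithin).exists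
      exact ⟨δ, h2, h1⟩
    refine ⟨κ, inferInstance, fun u k => l k u, δ, hδ, ?_, fun u hu v hv hd => ?_⟩
    · refine (isBounded_iff_forall_norm_le.2 ⟨√C, ?_⟩)
      rintro _ ⟨u, hu, rfl⟩
      refine (pi_norm_le_iff_of_nonneg (Real.sqrt_nonneg _)).2 fun k => ?_
      refine Real.abs_le_sqrt (((hl u u.2).1 k).trans ?_)
      have : sobolev h (u : N → ℝ) ≤ 1 := hu
      nlinarith
    · have hu1 : sobolev h (u : N → ℝ) ≤ 1 := hu
      have hv1 : sobolev h (v : N → ℝ) ≤ 1 := hv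
      have h1 := ((hl _ (u - v : D).2).2)
      have h2 : sobolev h ((u - v : D) : N → ℝ) ≤ 4 :=
        (hh.sobolev_sub_le u.2 v.2).trans (by linarith)
      have h3 : ∑ k, l k ((u - v : D) : N → ℝ) ^ 2 ≤ Fintype.card κ * δ ^ 2 := by
        have : ∀ k ∈ Finset.univ, l k ((u - v : D) : N → ℝ) ^ 2 ≤ δ ^ 2 := by
          intro k _
          have h4 : l k ((u - v : D) : N → ℝ) = l k u - l k v := hlin k _ _ u.2 v.2
          have h5 := (dist_le_pi_dist (fun k => l k u) (fun k => l k v) k).trans hd.le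
          rw [h4, ← sq_abs]
          rw [Real.dist_eq] at h5
          gcongr
        refine (Finset.sum_le_sum this).trans (le_of_eq ?_)
        simp
      rw [dist_eq_norm, ← map_sub]
      refine lt_of_pow_lt_pow_left₀ 2 hε.le ?_
      rw [hin]
      have h6 : C * ∑ k, l k ((u - v : D) : N → ℝ) ^ 2 ≤ ε ^ 2 / 4 :=
        (mul_le_mul_of_nonneg_left h3 hC.le).trans hδε
      nlinarith [pow_pos hε 2]
  have hmain := LagVar.spectral_gap (i := i) (a := a)
    (fun u v => by rw [hia, hai, hh.integral_laplacian_comm u.2 v.2])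
    (fun u => by rw [hia2]; exact hh.integral_formInner_nonneg) hbdd hlam.1.1
    (fun r hr U hU hv => by
      -- Since `eigenspace` is defined weakly in `L²`, the abstract eigenvector belongs to it
      -- without any regularity theory.
      refine hlam.2 ⟨hr, U, ⟨Lp.memLp U, fun v hvs => ?_⟩, fun h0 => hU (Lp.eq_zero_iff_ae_eq_zero.2 h0)⟩
      have h1 := hv ⟨v, hvs⟩
      have h2 : ⟪U, a ⟨v, hvs⟩⟫_ℝ = ∫ x, U x * -laplacian h v x ∂μ := inner_toLp U (haL ⟨v, hvs⟩)
      have h3 : ⟪U, i ⟨v, hvs⟩⟫_ℝ = ∫ x, U x * v x ∂μ := inner_toLp U (hDL ⟨v, hvs⟩)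
      rw [h2, h3] at h1
      simpa only [mul_neg, integral_neg] using h1) ⟨u, hu⟩
  have hnorm : ‖a ⟨u, hu⟩‖ ^ 2 = ∫ x, laplacian h u x ^ 2 ∂μ := by
    rw [← real_inner_self_eq_norm_sq, haa]
    simp only [sq]
  rw [hia2, hnorm] at hmain
  refine ⟨hmain.1, fun heq v hv => ?_⟩
  have := hmain.2 heq ⟨v, hv⟩
  rw [haa, hai] at this
  rw [this, mul_neg]

end RellichManifold

/-! ### The equality case of the spectral gap. -/

section FirstEigenspace

variable {m : ℕ} {N : Type*} [TopologicalSpace N] [ChartedSpace (Euc m) N]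
  [IsManifold (𝓡 m) ∞ N]
  {h : ∀ x : N, TangentSpace (𝓡 m) x →L[ℝ] TangentSpace (𝓡 m) x →L[ℝ] ℝ}
  {u v p : N → ℝ}

/-- A function with vanishing differential on a connected manifold is constant. -/
theorem apply_eq_of_dForm_eq_zero [PreconnectedSpace N] (hp : ContMDiff (𝓡 m) 𝓘(ℝ, ℝ) ∞ p)
    (h0 : ∀ x, dForm (m := m) p x = 0) (x y : N) : p x = p y := by
  have hloc : IsLocallyConstant p := by
    rw [IsLocallyConstant.iff_eventually_eq]
    intro x
    set e := chartAt (Euc m) x with hedef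
    have he : e ∈ atlas (Euc m) N := chart_mem_atlas _ x
    have hx : x ∈ e.source := mem_chart_source _ x
    obtain ⟨r, hr, hball⟩ := Metric.isOpen_iff.1 e.open_target (e x) (e.map_source hx)
    have hconst : ∀ z ∈ Metric.ball (e x) r, p (e.symm z) = p (e.symm (e x)) := by
      intro z hz
      refine Metric.isOpen_ball.is_const_of_fderiv_eq_zero (𝕜 := ℝ) (convex_ball _ _).isPreconnected
        (f := fun y => p (e.symm y))
        (((contDiffOn_comp_chart_symm he hp).differentiableOn (by simp)).mono hball) ?_ hz
        (Metric.mem_ball_self hr)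
      intro w hw
      rw [← formInChart_dForm he (hball hw) hp, formInChart, h0]
      simp
    have hev : ∀ᶠ z in 𝓝 x, z ∈ e.source ∧ e z ∈ Metric.ball (e x) r :=
      Filter.Eventually.and (e.open_source.mem_nhds hx)
        ((e.continuousAt hx).eventually_mem (Metric.ball_mem_nhds _ hr))
    filter_upwards [hev] with z hz
    have := hconst _ hz.2
    rwa [e.left_inv hz.1, e.left_inv hx] at this
  exact hloc.apply_eq_of_preconnectedSpace x y

variable [MeasurableSpace N] [BorelSpace N] [CompactSpace N] [T2Space N]

lemma SmoothMetric.integral_laplacian (hh : SmoothMetric h) (hu : ContMDiff (𝓡 m) 𝓘(ℝ, ℝ) ∞ u) :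
    ∫ x, laplacian h u x ∂(riemannianMeasure h) = 0 := by
  have h1 := hh.integral_mul_laplacian (u := fun _ => (1 : ℝ)) contMDiff_const hu
  simpa [formInner, dForm_const] using h1

lemma SmoothMetric.dForm_eq_zero_of_integral (hh : SmoothMetric h)
    (hu : ContMDiff (𝓡 m) 𝓘(ℝ, ℝ) ∞ u)
    (h0 : ∫ x, formInner h (dForm u) (dForm u) x ∂(riemannianMeasure h) = 0) (x : N) :
    dForm (m := m) u x = 0 := by
  have := hh.isOpenPosMeasure
  have hc := (hh.contMDiff_formInner (smoothForm_dForm hu) (smoothForm_dForm hu)).continuous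
  have h1 := (integral_eq_zero_iff_of_nonneg (fun x => hh.formInner_self_nonneg x)
    (hh.integrable_formInner hu hu)).1 h0
  have h2 := (hc.ae_eq_iff_eq _ continuous_const).1 (show _ =ᵐ[_] fun _ => (0 : ℝ) from h1)
  exact hh.eq_zero_of_formInner_self (congrFun h2 x)

lemma SmoothMetric.real_univ_pos [Nonempty N] (hh : SmoothMetric h) :
    0 < (riemannianMeasure h).real univ := by
  have := hh.isOpenPosMeasure
  have := hh.isFiniteMeasure
  exact ENNReal.toReal_pos (isOpen_univ.measure_pos _ univ_nonempty).ne' (measure_ne_top _ _)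

/-- The equality case of the spectral gap: a function with mean zero attains it if and only if it
is a first eigenfunction. -/
theorem SmoothMetric.mem_eigenspace_iff [ConnectedSpace N] (hh : SmoothMetric h) {lam : ℝ}
    (hlam : IsFirstEigenvalue h lam) (hu : ContMDiff (𝓡 m) 𝓘(ℝ, ℝ) ∞ u)
    (hmean : ∫ x, u x ∂(riemannianMeasure h) = 0) :
    u ∈ eigenspace h lam ↔
      ∫ x, laplacian h u x ^ 2 ∂(riemannianMeasure h)
        - lam * ∫ x, formInner h (dForm u) (dForm u) x ∂(riemannianMeasure h) = 0 := by
  set μ := riemannianMeasure h with hμ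
  have hL := hh.contMDiff_laplacian hu
  constructor
  · rintro ⟨_, hE⟩
    -- The weak equation is tested with `Δu` itself.
    have h1 := hE _ hL
    have h2 := hh.integral_laplacian_comm hu hL
    have h3 := hh.integral_mul_laplacian hu hu
    rw [h2, h3] at h1
    simp only [sq]
    linarith
  · intro h0
    have hgap := (hh.spectral_gap hlam hu).2 (by linarith)
    -- Equality gives `∫ p Δv = 0` for all smooth `v`. Taking `v = p` kills the Dirichlet integral,
    -- so `p` is constant by connectedness, and both summands have mean zero.
    set p : N → ℝ := fun x => laplacian h u x + lam * u x with hp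
    have hps : ContMDiff (𝓡 m) 𝓘(ℝ, ℝ) ∞ p := hL.add (contMDiff_const.mul hu)
    have hpv : ∀ v : N → ℝ, ContMDiff (𝓡 m) 𝓘(ℝ, ℝ) ∞ v → ∫ x, p x * laplacian h v x ∂μ = 0 := by
      intro v hv
      have hLv := hh.contMDiff_laplacian hv
      have h1 : ∀ x, p x * laplacian h v x
          = laplacian h u x * laplacian h v x + lam * (u x * laplacian h v x) := fun x => by
        simp only [hp]; ring
      simp only [h1]
      have i1 : Integrable (fun x => laplacian h u x * laplacian h v x) μ :=
        hh.integrable (hL.continuous.mul hLv.continuous)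
      have i2 : Integrable (fun x => u x * laplacian h v x) μ :=
        hh.integrable (hu.continuous.mul hLv.continuous)
      rw [integral_add i1 (i2.const_mul _), integral_const_mul, hgap v hv,
        hh.integral_laplacian_comm hu hv]
      ring
    have hdp : ∀ x, dForm (m := m) p x = 0 := by
      refine hh.dForm_eq_zero_of_integral hps ?_
      have := hpv p hps
      rw [hh.integral_mul_laplacian hps hps] at this
      linarith
    have hpc : ∀ x, p x = 0 := by
      intro x
      have hc : ∀ y, p y = p x := fun y => apply_eq_of_dForm_eq_zero hps hdp y x
      have h1 : ∫ y, p y ∂μ = 0 := by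
        rw [hp, integral_add (hh.integrable hL.continuous)
          ((hh.integrable hu.continuous).const_mul _), integral_const_mul,
          hh.integral_laplacian hu, hmean]
        simp
      simp only [hc, integral_const, smul_eq_mul] at h1
      exact (mul_eq_zero.1 h1).resolve_left hh.real_univ_pos.ne'
    refine ⟨hh.memLp hu.continuous, fun v hv => ?_⟩
    rw [hh.integral_laplacian_comm hu hv]
    have h1 : ∀ x, laplacian h u x = -(lam * u x) := fun x => eq_neg_of_add_eq_zero_left (hpc x)
    simp only [h1, neg_mul, integral_neg, mul_assoc, integral_const_mul, neg_neg]

end FirstEigenspace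

/-! ### Smooth sections in charts -/

section Sections

variable {m : ℕ} {N : Type*} [TopologicalSpace N] [ChartedSpace (Euc m) N]
  [IsManifold (𝓡 m) ∞ N] {e : OpenPartialHomeomorph N (Euc m)}

/-- The derivative of a chart. -/
def chartD (e : OpenPartialHomeomorph N (Euc m)) (x : N) : Euc m →L[ℝ] Euc m :=
  mfderiv (𝓡 m) (𝓡 m) e x

lemma endInChart_apply (J : ∀ x : N, TangentSpace (𝓡 m) x →L[ℝ] TangentSpace (𝓡 m) x)
    (y v : Euc m) : endInChart J e y v = chartD e (e.symm y) (J (e.symm y) (symmD e y v)) := rfl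

lemma symmD_chartD (he : e ∈ atlas (Euc m) N) {x : N} (hx : x ∈ e.source) (v : Euc m) :
    symmD e (e x) (chartD e x v) = v := by
  have := (chart_mdifferentiable he).symm_comp_deriv hx
  exact congrArg (fun A : Euc m →L[ℝ] Euc m => A v) this

lemma chartD_symmD (he : e ∈ atlas (Euc m) N) {y : Euc m} (hy : y ∈ e.target) (v : Euc m) :
    chartD e (e.symm y) (symmD e y v) = v := by
  have := (chart_mdifferentiable he).comp_symm_deriv hy
  exact congrArg (fun A : Euc m →L[ℝ] Euc m => A v) this

/-- The field with constant coordinates `v` is the tangent map of `e.symm` applied to a constant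
section. -/
lemma contMDiffOn_symmD (he : e ∈ atlas (Euc m) N) (v : Euc m) :
    ContMDiffOn (𝓡 m) (𝓡 m).tangent ∞
      (fun y => TotalSpace.mk' (Euc m) (E := fun x : N => TangentSpace (𝓡 m) x) (e.symm y)
        (symmD e y v)) e.target := by
  have h1 := (contMDiffOn_chart_symm he).contMDiffOn_tangentMapWithin (m := ∞) (by simp)
    e.open_target.uniqueMDiffOn
  have h2 : ContMDiffOn (𝓡 m) (𝓡 m).tangent ∞ (fun y : Euc m =>
      TotalSpace.mk' (Euc m) (E := fun y : Euc m => TangentSpace (𝓡 m) y) y v) e.target :=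
    contMDiffOn_vectorSpace_iff_contDiffOn.2 contDiffOn_const
  refine (h1.comp h2 fun y hy => hy).congr fun y hy => ?_
  simp only [Function.comp, tangentMapWithin, mfderivWithin_of_isOpen e.open_target hy]
  rfl

lemma contDiffOn_chartD (he : e ∈ atlas (Euc m) N) {X : Euc m → Euc m}
    (hX : ContMDiffOn (𝓡 m) (𝓡 m).tangent ∞
      (fun y => TotalSpace.mk' (Euc m) (E := fun x : N => TangentSpace (𝓡 m) x) (e.symm y) (X y))
      e.target) : ContDiffOn ℝ ∞ (fun y => chartD e (e.symm y) (X y)) e.target := by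
  have h1 := (contMDiffOn_chart he).contMDiffOn_tangentMapWithin (m := ∞) (by simp)
    e.open_source.uniqueMDiffOn
  refine contMDiffOn_vectorSpace_iff_contDiffOn.1 ?_
  refine (h1.comp hX fun y hy => e.map_target hy).congr fun y hy => ?_
  simp only [Function.comp, tangentMapWithin,
    mfderivWithin_of_isOpen e.open_source (e.map_target hy), TotalSpace.mk']
  have hmk : ∀ z w : Euc m, z = y → (⟨y, w⟩ : TotalSpace (Euc m)
      (fun y : Euc m => TangentSpace (𝓡 m) y)) = ⟨z, w⟩ := by rintro _ w rfl; rfl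
  exact hmk _ _ (e.right_inv hy)

end Sections

/-! ### The Kähler structure in charts. -/

namespace KahlerStructure

variable {n : ℕ} {M : Type*} [TopologicalSpace M] [ChartedSpace (Euc (2 * n)) M]
  [IsManifold (𝓡 (2 * n)) ∞ M] (K : KahlerStructure n M)
  {e' : OpenPartialHomeomorph M (Euc (2 * n))}

lemma inChart_apply (y v w : Euc (2 * n)) : inChart K.metric.inner e' y v w
    = K.metric.inner (e'.symm y) (symmD e' y v) (symmD e' y w) := rfl

/-- Smoothness of a form-valued map is tested on constant vectors, where it reduces to the bundle
metric applied to the smooth fields of `contMDiffOn_symmD`. -/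
lemma contDiffOn_metric (he : e' ∈ atlas (Euc (2 * n)) M) :
    ContDiffOn ℝ ∞ (inChart K.metric.inner e') e'.target := by
  refine contDiffOn_clm_apply.2 fun v => contDiffOn_clm_apply.2 fun w => ?_
  simp only [inChart_apply]
  rw [← contMDiffOn_iff_contDiffOn]
  have hs := contMDiffOn_chart_symm he
  have h1 : ContMDiffOn (𝓡 (2 * n)) ((𝓡 (2 * n)).prod 𝓘(ℝ)) ∞
      (fun y => TotalSpace.mk' ℝ (E := Bundle.Trivial M ℝ) (e'.symm y)
        (K.metric.inner (e'.symm y) (symmD e' y v) (symmD e' y w))) e'.target := by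
    intro y hy
    apply ContMDiffWithinAt.clm_bundle_apply₂ (F₁ := Euc (2 * n)) (F₂ := Euc (2 * n))
    · exact K.metric.contMDiff.contMDiffAt.comp_contMDiffWithinAt y (hs y hy)
    · exact contMDiffOn_symmD he v y hy
    · exact contMDiffOn_symmD he w y hy
  intro y hy
  have := h1 y hy
  simp only [contMDiffWithinAt_totalSpace] at this
  exact this.2

lemma contDiffOn_J (he : e' ∈ atlas (Euc (2 * n)) M) :
    ContDiffOn ℝ ∞ (endInChart K.J e') e'.target := by
  refine contDiffOn_clm_apply.2 fun v => ?_
  simp only [endInChart_apply]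
  refine contDiffOn_chartD he (X := fun y => K.J (e'.symm y) (symmD e' y v)) fun y hy => ?_
  apply ContMDiffWithinAt.clm_bundle_apply (F₁ := Euc (2 * n)) (F₂ := Euc (2 * n))
  · exact K.smooth_J.contMDiffAt.comp_contMDiffWithinAt y (contMDiffOn_chart_symm he y hy)
  · exact contMDiffOn_symmD he v y hy

lemma metricOn (he : e' ∈ atlas (Euc (2 * n)) M) :
    MetricOn (inChart K.metric.inner e') e'.target where
  isOpen := e'.open_target
  smooth := K.contDiffOn_metric he
  inner y hy :=
    { symm := fun _ _ => K.metric.symm _ _ _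
      pos := fun _ hv => K.metric.pos _ _ fun h0 => hv ((symmD_bijective he hy).1
        (h0.trans (map_zero (symmD e' y)).symm)) }

lemma symmD_endInChart (he : e' ∈ atlas (Euc (2 * n)) M) {y : Euc (2 * n)} (hy : y ∈ e'.target)
    (v : Euc (2 * n)) :
    symmD e' y (endInChart K.J e' y v) = K.J (e'.symm y) (symmD e' y v) := by
  rw [endInChart_apply]
  have := symmD_chartD he (e'.map_target hy) (K.J (e'.symm y) (symmD e' y v))
  rwa [e'.right_inv hy] at this

lemma kahlerOn (he : e' ∈ atlas (Euc (2 * n)) M) :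
    KahlerOn (inChart K.metric.inner e') (endInChart K.J e') e'.target where
  metric := K.metricOn he
  smooth := K.contDiffOn_J he
  J_J y hy v := by
    rw [endInChart_apply, K.symmD_endInChart he hy]
    have h1 : chartD e' (e'.symm y) (K.J (e'.symm y) (K.J (e'.symm y) (symmD e' y v)))
        = chartD e' (e'.symm y) (-symmD e' y v) := congrArg _ (K.J_J _ _)
    rw [h1, map_neg, chartD_symmD he hy]
  metric_J y hy v w := by
    rw [inChart_apply, inChart_apply, K.symmD_endInChart he hy, K.symmD_endInChart he hy]
    exact K.metric_J _ _ _
  parallel := K.parallel_J e' he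

end KahlerStructure

/-! ### The deformation and its induced metrics in charts. -/

namespace KahlerStructure

variable {n : ℕ} {M : Type*} [TopologicalSpace M] [ChartedSpace (Euc (2 * n)) M]
  [IsManifold (𝓡 (2 * n)) ∞ M] (K : KahlerStructure n M)
  {L : Type*} [TopologicalSpace L] [ChartedSpace (Euc n) L] [IsManifold (𝓡 n) ∞ L]
  {e : OpenPartialHomeomorph L (Euc n)} {e' : OpenPartialHomeomorph M (Euc (2 * n))}

/-- The complex structure at a point, on coordinate space. -/
def fiberJ (p : M) : Euc (2 * n) →L[ℝ] Euc (2 * n) := K.J p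

/-- The derivative of a map, on coordinate spaces. -/
def mapD (ψ : L → M) (x : L) : Euc n →L[ℝ] Euc (2 * n) := mfderiv (𝓡 n) (𝓡 (2 * n)) ψ x

lemma inChart_chartD (he' : e' ∈ atlas (Euc (2 * n)) M) {p : M} (hp : p ∈ e'.source)
    (a b : Euc (2 * n)) : inChart K.metric.inner e' (e' p) (chartD e' p a) (chartD e' p b)
      = fiberForm K.metric.inner p a b := by
  have h1 : inChart K.metric.inner e' (e' p) (chartD e' p a) (chartD e' p b)
      = fiberForm K.metric.inner (e'.symm (e' p)) (symmD e' (e' p) (chartD e' p a))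
        (symmD e' (e' p) (chartD e' p b)) := rfl
  rw [h1, e'.left_inv hp, symmD_chartD he' hp, symmD_chartD he' hp]

lemma endInChart_chartD (he' : e' ∈ atlas (Euc (2 * n)) M) {p : M} (hp : p ∈ e'.source)
    (a : Euc (2 * n)) :
    endInChart K.J e' (e' p) (chartD e' p a) = chartD e' p (K.fiberJ p a) := by
  have h1 : endInChart K.J e' (e' p) (chartD e' p a)
      = chartD e' (e'.symm (e' p)) (K.fiberJ (e'.symm (e' p))
        (symmD e' (e' p) (chartD e' p a))) := rfl
  rw [h1, e'.left_inv hp, symmD_chartD he' hp]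

lemma inChart_inducedMetric (ψ : L → M) (y u v : Euc n) :
    inChart (K.inducedMetric ψ) e y u v
      = fiberForm K.metric.inner (ψ (e.symm y)) (mapD ψ (e.symm y) (symmD e y u))
        (mapD ψ (e.symm y) (symmD e y v)) := rfl

/-- A family of maps in charts. -/
def chartMap (φ : ℝ → L → M) (e : OpenPartialHomeomorph L (Euc n))
    (e' : OpenPartialHomeomorph M (Euc (2 * n))) (q : ℝ × Euc n) : Euc (2 * n) :=
  e' (φ q.1 (e.symm q.2))

/-- The domain of a family of maps in charts. -/
def chartDomain (η : ℝ) (φ : ℝ → L → M) (e : OpenPartialHomeomorph L (Euc n))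
    (e' : OpenPartialHomeomorph M (Euc (2 * n))) : Set (ℝ × Euc n) :=
  (Ioo (-η) η ×ˢ e.target) ∩ (fun q => φ q.1 (e.symm q.2)) ⁻¹' e'.source

namespace IsHamiltonianDeformation

variable {K} {η : ℝ} {φ : ℝ → L → M} (hφ : K.IsHamiltonianDeformation η φ)

include hφ

lemma contMDiffOn_comp (he : e ∈ atlas (Euc n) L) :
    ContMDiffOn 𝓘(ℝ, ℝ × Euc n) (𝓡 (2 * n)) ∞ (fun q : ℝ × Euc n => φ q.1 (e.symm q.2))
      (Ioo (-η) η ×ˢ e.target) := by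
  have h1 : ContMDiffOn 𝓘(ℝ, ℝ × Euc n) 𝓘(ℝ, ℝ) ∞ (fun q : ℝ × Euc n => q.1)
      (Ioo (-η) η ×ˢ e.target) := contDiff_fst.contMDiff.contMDiffOn
  have h2 : ContMDiffOn 𝓘(ℝ, ℝ × Euc n) (𝓡 n) ∞ (fun q : ℝ × Euc n => e.symm q.2)
      (Ioo (-η) η ×ˢ e.target) :=
    (contMDiffOn_chart_symm he).comp (contDiff_snd.contMDiff.contMDiffOn) fun q hq => hq.2
  exact hφ.smooth.comp (h1.prodMk h2) fun q hq => ⟨hq.1, mem_univ _⟩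

lemma isOpen_chartDomain (he : e ∈ atlas (Euc n) L) : IsOpen (chartDomain η φ e e') :=
  (hφ.contMDiffOn_comp he).continuousOn.isOpen_inter_preimage (isOpen_Ioo.prod e.open_target)
    e'.open_source

lemma contDiffOn_chartMap (he : e ∈ atlas (Euc n) L) (he' : e' ∈ atlas (Euc (2 * n)) M) :
    ContDiffOn ℝ ∞ (chartMap φ e e') (chartDomain η φ e e') := by
  rw [← contMDiffOn_iff_contDiffOn]
  exact (contMDiffOn_chart he').comp ((hφ.contMDiffOn_comp he).mono inter_subset_left)
    fun q hq => hq.2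

lemma contDiffAt_chartMap (he : e ∈ atlas (Euc n) L) (he' : e' ∈ atlas (Euc (2 * n)) M)
    {q : ℝ × Euc n} (hq : q ∈ chartDomain η φ e e') : ContDiffAt ℝ ∞ (chartMap φ e e') q :=
  (hφ.contDiffOn_chartMap he he').contDiffAt ((hφ.isOpen_chartDomain he).mem_nhds hq)

lemma contMDiffAt {s : ℝ} (hs : s ∈ Ioo (-η) η) (x : L) :
    ContMDiffAt (𝓘(ℝ, ℝ).prod (𝓡 n)) (𝓡 (2 * n)) ∞ (fun p : ℝ × L => φ p.1 p.2) (s, x) :=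
  hφ.smooth.contMDiffAt ((isOpen_Ioo.prod isOpen_univ).mem_nhds ⟨hs, mem_univ _⟩)

lemma contMDiff {s : ℝ} (hs : s ∈ Ioo (-η) η) : ContMDiff (𝓡 n) (𝓡 (2 * n)) ∞ (φ s) := fun x =>
  (hφ.contMDiffAt hs x).comp x (contMDiffAt_const.prodMk contMDiffAt_id)

lemma mdifferentiableAt {s : ℝ} (hs : s ∈ Ioo (-η) η) (x : L) :
    MDifferentiableAt (𝓡 n) (𝓡 (2 * n)) (φ s) x := (hφ.contMDiff hs).mdifferentiable (by simp) x

lemma mdifferentiableAt_left {s : ℝ} (hs : s ∈ Ioo (-η) η) (x : L) :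
    MDifferentiableAt 𝓘(ℝ, ℝ) (𝓡 (2 * n)) (fun t => φ t x) s := by
  have : ContMDiffAt 𝓘(ℝ, ℝ) (𝓡 (2 * n)) ∞ (fun t => φ t x) s :=
    (hφ.contMDiffAt hs x).comp s (contMDiffAt_id.prodMk contMDiffAt_const)
  exact this.mdifferentiableAt (by simp)

lemma fderiv_chartMap_right (he : e ∈ atlas (Euc n) L) (he' : e' ∈ atlas (Euc (2 * n)) M) {s : ℝ}
    {y : Euc n} (hq : (s, y) ∈ chartDomain η φ e e') (v : Euc n) :
    fderiv ℝ (chartMap φ e e') (s, y) (0, v)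
      = chartD e' (φ s (e.symm y)) (mapD (φ s) (e.symm y) (symmD e y v)) := by
  rw [← fderiv_slice ((hφ.contDiffAt_chartMap he he' hq).differentiableAt (by simp)),
    ← mfderiv_eq_fderiv]
  have h1 := mdifferentiableAt_chart_symm he hq.1.2
  have h2 := hφ.mdifferentiableAt hq.1.1 (e.symm y)
  have h3 := (chart_mdifferentiable he').mdifferentiableAt hq.2
  have h4 := mfderiv_comp y h3 (h2.comp y h1)
  have h5 := mfderiv_comp y h2 h1
  rw [h5] at h4
  exact congrArg (fun A : Euc n →L[ℝ] Euc (2 * n) => A v) h4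

lemma fderiv_chartMap_left (he : e ∈ atlas (Euc n) L) (he' : e' ∈ atlas (Euc (2 * n)) M) {s : ℝ}
    {y : Euc n} (hq : (s, y) ∈ chartDomain η φ e e') :
    fderiv ℝ (chartMap φ e e') (s, y) (1, 0)
      = chartD e' (φ s (e.symm y)) (velocity φ s (e.symm y)) := by
  rw [← deriv_slice ((hφ.contDiffAt_chartMap he he' hq).differentiableAt (by simp)),
    ← fderiv_apply_one_eq_deriv, ← mfderiv_eq_fderiv]
  have h2 := hφ.mdifferentiableAt_left hq.1.1 (e.symm y)
  have h3 := (chart_mdifferentiable he').mdifferentiableAt hq.2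
  have h4 := mfderiv_comp s h3 h2
  exact congrArg (fun A : ℝ →L[ℝ] Euc (2 * n) => A 1) h4

lemma inChart_eq_sliceMetric (he : e ∈ atlas (Euc n) L) (he' : e' ∈ atlas (Euc (2 * n)) M) {s : ℝ}
    {y : Euc n} (hq : (s, y) ∈ chartDomain η φ e e') :
    inChart (K.inducedMetric (φ s)) e y
      = sliceMetric (inChart K.metric.inner e') (chartMap φ e e') s y := by
  ext u v
  rw [sliceMetric_apply, hφ.fderiv_chartMap_right he he' hq, hφ.fderiv_chartMap_right he he' hq,
    inChart_inducedMetric]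
  exact (K.inChart_chartD he' hq.2 _ _).symm

lemma mem_chartDomain_chartAt {s : ℝ} (hs : s ∈ Ioo (-η) η) {y : Euc n} (hy : y ∈ e.target) :
    (s, y) ∈ chartDomain η φ e (chartAt (Euc (2 * n)) (φ s (e.symm y))) :=
  ⟨⟨hs, hy⟩, mem_chart_source _ _⟩

/-- Smoothness is joint in time and space: near `(s, y)` the family stays in one chart of `M`, where
the induced metric is `sliceMetric`. -/
lemma contDiffAt_inChart (he : e ∈ atlas (Euc n) L) {s : ℝ} (hs : s ∈ Ioo (-η) η) {y : Euc n}
    (hy : y ∈ e.target) : ContDiffAt ℝ ∞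
      (fun q : ℝ × Euc n => inChart (K.inducedMetric (φ q.1)) e q.2) (s, y) := by
  set e' := chartAt (Euc (2 * n)) (φ s (e.symm y)) with he'def
  have he' : e' ∈ atlas (Euc (2 * n)) M := chart_mem_atlas _ _
  have hq : (s, y) ∈ chartDomain η φ e e' := hφ.mem_chartDomain_chartAt hs hy
  refine (contDiffAt_sliceMetric (K.metricOn he') (e'.map_source hq.2)
    (hφ.contDiffAt_chartMap he he' hq)).congr_of_eventuallyEq ?_
  filter_upwards [(hφ.isOpen_chartDomain he).mem_nhds hq] with p hp
  exact hφ.inChart_eq_sliceMetric he he' hp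

lemma smoothMetric {s : ℝ} (hs : s ∈ Ioo (-η) η) : SmoothMetric (K.inducedMetric (φ s)) := by
  intro e he
  refine ⟨e.open_target, fun y hy => ?_, fun y hy => ⟨fun u v => K.metric.symm _ _ _, fun v hv => ?_⟩⟩
  · have h1 := hφ.contDiffAt_inChart he hs hy
    exact (ContDiffAt.comp y (f := fun z : Euc n => (s, z)) h1
      (contDiffAt_const.prodMk contDiffAt_id)).contDiffWithinAt
  · refine K.metric.pos _ _ fun h0 => hv ?_
    have h1 : symmD e y v = 0 :=
      hφ.immersion s hs (e.symm y) (h0.trans (map_zero (mapD (φ s) (e.symm y))).symm)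
    exact (symmD_bijective he hy).1 (h1.trans (map_zero (symmD e y)).symm)

end IsHamiltonianDeformation

end KahlerStructure

/-! ### The velocity form and the second variation of the induced density. -/

namespace KahlerStructure

variable {n : ℕ} {M : Type*} [TopologicalSpace M] [ChartedSpace (Euc (2 * n)) M]
  [IsManifold (𝓡 (2 * n)) ∞ M] {K : KahlerStructure n M}
  {L : Type*} [TopologicalSpace L] [ChartedSpace (Euc n) L] [IsManifold (𝓡 n) ∞ L]
  {e : OpenPartialHomeomorph L (Euc n)} {e' : OpenPartialHomeomorph M (Euc (2 * n))}

/-- The one-form `v ↦ g(∂φ_s/∂s, dφ_s v)`. -/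
def velocityForm (K : KahlerStructure n M) (φ : ℝ → L → M) (s : ℝ) (x : L) : Euc n →L[ℝ] ℝ :=
  (fiberForm K.metric.inner (φ s x) (velocity φ s x)).comp (mapD (φ s) x)

/-- The derivative of `velocityForm` at time zero. -/
def accelerationForm (K : KahlerStructure n M) (φ : ℝ → L → M) (x : L) : Euc n →L[ℝ] ℝ :=
  deriv (fun s => K.velocityForm φ s x) 0

namespace IsHamiltonianDeformation

variable {η : ℝ} {φ : ℝ → L → M} {f : L → ℝ} (hφ : K.IsHamiltonianDeformation η φ) (hη : 0 < η)

include hφ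

lemma velocityForm_chart (he : e ∈ atlas (Euc n) L) (he' : e' ∈ atlas (Euc (2 * n)) M) {s : ℝ}
    {y : Euc n} (hq : (s, y) ∈ chartDomain η φ e e') (v : Euc n) :
    formInChart (K.velocityForm φ s) e y v
      = inChart K.metric.inner e' (chartMap φ e e' (s, y))
        (fderiv ℝ (chartMap φ e e') (s, y) (1, 0)) (fderiv ℝ (chartMap φ e e') (s, y) (0, v)) := by
  rw [hφ.fderiv_chartMap_right he he' hq, hφ.fderiv_chartMap_left he he' hq]
  exact (K.inChart_chartD he' hq.2 _ _).symm

lemma contDiffAt_velocityForm (he : e ∈ atlas (Euc n) L) {s : ℝ} (hs : s ∈ Ioo (-η) η) {y : Euc n}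
    (hy : y ∈ e.target) : ContDiffAt ℝ ∞
      (fun q : ℝ × Euc n => formInChart (K.velocityForm φ q.1) e q.2) (s, y) := by
  set e' := chartAt (Euc (2 * n)) (φ s (e.symm y)) with he'def
  have he' : e' ∈ atlas (Euc (2 * n)) M := chart_mem_atlas _ _
  have hq : (s, y) ∈ chartDomain η φ e e' := hφ.mem_chartDomain_chartAt hs hy
  have hΦ := hφ.contDiffAt_chartMap he he' hq
  have hd : ContDiffAt ℝ ∞ (fderiv ℝ (chartMap φ e e')) (s, y) := hΦ.fderiv_right (by simp)
  have hG : ContDiffAt ℝ ∞ (fun q => inChart K.metric.inner e' (chartMap φ e e' q)) (s, y) :=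
    ContDiffAt.comp (s, y) (g := inChart K.metric.inner e') (f := chartMap φ e e')
      ((K.metricOn he').contDiffAt (e'.map_source hq.2)) hΦ
  have hd1 : ContDiffAt ℝ ∞ (fun q => fderiv ℝ (chartMap φ e e') q (1, 0)) (s, y) :=
    hd.clm_apply contDiffAt_const
  have hd2 : ContDiffAt ℝ ∞ (fun q => (fderiv ℝ (chartMap φ e e') q).comp
      (ContinuousLinearMap.inr ℝ ℝ (Euc n))) (s, y) := hd.clm_comp contDiffAt_const
  have h1 : ContDiffAt ℝ ∞ (fun q : ℝ × Euc n =>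
      (inChart K.metric.inner e' (chartMap φ e e' q) (fderiv ℝ (chartMap φ e e') q (1, 0))).comp
        ((fderiv ℝ (chartMap φ e e') q).comp (ContinuousLinearMap.inr ℝ ℝ (Euc n)))) (s, y) :=
    (hG.clm_apply hd1).clm_comp hd2
  refine h1.congr_of_eventuallyEq ?_
  filter_upwards [(hφ.isOpen_chartDomain he).mem_nhds hq] with p hp
  ext v
  rw [hφ.velocityForm_chart he he' hp]
  simp

include hη

lemma zero_mem : (0 : ℝ) ∈ Ioo (-η) η := ⟨by linarith, hη⟩

/-- At a fixed point passing to the chart is composition with the fixed map `symmD e y`, so it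
commutes with the time derivative. The right side is visibly smooth in `y`. The right inverse `B`
transfers differentiability back to the manifold. -/
lemma accelerationForm_chart (he : e ∈ atlas (Euc n) L) {y : Euc n} (hy : y ∈ e.target) :
    formInChart (K.accelerationForm φ) e y
      = fderiv ℝ (fun q : ℝ × Euc n => formInChart (K.velocityForm φ q.1) e q.2) (0, y) (1, 0) := by
  have hs := hφ.zero_mem hη
  set x := e.symm y with hx
  set A := symmD e y
  obtain ⟨B, hB⟩ : ∃ B : Euc n →L[ℝ] Euc n, A.comp B = ContinuousLinearMap.id ℝ _ :=
    ⟨chartD e x, by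
      ext1 v
      have := symmD_chartD he (e.map_target hy) v
      rw [e.right_inv hy] at this
      exact this⟩
  have hd : DifferentiableAt ℝ (fun s => formInChart (K.velocityForm φ s) e y) 0 := by
    have h1 := hφ.contDiffAt_velocityForm he hs hy
    exact (ContDiffAt.comp (0 : ℝ) (f := fun s : ℝ => (s, y)) h1
      (contDiffAt_id.prodMk contDiffAt_const)).differentiableAt (by simp)
  have hd2 : DifferentiableAt ℝ (fun s => K.velocityForm φ s x) 0 := by
    have h2 : (fun s => K.velocityForm φ s x)
        = fun s => (formInChart (K.velocityForm φ s) e y).comp B := by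
      funext s
      have : (formInChart (K.velocityForm φ s) e y).comp B
          = (K.velocityForm φ s x).comp (A.comp B) := rfl
      rw [this, hB]; rfl
    rw [h2]
    exact hd.clm_comp (differentiableAt_const _)
  rw [← deriv_slice (H := fun q : ℝ × Euc n => formInChart (K.velocityForm φ q.1) e q.2)
    ((hφ.contDiffAt_velocityForm he hs hy).differentiableAt (by simp))]
  have h3 := hd2.hasDerivAt.clm_comp (hasDerivAt_const (0 : ℝ) A)
  have h4 := h3.deriv
  refine Eq.trans ?_ h4.symm
  simp only [ContinuousLinearMap.comp_zero, add_zero]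
  rfl

lemma accelerationForm_apply (he : e ∈ atlas (Euc n) L) (he' : e' ∈ atlas (Euc (2 * n)) M)
    {y : Euc n} (hq : ((0 : ℝ), y) ∈ chartDomain η φ e e') (v : Euc n) :
    formInChart (K.accelerationForm φ) e y v
      = deriv (fun s => inChart K.metric.inner e' (chartMap φ e e' (s, y))
        (fderiv ℝ (chartMap φ e e') (s, y) (1, 0)) (fderiv ℝ (chartMap φ e e') (s, y) (0, v))) 0 := by
  have hdiff := (hφ.contDiffAt_velocityForm he hq.1.1 hq.1.2).differentiableAt (by simp)
  rw [hφ.accelerationForm_chart hη he hq.1.2, ← deriv_slice hdiff]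
  have hev : (fun s => inChart K.metric.inner e' (chartMap φ e e' (s, y))
        (fderiv ℝ (chartMap φ e e') (s, y) (1, 0)) (fderiv ℝ (chartMap φ e e') (s, y) (0, v)))
      =ᶠ[𝓝 0] fun s => formInChart (K.velocityForm φ s) e y v := by
    have hc : ContinuousAt (fun s : ℝ => (s, y)) 0 := by fun_prop
    filter_upwards [hc ((hφ.isOpen_chartDomain (e' := e') he).mem_nhds hq)] with s hs
    exact (hφ.velocityForm_chart he he' hs v).symm
  rw [hev.deriv_eq]
  have hd : DifferentiableAt ℝ (fun s => formInChart (K.velocityForm φ s) e y) 0 :=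
    DifferentiableAt.comp (0 : ℝ) (f := fun s : ℝ => (s, y)) hdiff (by fun_prop)
  have := (hd.hasDerivAt.clm_apply (hasDerivAt_const (0 : ℝ) v)).deriv
  simp only [map_zero, add_zero] at this
  exact this.symm

lemma smoothForm_accelerationForm : SmoothForm (K.accelerationForm φ) := by
  intro e he y hy
  have hs := hφ.zero_mem hη
  have h1 := (hφ.contDiffAt_velocityForm he hs hy).fderiv_right (m := ∞) (by simp)
  have h2 : ContDiffAt ℝ ∞ (fun z : Euc n => fderiv ℝ (fun q : ℝ × Euc n =>
      formInChart (K.velocityForm φ q.1) e q.2) (0, z) (1, 0)) y :=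
    (ContDiffAt.comp y (f := fun z : Euc n => ((0 : ℝ), z)) h1
      (contDiffAt_const.prodMk contDiffAt_id)).clm_apply contDiffAt_const
  refine ContDiffAt.contDiffWithinAt (h2.congr_of_eventuallyEq ?_)
  filter_upwards [e.open_target.mem_nhds hy] with z hz
  exact hφ.accelerationForm_chart hη he hz

/-- The part of a chart of `L` that is mapped into a chart of `M` at time zero. -/
lemma isOpen_chartDomain_zero (he : e ∈ atlas (Euc n) L) :
    IsOpen {y : Euc n | ((0 : ℝ), y) ∈ chartDomain η φ e e'} :=
  (hφ.isOpen_chartDomain he).preimage (by fun_prop)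

lemma fderiv_chartMap_zero (he : e ∈ atlas (Euc n) L) (he' : e' ∈ atlas (Euc (2 * n)) M)
    {y : Euc n} (hq : ((0 : ℝ), y) ∈ chartDomain η φ e e') (v : Euc n) :
    fderiv ℝ (fun z => chartMap φ e e' (0, z)) y v
      = chartD e' (φ 0 (e.symm y)) (mapD (φ 0) (e.symm y) (symmD e y v)) := by
  rw [fderiv_slice ((hφ.contDiffAt_chartMap he he' hq).differentiableAt (by simp)),
    hφ.fderiv_chartMap_right he he' hq]

/-- Passage from the invariant hypotheses to the coordinate calculus, on the part of `e` that `φ 0`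
maps into `e'`. -/
lemma minimalLagrangian (hlag : K.IsLagrangian (φ 0)) (hmin : K.IsMinimal (φ 0))
    (he : e ∈ atlas (Euc n) L) (he' : e' ∈ atlas (Euc (2 * n)) M) :
    MinimalLagrangian (inChart K.metric.inner e') (endInChart K.J e') e'.target
      (fun z => chartMap φ e e' (0, z)) (inChart (K.inducedMetric (φ 0)) e)
      {y : Euc n | ((0 : ℝ), y) ∈ chartDomain η φ e e'} where
  kahler := K.kahlerOn he'
  metric :=
    { isOpen := hφ.isOpen_chartDomain_zero hη he
      smooth := (hφ.smoothMetric (hφ.zero_mem hη) e he).smooth.mono fun y hy => hy.1.2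
      inner := fun y hy => (hφ.smoothMetric (hφ.zero_mem hη) e he).inner y hy.1.2 }
  smooth y hy := (ContDiffAt.comp y (f := fun z : Euc n => ((0 : ℝ), z))
    (hφ.contDiffAt_chartMap he he' hy) (contDiffAt_const.prodMk contDiffAt_id)).contDiffWithinAt
  maps y hy := e'.map_source hy.2
  induced y hy u v := by
    rw [hφ.fderiv_chartMap_zero hη he he' hy, hφ.fderiv_chartMap_zero hη he he' hy]
    exact (K.inChart_chartD he' hy.2 _ _).symm
  lagrangian y hy u v := by
    rw [hφ.fderiv_chartMap_zero hη he he' hy, hφ.fderiv_chartMap_zero hη he he' hy]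
    have h1 := K.endInChart_chartD he' hy.2 (mapD (φ 0) (e.symm y) (symmD e y u))
    refine Eq.trans ?_ ((K.inChart_chartD he' hy.2
      (K.fiberJ (φ 0 (e.symm y)) (mapD (φ 0) (e.symm y) (symmD e y u)))
      (mapD (φ 0) (e.symm y) (symmD e y v))).trans ?_)
    · exact congrArg (fun a => inChart K.metric.inner e' (e' (φ 0 (e.symm y))) a _) h1
    · exact hlag (e.symm y) (symmD e y u) (symmD e y v)
  -- `meanCurvature` subtracts tangential parts; against a normal vector `ν` these are invisible, so
  -- only the covariant derivatives of the frame remain.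
  minimal y hy ν hν := by
    have h1 := hmin e he e' he' y hy.1.2 hy.2
    have h2 := congrArg (fun a => inChart K.metric.inner e' (chartMap φ e e' (0, y)) a ν) h1
    simp only [map_zero, zero_apply] at h2
    refine Eq.trans ?_ h2
    simp only [meanCurvature, map_sum, sum_apply]
    refine Finset.sum_congr rfl fun i _ => ?_
    simp only [secondFundamentalForm]
    rw [map_sub, sub_apply]
    have hsymm := ((K.metricOn he').inner _ (e'.map_source hy.2)).symm
    have h3 : ∀ w, inChart K.metric.inner e' (e' (φ 0 (e.symm y)))
        (fderiv ℝ (fun z => e' (φ 0 (e.symm z))) y w) ν = 0 := fun w => by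
      rw [hsymm]; exact hν w
    refine Eq.trans ?_ (sub_eq_self.2 (h3 _)).symm
    rfl

/-- The second variation of the density of the induced metrics. -/
lemma hasDerivAt_deriv_density (hlag : K.IsLagrangian (φ 0)) (hmin : K.IsMinimal (φ 0))
    (hf : ContMDiff (𝓡 n) 𝓘(ℝ, ℝ) ∞ f) (hX : ∀ x, velocity φ 0 x = K.JGrad (φ 0) f x)
    {R : ℝ} (hR : K.IsEinstein R) (he : e ∈ atlas (Euc n) L) {y : Euc n} (hy : y ∈ e.target) :
    HasDerivAt (fun s => deriv (fun s => density (inChart (K.inducedMetric (φ s)) e y)) s)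
      (sqrtDet (inChart (K.inducedMetric (φ 0)) e) y
        * (divCoord (inChart (K.inducedMetric (φ 0)) e) (formInChart (K.accelerationForm φ) e) y
          - fderiv ℝ (laplaceCoord (inChart (K.inducedMetric (φ 0)) e) (fun y => f (e.symm y))) y
            ((inChart (K.inducedMetric (φ 0)) e y).inverse (fderiv ℝ (fun y => f (e.symm y)) y))
          - R / (2 * n) * formInner (K.inducedMetric (φ 0)) (dForm f) (dForm f) (e.symm y))) 0 := by
  set e' := chartAt (Euc (2 * n)) (φ 0 (e.symm y)) with he'def
  have he' : e' ∈ atlas (Euc (2 * n)) M := chart_mem_atlas _ _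
  have hq : ((0 : ℝ), y) ∈ chartDomain η φ e e' := hφ.mem_chartDomain_chartAt (hφ.zero_mem hη) hy
  have hh := hφ.smoothMetric (hφ.zero_mem hη)
  have hML := hφ.minimalLagrangian hη hlag hmin he he'
  set g := inChart (K.inducedMetric (φ 0)) e with hg
  have hgrad : ∀ z, z ∈ e.target → grad (K.inducedMetric (φ 0)) f (e.symm z)
      = symmD e z ((g z).inverse (fderiv ℝ (fun y => f (e.symm y)) z)) := by
    intro z hz
    rw [← formInChart_dForm he hz hf]
    exact hh.inverse_chart (β := dForm f) he hz
  have hV : ∀ z ∈ {y : Euc n | ((0 : ℝ), y) ∈ chartDomain η φ e e'},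
      fderiv ℝ (chartMap φ e e') (0, z) (1, 0) = endInChart K.J e' (chartMap φ e e' (0, z))
        (MinimalLagrangian.gradAlong (fun z => chartMap φ e e' (0, z)) g
          (fun y => f (e.symm y)) z) := by
    intro z hz
    rw [hφ.fderiv_chartMap_left he he' hz, MinimalLagrangian.gradAlong,
      hφ.fderiv_chartMap_zero hη he he' hz, ← hgrad z hz.1.2]
    refine Eq.trans ?_ (K.endInChart_chartD he' hz.2 _).symm
    exact congrArg (chartD e' (φ 0 (e.symm z))) (hX (e.symm z))
  have hΦ : ∀ z ∈ {y : Euc n | ((0 : ℝ), y) ∈ chartDomain η φ e e'},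
      ∀ᶠ q in 𝓝 ((0 : ℝ), z), ContDiffAt ℝ ∞ (chartMap φ e e') q := fun z hz => by
    filter_upwards [(hφ.isOpen_chartDomain he).mem_nhds hz] with q hq using
      hφ.contDiffAt_chartMap he he' hq
  have key := hML.hasDerivAt_deriv_density (β := formInChart (K.accelerationForm φ) e)
    ((contDiffOn_comp_chart_symm he hf).mono fun z hz => hz.1.2) hq hΦ hV
    fun z hz v => hφ.accelerationForm_apply hη he he' hz v
  -- The Einstein condition turns the Ricci term into a multiple of `|∇f|²`, because `dF` is
  -- isometric.
  have hric : ricci (inChart K.metric.inner e') (chartMap φ e e' (0, y))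
      (MinimalLagrangian.gradAlong (fun z => chartMap φ e e' (0, z)) g (fun y => f (e.symm y)) y)
      (MinimalLagrangian.gradAlong (fun z => chartMap φ e e' (0, z)) g (fun y => f (e.symm y)) y)
      = R / (2 * n) * formInner (K.inducedMetric (φ 0)) (dForm f) (dForm f) (e.symm y) := by
    rw [(hR e' he' (chartMap φ e e' (0, y)) (e'.map_source hq.2)).2, hh.formInner_chart he hy, formInChart_dForm he hy hf]
    congr 1
    rw [MinimalLagrangian.gradAlong]
    refine (hML.induced y hq _ _).symm.trans ?_
    rw [(hML.metric.inner y hq).apply_inverse]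
  rw [hric] at key
  refine key.congr_of_eventuallyEq ?_
  have hc : ContinuousAt (fun s : ℝ => (s, y)) 0 := by fun_prop
  have hev : ∀ᶠ s in 𝓝 (0 : ℝ), (s, y) ∈ chartDomain η φ e e' :=
    hc ((hφ.isOpen_chartDomain he).mem_nhds hq)
  filter_upwards [hev.eventually_nhds] with s hs
  refine Filter.EventuallyEq.deriv_eq ?_
  filter_upwards [hs] with t ht
  rw [hφ.inChart_eq_sliceMetric he he' ht]

end IsHamiltonianDeformation

end KahlerStructure

/-! ### Integrals depending on a parameter -/

section Parametric

variable {m : ℕ} {I : Set ℝ} {O K : Set (Euc m)} {H : ℝ × Euc m → ℝ}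

/-- A smooth family of functions on `O` with support in the compact set `K`. -/
structure SmoothFamily (I : Set ℝ) (O K : Set (Euc m)) (H : ℝ × Euc m → ℝ) : Prop where
  isOpen_left : IsOpen I
  isOpen : IsOpen O
  isCompact : IsCompact K
  subset : K ⊆ O
  smooth : ∀ s ∈ I, ∀ y ∈ O, ContDiffAt ℝ ∞ H (s, y)
  eq_zero : ∀ s ∈ I, ∀ y ∈ O, y ∉ K → H (s, y) = 0

namespace SmoothFamily

lemma deriv_left (h : SmoothFamily I O K H) {s : ℝ} (hs : s ∈ I) {y : Euc m} (hy : y ∈ O) :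
    HasDerivAt (fun t => H (t, y)) (fderiv ℝ H (s, y) (1, 0)) s := by
  have hd := (h.smooth s hs y hy).differentiableAt (by simp)
  exact HasFDerivAt.comp_hasDerivAt s (l := H) (f := fun t : ℝ => (t, y)) hd.hasFDerivAt
    (hasDerivAt_mk_left s y)

/-- Off `K` the family vanishes at all times, hence so does its time derivative. The class is thus
closed under time derivatives, and differentiation under the integral can be repeated. -/
lemma fderiv (h : SmoothFamily I O K H) :
    SmoothFamily I O K (fun q => fderiv ℝ H q (1, 0)) where
  isOpen_left := h.isOpen_left
  isOpen := h.isOpen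
  isCompact := h.isCompact
  subset := h.subset
  smooth s hs y hy := ((h.smooth s hs y hy).fderiv_right (by simp)).clm_apply contDiffAt_const
  eq_zero s hs y hy hyK := by
    refine (h.deriv_left hs hy).unique ?_
    refine (hasDerivAt_const s (0 : ℝ)).congr_of_eventuallyEq ?_
    filter_upwards [h.isOpen_left.mem_nhds hs] with t ht using h.eq_zero t ht y hy hyK

lemma continuousOn (h : SmoothFamily I O K H) : ContinuousOn H (I ×ˢ O) := fun q hq =>
  (h.smooth q.1 hq.1 q.2 hq.2).continuousAt.continuousWithinAt

lemma continuousOn_right (h : SmoothFamily I O K H) {s : ℝ} (hs : s ∈ I) :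
    ContinuousOn (fun y => H (s, y)) O :=
  h.continuousOn.comp (by fun_prop) fun _ hy => ⟨hs, hy⟩

lemma integrableOn (h : SmoothFamily I O K H) {s : ℝ} (hs : s ∈ I) :
    IntegrableOn (fun y => H (s, y)) O :=
  integrableOn_of_compact_support h.isOpen h.isCompact h.subset (h.continuousOn_right hs)
    (h.eq_zero s hs)

/-- The time derivative is bounded on a compact time interval times `K` and vanishes off `K`, so a
constant on `K` dominates it. -/
lemma hasDerivAt_integral (h : SmoothFamily I O K H) {s : ℝ} (hs : s ∈ I) :
    HasDerivAt (fun t => ∫ y in O, H (t, y)) (∫ y in O, _root_.fderiv ℝ H (s, y) (1, 0)) s := by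
  obtain ⟨r, hr, hball⟩ := Metric.nhds_basis_closedBall.mem_iff.1 (h.isOpen_left.mem_nhds hs)
  have hF := h.fderiv
  obtain ⟨C, hC⟩ := ((isCompact_closedBall s r).prod h.isCompact).exists_bound_of_continuousOn
    (hF.continuousOn.mono (prod_mono hball h.subset))
  have hmeas := h.isOpen.measurableSet
  refine (hasDerivAt_integral_of_dominated_loc_of_deriv_le (μ := volume.restrict O)
    (F := fun t y => H (t, y)) (F' := fun t y => _root_.fderiv ℝ H (t, y) (1, 0))
    (bound := K.indicator fun _ => C) (Metric.closedBall_mem_nhds s hr) ?_ (h.integrableOn hs) ?_ ?_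
    ?_ ?_).2
  · filter_upwards [h.isOpen_left.mem_nhds hs] with t ht using
      (h.integrableOn ht).aestronglyMeasurable
  · exact (hF.integrableOn hs).aestronglyMeasurable
  · filter_upwards [ae_restrict_mem hmeas] with y hy t ht
    by_cases hyK : y ∈ K
    · rw [indicator_of_mem hyK]; exact hC (t, y) ⟨ht, hyK⟩
    · rw [indicator_of_notMem hyK, hF.eq_zero t (hball ht) y hy hyK, norm_zero]
  · exact ((integrable_indicator_iff h.isCompact.measurableSet).2
      (integrableOn_const h.isCompact.measure_lt_top.ne)).integrableOn
  · filter_upwards [ae_restrict_mem hmeas] with y hy t ht using h.deriv_left (hball ht) hy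

/-- The integral of a smooth family is twice continuously differentiable. -/
lemma contDiffAt_integral (h : SmoothFamily I O K H) {s : ℝ} (hs : s ∈ I) :
    ContDiffAt ℝ 2 (fun t => ∫ y in O, H (t, y)) s ∧
      iteratedDeriv 2 (fun t => ∫ y in O, H (t, y)) s
        = ∫ y in O, _root_.fderiv ℝ (fun q => _root_.fderiv ℝ H q (1, 0)) (s, y) (1, 0) := by
  have h1 := h.fderiv
  have h2 := h1.fderiv
  have hd0 : ∀ t ∈ I, HasDerivAt _ _ t := fun t ht => h.hasDerivAt_integral ht
  have hd1 : ∀ t ∈ I, HasDerivAt _ _ t := fun t ht => h1.hasDerivAt_integral ht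
  -- A further derivative is taken only to obtain continuity of the second one.
  have hd2 : ∀ t ∈ I, HasDerivAt _ _ t := fun t ht => h2.hasDerivAt_integral ht
  have hI := h.isOpen_left
  have e0 : EqOn (deriv fun t => ∫ y in O, H (t, y))
      (fun t => ∫ y in O, _root_.fderiv ℝ H (t, y) (1, 0)) I := fun t ht => (hd0 t ht).deriv
  have e1 : EqOn (deriv fun t => ∫ y in O, _root_.fderiv ℝ H (t, y) (1, 0))
      (fun t => ∫ y in O, _root_.fderiv ℝ (fun q => _root_.fderiv ℝ H q (1, 0)) (t, y) (1, 0)) I :=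
    fun t ht => (hd1 t ht).deriv
  have c1 : ContDiffOn ℝ 1 (fun t => ∫ y in O, _root_.fderiv ℝ H (t, y) (1, 0)) I := by
    rw [show (1 : WithTop ℕ∞) = 0 + 1 by simp, contDiffOn_succ_iff_deriv_of_isOpen hI]
    refine ⟨fun t ht => (hd1 t ht).differentiableAt.differentiableWithinAt, by simp, ?_⟩
    rw [contDiffOn_zero]
    exact ContinuousOn.congr (fun t ht => (hd2 t ht).continuousAt.continuousWithinAt) e1
  have c2 : ContDiffOn ℝ 2 (fun t => ∫ y in O, H (t, y)) I := by
    rw [show (2 : WithTop ℕ∞) = 1 + 1 by norm_num, contDiffOn_succ_iff_deriv_of_isOpen hI]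
    exact ⟨fun t ht => (hd0 t ht).differentiableAt.differentiableWithinAt, by simp, c1.congr e0⟩
  refine ⟨c2.contDiffAt (hI.mem_nhds hs), ?_⟩
  rw [iteratedDeriv_succ, iteratedDeriv_one]
  have : deriv (fun t => ∫ y in O, H (t, y)) =ᶠ[𝓝 s]
      fun t => ∫ y in O, _root_.fderiv ℝ H (t, y) (1, 0) := by
    filter_upwards [hI.mem_nhds hs] with t ht using e0 ht
  rw [this.deriv_eq]
  exact e1 hs

end SmoothFamily

end Parametric

/-! ### The second variation of volume. -/

namespace KahlerStructure.IsHamiltonianDeformation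

variable {n : ℕ} {M : Type*} [TopologicalSpace M] [ChartedSpace (Euc (2 * n)) M]
  [IsManifold (𝓡 (2 * n)) ∞ M] {K : KahlerStructure n M}
  {L : Type*} [TopologicalSpace L] [ChartedSpace (Euc n) L] [IsManifold (𝓡 n) ∞ L]
  [T2Space L] [CompactSpace L] {e : OpenPartialHomeomorph L (Euc n)}
  {η : ℝ} {φ : ℝ → L → M} {f ρ : L → ℝ} (hφ : K.IsHamiltonianDeformation η φ)

include hφ

lemma smoothFamily (he : e ∈ atlas (Euc n) L) (hρ : ContMDiff (𝓡 n) 𝓘(ℝ, ℝ) ∞ ρ)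
    (hs : tsupport ρ ⊆ e.source) : SmoothFamily (Ioo (-η) η) e.target (e '' tsupport ρ)
      (fun q : ℝ × Euc n => density (inChart (K.inducedMetric (φ q.1)) e q.2) * ρ (e.symm q.2)) where
  isOpen_left := isOpen_Ioo
  isOpen := e.open_target
  isCompact := isCompact_image_chart (isClosed_tsupport ρ).isCompact hs
  subset := image_chart_subset hs
  smooth s hs y hy := by
    have h1 : ContDiffAt ℝ ∞ (fun q : ℝ × Euc n => density (inChart (K.inducedMetric (φ q.1)) e q.2))
        (s, y) :=
      ContDiffAt.comp (s, y) (g := density)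
        (f := fun q : ℝ × Euc n => inChart (K.inducedMetric (φ q.1)) e q.2)
        ((hφ.smoothMetric hs e he).inner y hy).contDiffAt_density (hφ.contDiffAt_inChart he hs hy)
    have h2 : ContDiffAt ℝ ∞ (fun q : ℝ × Euc n => ρ (e.symm q.2)) (s, y) :=
      ContDiffAt.comp (s, y) (g := fun y => ρ (e.symm y)) (f := fun q : ℝ × Euc n => q.2)
        ((contDiffOn_comp_chart_symm he hρ).contDiffAt (e.open_target.mem_nhds hy)) contDiffAt_snd
    exact h1.mul h2
  eq_zero s hs y hy hyK := by
    have : ρ (e.symm y) = 0 :=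
      comp_symm_eq_zero (fun x hx => image_eq_zero_of_notMem_tsupport hx) hy hyK
    simp [this]

variable [MeasurableSpace L] [BorelSpace L]

/-- The partition of unity stays fixed while the metric varies, so the volume is a finite sum of
coordinate integrals over domains independent of `s`. -/
lemma vol_eq_sum {t : Finset L} {ρ : L → L → ℝ} (hρ : ∀ i, ContMDiff (𝓡 n) 𝓘(ℝ, ℝ) ∞ (ρ i))
    (hsub : ∀ i, tsupport (ρ i) ⊆ (chartAt (Euc n) i).source) (hsum : ∀ x, ∑ i ∈ t, ρ i x = 1)
    {s : ℝ} (hs : s ∈ Ioo (-η) η) :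
    K.vol (φ s) = ∑ i ∈ t, ∫ y in (chartAt (Euc n) i).target,
      density (inChart (K.inducedMetric (φ s)) (chartAt (Euc n) i) y)
        * ρ i ((chartAt (Euc n) i).symm y) := by
  have hh := hφ.smoothMetric hs
  have h1 : K.vol (φ s) = ∫ x, ∑ i ∈ t, ρ i x ∂(riemannianMeasure (K.inducedMetric (φ s))) := by
    simp [hsum, vol]
  rw [h1, integral_finsetSum t fun i _ => hh.integrable (hρ i).continuous]
  refine Finset.sum_congr rfl fun i _ => ?_
  exact hh.integral_of_support (chart_mem_atlas _ i) (hρ i).continuous.continuousOn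
    fun x hx => image_eq_zero_of_notMem_tsupport fun h => hx (hsub i h)

variable (hη : 0 < η)

include hη

/-- The second derivative of the density is the integrand of the second variation of volume. -/
lemma fderiv_fderiv_density (hlag : K.IsLagrangian (φ 0)) (hmin : K.IsMinimal (φ 0))
    (hf : ContMDiff (𝓡 n) 𝓘(ℝ, ℝ) ∞ f) (hX : ∀ x, velocity φ 0 x = K.JGrad (φ 0) f x)
    {R : ℝ} (hR : K.IsEinstein R) (he : e ∈ atlas (Euc n) L)
    (hρ : ContMDiff (𝓡 n) 𝓘(ℝ, ℝ) ∞ ρ) (hs : tsupport ρ ⊆ e.source) {y : Euc n}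
    (hy : y ∈ e.target) :
    fderiv ℝ (fun q => fderiv ℝ (fun q : ℝ × Euc n =>
      density (inChart (K.inducedMetric (φ q.1)) e q.2) * ρ (e.symm q.2)) q (1, 0)) (0, y) (1, 0)
    = sqrtDet (inChart (K.inducedMetric (φ 0)) e) y * (ρ (e.symm y)
      * (divForm (K.inducedMetric (φ 0)) (K.accelerationForm φ) (e.symm y)
        - formInner (K.inducedMetric (φ 0)) (dForm (laplacian (K.inducedMetric (φ 0)) f)) (dForm f)
          (e.symm y)
        - R / (2 * n) * formInner (K.inducedMetric (φ 0)) (dForm f) (dForm f) (e.symm y))) := by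
  have h0 := hφ.zero_mem hη
  have hh := hφ.smoothMetric h0
  have hfam := hφ.smoothFamily he hρ hs
  have hev : ∀ᶠ s in 𝓝 (0 : ℝ), s ∈ Ioo (-η) η := isOpen_Ioo.mem_nhds h0
  have key := (hφ.hasDerivAt_deriv_density hη hlag hmin hf hX hR he hy).mul_const (ρ (e.symm y))
  have h1 := hfam.fderiv.deriv_left h0 hy
  have h2 : (fun s => fderiv ℝ (fun q : ℝ × Euc n =>
        density (inChart (K.inducedMetric (φ q.1)) e q.2) * ρ (e.symm q.2)) (s, y) (1, 0))
      =ᶠ[𝓝 0] fun s => deriv (fun s => density (inChart (K.inducedMetric (φ s)) e y)) s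
        * ρ (e.symm y) := by
    filter_upwards [hev] with s hs
    rw [← (hfam.deriv_left hs hy).deriv]
    exact deriv_mul_const_field (u := fun s => density (inChart (K.inducedMetric (φ s)) e y))
      (ρ (e.symm y))
  have h3 := h1.unique (key.congr_of_eventuallyEq h2)
  refine h3.trans ?_
  have h4 : formInner (K.inducedMetric (φ 0)) (dForm (laplacian (K.inducedMetric (φ 0)) f))
      (dForm f) (e.symm y)
      = fderiv ℝ (laplaceCoord (inChart (K.inducedMetric (φ 0)) e) (fun y => f (e.symm y))) y
        ((inChart (K.inducedMetric (φ 0)) e y).inverse (fderiv ℝ (fun y => f (e.symm y)) y)) := by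
    rw [hh.formInner_chart he hy, formInChart_dForm he hy hf,
      formInChart_dForm he hy (hh.contMDiff_laplacian hf)]
    congr 1
    refine Filter.EventuallyEq.fderiv_eq ?_
    filter_upwards [e.open_target.mem_nhds hy] with z hz using hh.laplacian_chart hf he hz
  rw [h4, hh.divForm_eq (hφ.smoothForm_accelerationForm hη) he (e.map_target hy), e.right_inv hy]
  ring

/-- The second variation formula. -/
theorem second_variation (hlag : K.IsLagrangian (φ 0)) (hmin : K.IsMinimal (φ 0))
    (hf : ContMDiff (𝓡 n) 𝓘(ℝ, ℝ) ∞ f) (hX : ∀ x, velocity φ 0 x = K.JGrad (φ 0) f x)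
    {R : ℝ} (hR : K.IsEinstein R) :
    ContDiffAt ℝ 2 (fun s => K.vol (φ s)) 0 ∧ iteratedDeriv 2 (fun s => K.vol (φ s)) 0
      = ∫ x, laplacian (K.inducedMetric (φ 0)) f x ^ 2 ∂(riemannianMeasure (K.inducedMetric (φ 0)))
        - R / (2 * n) * ∫ x, formInner (K.inducedMetric (φ 0)) (dForm f) (dForm f) x
          ∂(riemannianMeasure (K.inducedMetric (φ 0))) := by
  obtain ⟨t, ρ, hρ, hsub, hsum⟩ := exists_finite_partition n L
  have h0 := hφ.zero_mem hη
  have hh := hφ.smoothMetric h0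
  set h := K.inducedMetric (φ 0) with hdef
  have hβ := hφ.smoothForm_accelerationForm hη
  have hΔ := hh.contMDiff_laplacian hf
  have hfam := fun i => hφ.smoothFamily (chart_mem_atlas (Euc n) i) (hρ i) (hsub i)
  have hC := fun i => (hfam i).contDiffAt_integral h0
  have hev : (fun s => K.vol (φ s)) =ᶠ[𝓝 0] fun s => ∑ i ∈ t,
      ∫ y in (chartAt (Euc n) i).target,
        density (inChart (K.inducedMetric (φ s)) (chartAt (Euc n) i) y)
          * ρ i ((chartAt (Euc n) i).symm y) := by
    filter_upwards [isOpen_Ioo.mem_nhds h0] with s hs using hφ.vol_eq_sum hρ hsub hsum hs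
  refine ⟨(ContDiffAt.sum fun i _ => (hC i).1).congr_of_eventuallyEq hev, ?_⟩
  -- `Q` does not depend on the chart, so the localized second derivatives `∫ ρ i Q` add up to `∫
  -- Q`.
  set Q : L → ℝ := fun x => divForm h (K.accelerationForm φ) x
    - formInner h (dForm (laplacian h f)) (dForm f) x
    - R / (2 * n) * formInner h (dForm f) (dForm f) x with hQ
  have i1 : Integrable (divForm h (K.accelerationForm φ)) (riemannianMeasure h) :=
    hh.integrable (hh.contMDiff_divForm hβ).continuous
  have i2 := hh.integrable_formInner hΔ hf
  have i3 := hh.integrable_formInner hf hf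
  have hQc : Continuous Q :=
    ((hh.contMDiff_divForm hβ).continuous.sub
      (hh.contMDiff_formInner (smoothForm_dForm hΔ) (smoothForm_dForm hf)).continuous).sub
      (continuous_const.mul
        (hh.contMDiff_formInner (smoothForm_dForm hf) (smoothForm_dForm hf)).continuous)
  have hterm : ∀ i, iteratedDeriv 2 (fun s => ∫ y in (chartAt (Euc n) i).target,
        density (inChart (K.inducedMetric (φ s)) (chartAt (Euc n) i) y)
          * ρ i ((chartAt (Euc n) i).symm y)) 0 = ∫ x, ρ i x * Q x ∂(riemannianMeasure h) := by
    intro i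
    refine (hC i).2.trans ?_
    have hs : ∫ x, ρ i x * Q x ∂(riemannianMeasure h) = _ :=
      hh.integral_of_support (u := fun x => ρ i x * Q x) (chart_mem_atlas _ i)
        ((hρ i).continuous.mul hQc).continuousOn fun x hx => by
          rw [image_eq_zero_of_notMem_tsupport fun h => hx (hsub i h), zero_mul]
    rw [hs]
    refine setIntegral_congr_fun (chartAt (Euc n) i).open_target.measurableSet fun y hy => ?_
    exact hφ.fderiv_fderiv_density hη hlag hmin hf hX hR (chart_mem_atlas _ i) (hρ i) (hsub i) hy
  have hsumd : iteratedDeriv 2 (fun s => K.vol (φ s)) 0 = ∫ x, Q x ∂(riemannianMeasure h) := by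
    rw [hev.iteratedDeriv_eq, iteratedDeriv_fun_sum fun i _ => (hC i).1]
    have hint : ∀ i ∈ t, Integrable (fun x => ρ i x * Q x) (riemannianMeasure h) :=
      fun i _ => hh.integrable ((hρ i).continuous.mul hQc)
    simp only [hterm]
    rw [← integral_finsetSum t hint]
    simp only [← Finset.sum_mul, hsum, one_mul]
  -- The acceleration enters only through a divergence, which integrates to zero. Green's formula
  -- then turns `-∫ ⟨dΔf, df⟩` into `∫ (Δf)²`.
  have j1 : ∫ x, divForm h (K.accelerationForm φ) x ∂(riemannianMeasure h) = 0 := by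
    have := hh.integral_mul_divForm (u := fun _ => (1 : ℝ)) hβ contMDiff_const
    simpa [formInner, dForm_const] using this
  have j2 := hh.integral_mul_laplacian hΔ hf
  have i12 : Integrable (fun x => divForm h (K.accelerationForm φ) x
    - formInner h (dForm (laplacian h f)) (dForm f) x) (riemannianMeasure h) := i1.sub i2
  rw [hsumd, hQ, integral_sub i12 (i3.const_mul _), integral_sub i1 i2, integral_const_mul, j1]
  simp only [sq, j2]
  ring

end KahlerStructure.IsHamiltonianDeformation

end LagVar

end

/-! ### The criterion for essential variations. -/

open LagVar

theorem mainTheorem6 {n : ℕ}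
    {M : Type*} [TopologicalSpace M] [T2Space M] [SecondCountableTopology M]
    [ChartedSpace (Euc (2 * n)) M] [IsManifold (𝓡 (2 * n)) ∞ M]
    (K : KahlerStructure n M) (R : ℝ) (hR : K.IsEinstein R)
    {L : Type*} [TopologicalSpace L] [T2Space L] [CompactSpace L] [ConnectedSpace L]
    [ChartedSpace (Euc n) L] [IsManifold (𝓡 n) ∞ L] [MeasurableSpace L] [BorelSpace L]
    (η : ℝ) (hη : 0 < η) (φ : ℝ → L → M) (hφ : K.IsHamiltonianDeformation η φ)
    (hlag : K.IsLagrangian (φ 0)) (hmin : K.IsMinimal (φ 0))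
    (hlam : IsFirstEigenvalue (K.inducedMetric (φ 0)) (R / (2 * n)))
    (f : L → ℝ) (hf : ContMDiff (𝓡 n) 𝓘(ℝ, ℝ) ∞ f)
    (hX : ∀ x, KahlerStructure.velocity φ 0 x = K.JGrad (φ 0) f x) :
    ContDiffAt ℝ 2 (fun s => K.vol (φ s)) 0 ∧
      (K.IsEssentialVariation (φ 0) (KahlerStructure.velocity φ 0) ↔
        0 < iteratedDeriv 2 (fun s => K.vol (φ s)) 0) := by
  have h0 := hφ.zero_mem hη
  have hh := hφ.smoothMetric h0
  have hfin := hh.isFiniteMeasure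
  -- The formula is kept for every potential `u` of the velocity, since an essential variation comes
  -- with its own potential.
  have sv := fun (u : L → ℝ) hu hXu => hφ.second_variation (f := u) hη hlag hmin hu hXu hR
  refine ⟨(sv f hf hX).1, ?_, fun hpos => ?_⟩
  · rintro ⟨-, u, hu, hmean, hXu, lam, hlam', hmem⟩
    obtain rfl := hlam'.unique hlam
    rw [hh.mem_eigenspace_iff hlam hu hmean, ← (sv u hu hXu).2] at hmem
    refine lt_of_le_of_ne ?_ (Ne.symm hmem)
    rw [(sv u hu hXu).2]
    exact sub_nonneg.2 (hh.spectral_gap hlam hu).1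
  -- Subtracting the mean normalizes the potential without changing its gradient.
  · set c : ℝ := (∫ x, f x ∂(riemannianMeasure (K.inducedMetric (φ 0))))
      / (riemannianMeasure (K.inducedMetric (φ 0))).real univ
    have hu : ContMDiff (𝓡 n) 𝓘(ℝ, ℝ) ∞ (fun x => f x - c) := hf.sub contMDiff_const
    have hXu : ∀ x, KahlerStructure.velocity φ 0 x = K.JGrad (φ 0) (fun x => f x - c) x := by
      intro x
      have hd : dForm (m := n) (fun x => f x - c) x = dForm f x := by
        simp only [sub_eq_add_neg]
        rw [dForm_add hf contMDiff_const, dForm_const, add_zero]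
      have hg : grad (K.inducedMetric (φ 0)) (fun x => f x - c) x
          = grad (K.inducedMetric (φ 0)) f x :=
        congrArg (fiberForm (K.inducedMetric (φ 0)) x).inverse hd
      rw [hX x, KahlerStructure.JGrad, KahlerStructure.JGrad, hg]
    have hmean : ∫ x, f x - c ∂(riemannianMeasure (K.inducedMetric (φ 0))) = 0 := by
      rw [integral_sub (hh.integrable hf.continuous) (integrable_const c), integral_const,
        smul_eq_mul, mul_div_cancel₀ _ hh.real_univ_pos.ne', sub_self]
    refine ⟨?_, fun x => f x - c, hu, hmean, hXu, _, hlam, ?_⟩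
    -- If the velocity vanished, the zero function would be a potential; it lies in the eigenspace,
    -- so the second derivative would be zero.
    · by_contra! hzero
      have hX0 : ∀ x, KahlerStructure.velocity φ 0 x = K.JGrad (φ 0) (fun _ => (0 : ℝ)) x := by
        intro x
        rw [hzero x, KahlerStructure.JGrad, grad, mfderiv_const]
        erw [map_zero, map_zero, map_zero]
      have hz := (sv (fun _ => 0) contMDiff_const hX0).2
      have hE : (fun _ : L => (0 : ℝ)) ∈ eigenspace (K.inducedMetric (φ 0)) (R / (2 * n)) :=
        ⟨MemLp.zero', fun v _ => by simp⟩
      rw [hh.mem_eigenspace_iff hlam contMDiff_const (by simp), ← hz] at hE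
      exact hpos.ne' hE
    · rw [hh.mem_eigenspace_iff hlam hu hmean, ← (sv _ hu hXu).2]
      exact hpos.ne'
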